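/- Let $m\ge 1$ be a square-free integer and $\ell\ge 1$ an integer. Put $S=\begin{pmatrix}2&0\\0&2m\end{pmatrix}$ if $m\equiv 1,2 \pmod 4$ and $S=\begin{pmatrix}2&1\\1&(m+1)/2\end{pmatrix}$ if $m\equiv 3\pmod 4$, and $S_0=\begin{pmatrix}&&1\\&-S&\\1&&\end{pmatrix}$. Let $V_0=\mathbb{Q}^4$, $\phi_0(x,y)=\tfrac12 x^tS_0y$, $\phi_0[x]=\phi_0(x,x)$, $L_0=\mathbb{Z}^4$, and $$L_0[\ell,2^{-1}\mathbb{Z}]=\{x\in V_0:\ \phi_0[x]=\ell,\ \phi_0(x,L_0)=2^{-1}\mathbb{Z}\}.$$ Let $\mathrm{SO}(V_0)$ be the group of isometries of $(V_0,\phi_0)$ of determinant $1$, $\Gamma(L_0)=\{g\in \mathrm{SO}(V_0): gL_0=L_0\}$ and $\widehat\Gamma(L_0)=\{g\in\Gamma(L_0): g\in 1_4+M_4(\mathbb{Z})S_0\}$; both act on $L_0[\ell,2^{-1}\mathbb{Z}]$. Let $\xi=(1,0,0,\ell)\in L_0[\ell,2^{-1}\mathbb{Z}]$, $\widetilde W=\{x\in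 V_0:\phi_0(x,\xi)=0\}$ and $\widetilde H(\xi)=\mathrm{SO}(\widetilde W)$, identified with the stabiliser of $\xi$ in $\mathrm{SO}(V_0)$. For a quadratic space $(V,\phi)$, let $A(V)$ be its Clifford algebra ($v^2=\phi[v]$) and $G^+(V)=\{\alpha\in A^+(V)^\times:\alpha V\alpha^{-1}=V\}$ its even Clifford group, let $\tau(\alpha)x=\alpha x\alpha^{-1}$, which defines a homomorphism $\tau:G^+(V)\to \mathrm{SO}(V)$, and let $\nu(\alpha)=\alpha\alpha^*$, where $*$ is the anti-automorphism of $A(V)$ fixing $V$. View $G^+(\widetilde W)\subset G^+(V_0)$. Subscripts $p$, $\infty$, $\mathbb{A}$ denote localisations over $\mathbb{Q}_p$ and $\mathbb{R}$ and adelisations, and groups of rational points are embedded diagonally. Put $$\widetilde C_p=\{g\in \mathrm{SO}(V_0)_p: g(L_0)_p=(L_0)_p\},\qquad \widetilde J_p=\{\gamma\in G^+(V_0)_p:\tau(\gamma)\in\widetilde C_p,\ \nu(\gamma)\in\mathbb{Z}_p^\times\},$$ $\widetilde C=\mathrm{SO}(V_0)_\infty\prod_p\widetilde C_p$ and $\widetilde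 J=G^+(V_0)_\infty\prod_p\widetilde J_p$. Then: (a) For every $\epsilon\in G^+(\widetilde W)_{\mathbb{A}}$ there is $\alpha\in G^+(V_0)$ with $\epsilon\in\alpha\widetilde J$, and $\epsilon\mapsto\widehat\Gamma(L_0)\,\tau(\alpha)^{-1}\xi$ (for any such $\alpha$) gives a well-defined bijection $$\kappa: G^+(\widetilde W)_{\mathbb{Q}}\backslash G^+(\widetilde W)_{\mathbb{A}}/(G^+(\widetilde W)_{\mathbb{A}}\cap\widetilde J)\longrightarrow L_0[\ell,2^{-1}\mathbb{Z}]/\widehat\Gamma(L_0).$$ (b) For every $\epsilon'\in\widetilde H(\xi)_{\mathbb{A}}$ there is $\alpha'\in \mathrm{SO}(V_0)$ with $\epsilon'\in\alpha'\widetilde C$, and $\epsilon'\mapsto\Gamma(L_0)\,(\alpha')^{-1}\xi$ (for any such $\alpha'$) gives a well-defined bijection $$\lambda: \widetilde H(\xi)_{\mathbb{Q}}\backslash \widetilde H(\xi)_{\mathbb{A}}/(\widetilde H(\xi)_{\mathbb{A}}\cap\widetilde C)\longrightarrow L_0[\ell,2^{-1}\mathbb{Z}]/\Gamma(L_0).$$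 (c) With $\iota:L_0[\ell,2^{-1}\mathbb{Z}]/\widehat\Gamma(L_0)\to L_0[\ell,2^{-1}\mathbb{Z}]/\Gamma(L_0)$, $\widehat\Gamma(L_0)v\mapsto\Gamma(L_0)v$, and with $\tau$ also denoting the map it induces from the double cosets in (a) to those in (b), one has $\lambda\circ\tau=\iota\circ\kappa$. -/

import Mathlib

set_option linter.unusedSectionVars false
set_option linter.style.haveILetI false

namespace QuadSpace
open CliffordAlgebra

section Generic
variable {F M : Type*} [Field F] [CharZero F] [AddCommGroup M] [Module F M]

theorem ι_inj (Q : QuadraticForm F M) : Function.Injective (ι Q) := by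
  haveI : Invertible (2 : F) := invertibleOfNonzero two_ne_zero
  intro x y h
  have := congrArg (equivExterior Q) h
  simp only [equivExterior, changeFormEquiv_apply, changeForm_ι] at this
  exact (ExteriorAlgebra.ι_leftInverse (R := F) (M := M)).injective this

theorem algebraMap_inj (Q : QuadraticForm F M) :
    Function.Injective (algebraMap F (CliffordAlgebra Q)) := by
  haveI : Invertible (2 : F) := invertibleOfNonzero two_ne_zero
  exact (algebraMap F (CliffordAlgebra Q)).injective

theorem ι_mul_prod (Q : QuadraticForm F M) (a : M) (l : List M)
    (h : ∀ b ∈ l, Q.IsOrtho a b) :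
    ι Q a * (l.map (ι Q)).prod = (-1 : F) ^ l.length • ((l.map (ι Q)).prod * ι Q a) := by
  induction l with
  | nil => simp
  | cons b l ih =>
    have hb := h b (by simp)
    have hl := ih (fun c hc => h c (by simp [hc]))
    simp only [List.map_cons, List.prod_cons, List.length_cons]
    rw [← mul_assoc, ι_mul_ι_comm_of_isOrtho hb, neg_mul, mul_assoc, hl, pow_succ]
    simp [mul_assoc]

theorem contract_prod (d : Module.Dual F M) (Q : QuadraticForm F M)
    (l : List M) (h : ∀ b ∈ l, d b = 0) : contractLeft d ((l.map (ι Q)).prod) = 0 := by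
  induction l with
  | nil => simp
  | cons b l ih =>
    simp only [List.map_cons, List.prod_cons]
    rw [contractLeft_ι_mul, h b (by simp), ih (fun c hc => h c (by simp [hc]))]
    simp

theorem equivExterior_prod [Invertible (2 : F)] (Q : QuadraticForm F M) (l : List M)
    (h : l.Pairwise Q.IsOrtho) :
    equivExterior Q ((l.map (ι Q)).prod) = (l.map (ExteriorAlgebra.ι F)).prod := by
  induction l with
  | nil => simp [equivExterior]
  | cons b l ih =>
    rw [List.pairwise_cons] at h
    simp only [List.map_cons, List.prod_cons]
    rw [← ih h.2]
    simp only [equivExterior, changeFormEquiv_apply] at ih ⊢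
    rw [changeForm_ι_mul, ih h.2]
    have := contract_prod (QuadraticMap.associated (R := F) (-Q) b) (0 : QuadraticForm F M) l (by
      intro c hc
      have h1 : QuadraticMap.associated Q b c = 0 :=
        QuadraticMap.associated_isOrtho.mpr (h.1 c hc)
      rw [map_neg]
      simp [h1])
    erw [this]
    rw [sub_zero]

theorem even_comm_of_ι (Q : QuadraticForm F M) (z : CliffordAlgebra Q) (s : F)
    (hs : s = 1 ∨ s = -1) (hz : ∀ v, ι Q v * z = s • (z * ι Q v)) (x : CliffordAlgebra Q)
    (hx : involute x = x) : x * z = z * x := by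
  rcases hs with rfl | rfl
  · clear hx
    induction x using CliffordAlgebra.induction with
    | algebraMap r => exact Algebra.commutes r z
    | ι v => simpa using hz v
    | mul a b ha hb => rw [mul_assoc, hb, ← mul_assoc, ha, mul_assoc]
    | add a b ha hb => rw [add_mul, mul_add, ha, hb]
  · have key : ∀ x : CliffordAlgebra Q, x * z = z * involute x := by
      intro x
      induction x using CliffordAlgebra.induction with
      | algebraMap r => rw [AlgHom.commutes]; exact Algebra.commutes r z
      | ι v => simpa using hz v
      | mul a b ha hb => rw [map_mul, mul_assoc, hb, ← mul_assoc, ha, mul_assoc]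
      | add a b ha hb => rw [add_mul, map_add, mul_add, ha, hb]
    rw [key x, hx]

/-- `SO(M, Q)`: the isometries of determinant one. -/
def specialOrthogonal (Q : QuadraticForm F M) : Subgroup (M ≃ₗ[F] M) where
  carrier := {g | (∀ x, Q (g x) = Q x) ∧ LinearEquiv.det g = 1}
  one_mem' := ⟨fun _ => rfl, map_one _⟩
  mul_mem' := fun {a b} ha hb =>
    ⟨fun x => by rw [LinearEquiv.mul_apply, ha.1, hb.1], by rw [map_mul, ha.2, hb.2, one_mul]⟩
  inv_mem' := fun {a} ha =>
    ⟨fun x => by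
      rw [← ha.1 (a⁻¹ x), ← LinearEquiv.mul_apply, mul_inv_cancel, LinearEquiv.coe_one, id],
     by rw [map_inv, ha.2, inv_one]⟩

/-- The even Clifford group `G⁺(M, Q)`: even units `α` with `α M α⁻¹ = M`. -/
def evenCliffordGroup (Q : QuadraticForm F M) : Subgroup (CliffordAlgebra Q)ˣ where
  carrier := {α | involute (α : CliffordAlgebra Q) = α ∧
    ∀ y : CliffordAlgebra Q,
      (α : CliffordAlgebra Q) * y * (α⁻¹ : (CliffordAlgebra Q)ˣ) ∈ LinearMap.range (ι Q) ↔
        y ∈ LinearMap.range (ι Q)}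
  one_mem' := ⟨by simp, fun y => by simp⟩
  mul_mem' := fun {a b} ha hb => ⟨by simp [ha.1, hb.1], fun y => by
    rw [← hb.2 y, ← ha.2 ((b : CliffordAlgebra Q) * y * (b⁻¹ : (CliffordAlgebra Q)ˣ))]
    simp only [Units.val_mul, mul_inv_rev, mul_assoc]⟩
  inv_mem' := fun {a} ha => ⟨by
      have h1 : involute (a : CliffordAlgebra Q) * involute ((a⁻¹ : (CliffordAlgebra Q)ˣ) :
          CliffordAlgebra Q) = 1 := by rw [← map_mul]; simp
      rw [ha.1] at h1
      exact (Units.inv_eq_of_mul_eq_one_right h1).symm,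
    fun y => by
      rw [← ha.2]
      simp [mul_assoc]⟩

variable {Q : QuadraticForm F M}

/-- Conjugation by `α`, as a linear map `M → M`. -/
noncomputable def tauLinear (α : evenCliffordGroup Q) : M →ₗ[F] M :=
  (LinearEquiv.ofInjective (ι Q) (ι_inj Q)).symm.toLinearMap ∘ₗ
    LinearMap.codRestrict (LinearMap.range (ι Q))
      (LinearMap.mulRight F ((α.1⁻¹ : (CliffordAlgebra Q)ˣ) : CliffordAlgebra Q) ∘ₗ
        LinearMap.mulLeft F (α.1 : CliffordAlgebra Q) ∘ₗ ι Q)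
      (fun x => (α.2.2 (ι Q x)).2 ⟨x, rfl⟩)

theorem ι_tauLinear (α : evenCliffordGroup Q) (x : M) :
    ι Q (tauLinear α x) =
      (α.1 : CliffordAlgebra Q) * ι Q x * (α.1⁻¹ : (CliffordAlgebra Q)ˣ) := by
  have := LinearEquiv.apply_symm_apply (LinearEquiv.ofInjective (ι Q) (ι_inj Q))
    (LinearMap.codRestrict (LinearMap.range (ι Q))
      (LinearMap.mulRight F ((α.1⁻¹ : (CliffordAlgebra Q)ˣ) : CliffordAlgebra Q) ∘ₗ
        LinearMap.mulLeft F (α.1 : CliffordAlgebra Q) ∘ₗ ι Q)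
      (fun x => (α.2.2 (ι Q x)).2 ⟨x, rfl⟩) x)
  exact congrArg Subtype.val this

theorem tauLinear_mul (α β : evenCliffordGroup Q) :
    tauLinear (α * β) = tauLinear α * tauLinear β := by
  ext x
  apply ι_inj Q
  rw [Module.End.mul_apply, ι_tauLinear, ι_tauLinear, ι_tauLinear]
  simp [mul_assoc]

theorem tauLinear_one : tauLinear (1 : evenCliffordGroup Q) = 1 := by
  ext x
  apply ι_inj Q
  rw [ι_tauLinear]
  simp

theorem tauLinear_isometry (α : evenCliffordGroup Q) (x : M) : Q (tauLinear α x) = Q x := by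
  apply algebraMap_inj Q
  rw [← ι_sq_scalar, ι_tauLinear]
  calc _ = (α.1 : CliffordAlgebra Q) * (ι Q x * ι Q x) * (α.1⁻¹ : (CliffordAlgebra Q)ˣ) := by
        simp only [mul_assoc, Units.inv_mul_cancel_left]
    _ = _ := by rw [ι_sq_scalar, ← Algebra.commutes, mul_assoc, Units.mul_inv, mul_one]

theorem ι_prod_tauLinear (α : evenCliffordGroup Q) (l : List M) :
    ((l.map (tauLinear α)).map (ι Q)).prod =
      (α.1 : CliffordAlgebra Q) * (l.map (ι Q)).prod * (α.1⁻¹ : (CliffordAlgebra Q)ˣ) := by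
  induction l with
  | nil => simp
  | cons b l ih =>
    simp only [List.map_cons, List.prod_cons]
    rw [ih, ι_tauLinear]
    simp [mul_assoc]

theorem det_tauLinear_of_basis {n : ℕ} (e : Module.Basis (Fin n) F M)
    (ho : ∀ i j, i ≠ j → Q.IsOrtho (e i) (e j)) (α : evenCliffordGroup Q) :
    LinearMap.det (tauLinear α) = 1 := by
  haveI : Invertible (2 : F) := invertibleOfNonzero two_ne_zero
  have hto : ∀ x y, Q.IsOrtho x y → Q.IsOrtho (tauLinear α x) (tauLinear α y) := by
    intro x y h
    unfold QuadraticMap.IsOrtho at *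
    rw [← map_add, tauLinear_isometry, tauLinear_isometry, tauLinear_isometry, h]
  set l : List M := List.ofFn e with hl
  set z := (l.map (ι Q)).prod with hz
  have hpw : l.Pairwise Q.IsOrtho := by
    rw [hl, List.pairwise_ofFn]
    exact fun i j hij => ho i j hij.ne
  -- the ordered product of the basis vectors commutes with even elements
  have hanti : ∀ v, ι Q v * z = (-1 : F) ^ (n + 1) • (z * ι Q v) := by
    suffices h : LinearMap.mulRight F z ∘ₗ ι Q =
        (-1 : F) ^ (n + 1) • (LinearMap.mulLeft F z ∘ₗ ι Q) from
      fun v => LinearMap.congr_fun h v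
    refine e.ext fun i => ?_
    change ι Q (e i) * z = (-1 : F) ^ (n + 1) • (z * ι Q (e i))
    · obtain ⟨l₁, l₂, hsplit⟩ := List.append_of_mem (show e i ∈ l by rw [hl]; simp)
      have hlen : l₁.length + l₂.length + 1 = n := by
        have := congrArg List.length hsplit
        simp [hl] at this
        omega
      rw [hsplit, List.pairwise_append, List.pairwise_cons] at hpw
      have h1 := ι_mul_prod Q (e i) l₁ (fun b hb =>
        QuadraticMap.IsOrtho.symm (hpw.2.2 b hb (e i) (by simp)))
      have h2 := ι_mul_prod Q (e i) l₂ hpw.2.1.1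
      rw [hz, hsplit]
      simp only [List.map_append, List.map_cons, List.prod_append, List.prod_cons]
      rw [← mul_assoc, h1]
      have h3 : (l₂.map (ι Q)).prod * ι Q (e i) =
          (-1 : F) ^ l₂.length • (ι Q (e i) * (l₂.map (ι Q)).prod) := by
        rw [h2, smul_smul, ← mul_pow]; simp
      rw [mul_assoc (l₁.map (ι Q)).prod _ (ι Q (e i)), mul_assoc (ι Q (e i)) _ (ι Q (e i)), h3]
      simp only [mul_smul_comm, smul_mul_assoc, smul_smul, mul_assoc]
      congr 1
      rw [← pow_add, ← hlen, neg_one_pow_eq_pow_mod_two,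
        neg_one_pow_eq_pow_mod_two (n := l₁.length + l₂.length + 1 + 1 + l₂.length)]
      congr 1
      omega
  have hcomm := even_comm_of_ι Q z ((-1 : F) ^ (n + 1)) (neg_one_pow_eq_or F _) hanti
    (α.1 : CliffordAlgebra Q) α.2.1
  have hfix : ((l.map (tauLinear α)).map (ι Q)).prod = z := by
    rw [ι_prod_tauLinear, ← hz, hcomm, mul_assoc]; simp
  have hext := congrArg (equivExterior Q) hfix
  rw [hz, equivExterior_prod Q l hpw, equivExterior_prod Q (l.map (tauLinear α)) (by
    rw [List.pairwise_map]
    exact hpw.imp (fun h => hto _ _ h)), hl, List.map_ofFn, List.map_ofFn, List.map_ofFn] at hext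
  have h4 : ExteriorAlgebra.ιMulti F n (tauLinear α ∘ e) = ExteriorAlgebra.ιMulti F n e := by
    rw [ExteriorAlgebra.ιMulti_apply, ExteriorAlgebra.ιMulti_apply]
    exact hext
  have h5 := congrArg (ExteriorAlgebra.liftAlternating (R := F) (M := M) (N := F)
    (Function.update (fun _ => 0) n e.det)) h4
  rw [ExteriorAlgebra.liftAlternating_apply_ιMulti, ExteriorAlgebra.liftAlternating_apply_ιMulti,
    Function.update_self, Module.Basis.det_comp, Module.Basis.det_self, mul_one] at h5
  exact h5

theorem det_tauLinear [FiniteDimensional F M] (α : evenCliffordGroup Q) :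
    LinearMap.det (tauLinear α) = 1 := by
  haveI : Invertible (2 : F) := invertibleOfNonzero two_ne_zero
  obtain ⟨e, he⟩ := LinearMap.BilinForm.exists_orthogonal_basis
    (B := QuadraticMap.associated Q) ⟨QuadraticMap.associated_isSymm F Q⟩
  exact det_tauLinear_of_basis e
    (fun i j hij => QuadraticMap.associated_isOrtho.mp (he hij)) α

/-- The homomorphism `τ : G⁺(M) → SO(M)`, characterised by `τ(α)x = α x α⁻¹`. -/
noncomputable def tau [FiniteDimensional F M] : evenCliffordGroup Q →* specialOrthogonal Q where
  toFun α := ⟨LinearEquiv.ofLinearMap (tauLinear α) (tauLinear α⁻¹)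
      (by rw [← Module.End.mul_eq_comp, ← tauLinear_mul, mul_inv_cancel, tauLinear_one]; rfl)
      (by rw [← Module.End.mul_eq_comp, ← tauLinear_mul, inv_mul_cancel, tauLinear_one]; rfl),
    tauLinear_isometry α, Units.ext (by
      rw [LinearEquiv.coe_det, Units.val_one, ← det_tauLinear α]; rfl)⟩
  map_one' := by ext x; exact LinearMap.congr_fun tauLinear_one x
  map_mul' α β := by ext x; exact LinearMap.congr_fun (tauLinear_mul α β) x

theorem ι_tau [FiniteDimensional F M] (α : evenCliffordGroup Q) (x : M) :
    ι Q ((tau α).1 x) = (α.1 : CliffordAlgebra Q) * ι Q x * (α.1⁻¹ : (CliffordAlgebra Q)ˣ) :=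
  ι_tauLinear α x

/-- The stabiliser `{g ∈ SO(M) | gL = L}` of a lattice `L`. -/
def stabilizer (Q : QuadraticForm F M) (L : AddSubgroup M) : Subgroup (specialOrthogonal Q) where
  carrier := {g | ∀ x, g.1 x ∈ L ↔ x ∈ L}
  one_mem' := fun _ => Iff.rfl
  mul_mem' := fun {a b} ha hb x => (ha (b.1 x)).trans (hb x)
  inv_mem' := fun {a} ha x => by
    rw [← ha]
    have : a.1 ((a⁻¹).1 x) = x := LinearEquiv.apply_symm_apply a.1 x
    rw [this]

/-- `A(L)`: the subring of the Clifford algebra generated by the lattice `L` and the ring `O`. -/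
def latticeOrder (Q : QuadraticForm F M) (O : Subring F) (L : AddSubgroup M) :
    Subring (CliffordAlgebra Q) :=
  Subring.closure (ι Q '' L ∪ algebraMap F (CliffordAlgebra Q) '' O)

/-- The integral points of `G⁺(M)` relative to `L`: the stabiliser of both `A(L)` (acted on by left
multiplication) and `L` (acted on through `τ`). -/
noncomputable def integralCliffordGroup [FiniteDimensional F M] (Q : QuadraticForm F M)
    (O : Subring F) (L : AddSubgroup M) : Subgroup (evenCliffordGroup Q) where
  carrier := {α | (α.1 : CliffordAlgebra Q) ∈ latticeOrder Q O L ∧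
    ((α.1⁻¹ : (CliffordAlgebra Q)ˣ) : CliffordAlgebra Q) ∈ latticeOrder Q O L ∧
    tau α ∈ stabilizer Q L}
  one_mem' := ⟨by simp, by simp, by
    rw [map_one]; exact one_mem _⟩
  mul_mem' := fun {a b} ha hb => ⟨by simpa using mul_mem ha.1 hb.1,
    by simpa using mul_mem hb.2.1 ha.2.1, by rw [map_mul]; exact mul_mem ha.2.2 hb.2.2⟩
  inv_mem' := fun {a} ha => ⟨ha.2.1, by simpa using ha.1, by
    rw [map_inv]; exact inv_mem ha.2.2⟩

/-- `{γ ∈ G⁺(M) | τ(γ)L = L, ν(γ) ∈ O^×}`, where `ν(γ) = γ γ^*`, and `*` (`reverse`) is the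
anti-automorphism of the Clifford algebra that fixes vectors. -/
noncomputable def unitNormStabilizer [FiniteDimensional F M] (Q : QuadraticForm F M)
    (O : Subring F) (L : AddSubgroup M) : Subgroup (evenCliffordGroup Q) where
  carrier := {γ | tau γ ∈ stabilizer Q L ∧
    ∃ u : Oˣ, (γ.1 : CliffordAlgebra Q) * reverse (γ.1 : CliffordAlgebra Q) =
      algebraMap F (CliffordAlgebra Q) (u : O)}
  one_mem' := ⟨by rw [map_one]; exact one_mem _, 1, by simp⟩
  mul_mem' := by
    rintro a b ⟨ha, u, hu⟩ ⟨hb, v, hv⟩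
    refine ⟨by rw [map_mul]; exact mul_mem ha hb, u * v, ?_⟩
    have : ((a * b : evenCliffordGroup Q).1 : CliffordAlgebra Q) = a.1 * b.1 := by simp
    rw [this, reverse.map_mul, mul_assoc, ← mul_assoc (b.1 : CliffordAlgebra Q), hv,
      Algebra.commutes, ← mul_assoc, hu, ← map_mul]
    simp
  inv_mem' := by
    rintro a ⟨ha, u, hu⟩
    refine ⟨by rw [map_inv]; exact inv_mem ha, u⁻¹, ?_⟩
    set c : CliffordAlgebra Q := (a.1 : CliffordAlgebra Q)
    set d : CliffordAlgebra Q := ((a.1⁻¹ : (CliffordAlgebra Q)ˣ) : CliffordAlgebra Q) with hd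
    have hdc : d * c = 1 := a.1.inv_mul
    have hcd : c * d = 1 := a.1.mul_inv
    have hrev : reverse c = d * algebraMap F _ ((u : O) : F) := by
      rw [← hu, ← mul_assoc, hdc, one_mul]
    have h1 : reverse d * reverse c = 1 := by rw [← reverse.map_mul, hcd, reverse.map_one]
    have hui : ((u : O) : F) * (((u⁻¹ : Oˣ) : O) : F) = 1 := by
      rw [← Subring.coe_mul, Units.mul_inv]; rfl
    have h2 : reverse c * (c * algebraMap F _ (((u⁻¹ : Oˣ) : O) : F)) = 1 := by
      rw [hrev, mul_assoc, ← mul_assoc _ c, Algebra.commutes, mul_assoc c, ← map_mul, hui, map_one,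
        mul_one, hdc]
    have h3 : reverse d = c * algebraMap F _ (((u⁻¹ : Oˣ) : O) : F) := by
      calc reverse d = reverse d * (reverse c * (c * algebraMap F _ (((u⁻¹ : Oˣ) : O) : F))) := by
            rw [h2, mul_one]
        _ = _ := by rw [← mul_assoc, h1, one_mul]
    change d * reverse d = _
    rw [h3, ← mul_assoc, hdc, one_mul]

end Generic

open CliffordAlgebra

/-! ### The quadratic space `(V₀, φ₀)` over a field `F ⊇ ℚ` and the orthogonal complement of `ξ` -/

/-- The binary even matrix `S` attached to the square-free integer `m`. -/
def matS (m : ℕ) : Matrix (Fin 2) (Fin 2) ℤ :=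
  if m % 4 = 3 then !![2, 1; 1, ((m : ℤ) + 1) / 2] else !![2, 0; 0, 2 * (m : ℤ)]

/-- The matrix `S₀`, with `-S` in the middle block and `1` in the two outer antidiagonal corners. -/
def matS0 (m : ℕ) : Matrix (Fin 4) (Fin 4) ℤ :=
  !![0, 0, 0, 1;
     0, -matS m 0 0, -matS m 0 1, 0;
     0, -matS m 1 0, -matS m 1 1, 0;
     1, 0, 0, 0]

section Field
variable (F : Type*) [Field F] [CharZero F] (m ℓ : ℕ)

/-- `φ₀(x, y) = ½ xᵗ S₀ y` on `V₀ ⊗ F = F⁴`. -/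
noncomputable def phi : LinearMap.BilinForm F (Fin 4 → F) :=
  (2 : F)⁻¹ • Matrix.toBilin' ((matS0 m).map (Int.cast : ℤ → F))

theorem phi_symm (x y : Fin 4 → F) : phi F m x y = phi F m y x := by
  have hs : matS m 0 1 = matS m 1 0 := by unfold matS; split_ifs <;> rfl
  simp only [phi, LinearMap.smul_apply, Matrix.toBilin'_apply, Fin.sum_univ_four, matS0,
    Matrix.map_apply]
  simp [hs]
  ring

/-- `φ₀[x] = φ₀(x, x)`. -/
noncomputable def quad : QuadraticForm F (Fin 4 → F) := (phi F m).toQuadraticMap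

/-- The vector `ξ = (1, 0, 0, ℓ)`. -/
def xi : Fin 4 → F := ![1, 0, 0, (ℓ : F)]

/-- `W ⊗ F = {x ∈ F⁴ | φ₀(x, ξ) = 0}`. -/
noncomputable def W : Submodule F (Fin 4 → F) where
  carrier := {x | phi F m x (xi F ℓ) = 0}
  zero_mem' := by simp
  add_mem' := fun {a b} ha hb => by
    change phi F m _ _ = 0 at *; rw [map_add, LinearMap.add_apply, ha, hb, add_zero]
  smul_mem' := fun c x hx => by
    change phi F m _ _ = 0 at *; rw [map_smul, LinearMap.smul_apply, hx, smul_zero]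

/-- The restriction of `φ₀` to `W`. -/
noncomputable def quadW : QuadraticForm F (W F m ℓ) := (quad F m).comp (W F m ℓ).subtype

/-- The inclusion of quadratic spaces `W ⊂ V₀`. -/
noncomputable def inclW : quadW F m ℓ →qᵢ quad F m where
  toLinearMap := (W F m ℓ).subtype
  map_app' := fun _ => rfl

/-- The induced map of Clifford algebras `A(W) → A(V₀)`. -/
noncomputable def clifIncl : CliffordAlgebra (quadW F m ℓ) →ₐ[F] CliffordAlgebra (quad F m) :=
  CliffordAlgebra.map (inclW F m ℓ)

/-- `SO(V₀ ⊗ F)`. -/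
noncomputable abbrev SOV : Subgroup ((Fin 4 → F) ≃ₗ[F] (Fin 4 → F)) := specialOrthogonal (quad F m)

/-- `G⁺(V₀ ⊗ F)`. -/
noncomputable abbrev GV : Subgroup (CliffordAlgebra (quad F m))ˣ := evenCliffordGroup (quad F m)

/-- `H(ξ)_F = SO(W ⊗ F)`. -/
noncomputable abbrev SOW : Subgroup (W F m ℓ ≃ₗ[F] W F m ℓ) := specialOrthogonal (quadW F m ℓ)

/-- `G⁺(W ⊗ F)`. -/
noncomputable abbrev GW : Subgroup (CliffordAlgebra (quadW F m ℓ))ˣ := evenCliffordGroup (quadW F m ℓ)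

variable {F}

/-- The lattice `O⁴` in `F⁴`: it is `L₀` for `O = ℤ` and `L₀ ⊗ ℤ_p` for `O = ℤ_p`. -/
def lattice (O : Subring F) : AddSubgroup (Fin 4 → F) where
  carrier := {x | ∀ i, x i ∈ O}
  zero_mem' := fun _ => O.zero_mem
  add_mem' := fun ha hb i => O.add_mem (ha i) (hb i)
  neg_mem' := fun ha i => O.neg_mem (ha i)

/-- The intersection of the lattice `O⁴` with `W`. -/
noncomputable def latticeW (O : Subring F) : AddSubgroup (W F m ℓ) :=
  (lattice O).comap (W F m ℓ).subtype.toAddMonoidHom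

variable {m ℓ}

/-- `g ∈ SO(V₀)` is the extension of `h ∈ SO(W)` which fixes `ξ`; this is how `SO(W)` is viewed as
a subgroup of `SO(V₀)`. -/
def Extends (h : SOW F m ℓ) (g : SOV F m) : Prop :=
  g.1 (xi F ℓ) = xi F ℓ ∧ ∀ w : W F m ℓ, g.1 (w : Fin 4 → F) = h.1 w

variable (m ℓ)

/-- `{h ∈ SO(W) | h O⁴ = O⁴}`, with `h` acting on `V₀ ⊗ F` with `hξ = ξ`. -/
noncomputable def levelH (O : Subring F) : Subgroup (SOW F m ℓ) where
  carrier := {h | ∃ g ∈ stabilizer (quad F m) (lattice O), Extends h g}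
  one_mem' := ⟨1, one_mem _, rfl, fun _ => rfl⟩
  mul_mem' := by
    rintro a b ⟨g, hg, h1, h2⟩ ⟨g', hg', h1', h2'⟩
    refine ⟨g * g', mul_mem hg hg', ?_, fun w => ?_⟩
    · change g.1 (g'.1 _) = _
      rw [h1', h1]
    · change g.1 (g'.1 _) = _
      rw [h2', h2]; rfl
  inv_mem' := by
    rintro a ⟨g, hg, h1, h2⟩
    refine ⟨g⁻¹, inv_mem hg, ?_, fun w => ?_⟩
    · change g.1.symm _ = _
      rw [LinearEquiv.symm_apply_eq, h1]
    · change g.1.symm _ = _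
      rw [LinearEquiv.symm_apply_eq, h2]
      congr 1
      exact (LinearEquiv.apply_symm_apply a.1 w).symm

/-- The elements of `G⁺(W)` whose image `γ` in `A(V₀)` is in `G⁺(V₀)` and satisfies
`τ(γ) O⁴ = O⁴` and `ν(γ) ∈ O^×`. -/
noncomputable def levelG (O : Subring F) : Subgroup (GW F m ℓ) :=
  (((unitNormStabilizer (quad F m) O (lattice O)).map (GV F m).subtype).comap
    (Units.map (clifIncl F m ℓ : CliffordAlgebra (quadW F m ℓ) →* CliffordAlgebra (quad F m)))).comap
      (GW F m ℓ).subtype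

theorem ι_xi_mul (x : CliffordAlgebra (quadW F m ℓ)) :
    ι (quad F m) (xi F ℓ) * clifIncl F m ℓ x =
      clifIncl F m ℓ (involute x) * ι (quad F m) (xi F ℓ) := by
  induction x using CliffordAlgebra.induction with
  | algebraMap r =>
    simp only [AlgHom.commutes]
    exact (Algebra.commutes r (ι (quad F m) (xi F ℓ))).symm
  | ι w =>
    have h : (quad F m).IsOrtho (xi F ℓ) (w : Fin 4 → F) := by
      have h1 : phi F m w (xi F ℓ) = 0 := w.2
      have h2 : phi F m (xi F ℓ) w = 0 := by rw [phi_symm, h1]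
      change phi F m (_ + _) (_ + _) = phi F m _ _ + phi F m _ _
      simp [h1, h2]
    rw [involute_ι, map_neg, clifIncl, CliffordAlgebra.map_apply_ι]
    exact (ι_mul_ι_comm_of_isOrtho h).trans (neg_mul _ _).symm
  | mul a b ha hb => rw [map_mul, map_mul, map_mul, ← mul_assoc, ha, mul_assoc, hb, mul_assoc]
  | add a b ha hb => rw [map_add, map_add, map_add, mul_add, add_mul, ha, hb]

theorem tau_mem_levelH (O : Subring F) {ε : GW F m ℓ} (hε : ε ∈ levelG m ℓ O) :
    tau ε ∈ levelH m ℓ O := by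
  obtain ⟨e, he, h⟩ := hε
  have h1 : (e.1 : CliffordAlgebra (quad F m)) = clifIncl F m ℓ (ε.1 : CliffordAlgebra _) :=
    congrArg Units.val h
  have h2 : ((e.1⁻¹ : (CliffordAlgebra (quad F m))ˣ) : CliffordAlgebra (quad F m)) =
      clifIncl F m ℓ ((ε.1⁻¹ : (CliffordAlgebra (quadW F m ℓ))ˣ) : CliffordAlgebra _) := by
    have h' : e.1 = Units.map (clifIncl F m ℓ :
        CliffordAlgebra (quadW F m ℓ) →* CliffordAlgebra (quad F m)) ε.1 := h
    rw [h', ← map_inv]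
    rfl
  refine ⟨tau e, he.1, ?_, fun w => ?_⟩
  · apply ι_inj (quad F m)
    have h3 := ι_xi_mul m ℓ (ε.1 : CliffordAlgebra (quadW F m ℓ))
    rw [ε.2.1, ← h1] at h3
    rw [ι_tau, ← h3, mul_assoc, Units.mul_inv, mul_one]
  · apply ι_inj (quad F m)
    have h3 : ∀ v : W F m ℓ, ι (quad F m) (v : Fin 4 → F) =
        clifIncl F m ℓ (ι (quadW F m ℓ) v) := fun v =>
      (CliffordAlgebra.map_apply_ι (inclW F m ℓ) v).symm
    rw [ι_tau, h3, h3, ι_tau, h1, h2, map_mul, map_mul]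

end Field

/-! ### Extension of scalars from `ℚ` -/

section Cast
variable (F : Type*) [Field F] [CharZero F] (m ℓ : ℕ)

/-- The inclusion `V₀ = ℚ⁴ → F⁴`. -/
def castV : (Fin 4 → ℚ) →ₗ[ℚ] (Fin 4 → F) where
  toFun x i := (x i : F)
  map_add' x y := by ext i; simp
  map_smul' c x := by ext i; simp [Rat.smul_def]

theorem phi_castV (x y : Fin 4 → ℚ) : phi F m (castV F x) (castV F y) = (phi ℚ m x y : F) := by
  simp [phi, castV, Matrix.toBilin'_apply]

theorem castV_mem_W (x : W ℚ m ℓ) : castV F x ∈ W F m ℓ := by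
  have h : phi ℚ m x (xi ℚ ℓ) = 0 := x.2
  have h1 : castV F (xi ℚ ℓ) = xi F ℓ := by
    ext i; fin_cases i <;> simp [castV, xi]
  change phi F m _ _ = 0
  rw [← h1, phi_castV, h, Rat.cast_zero]

/-- The inclusion `W → W ⊗ F`. -/
noncomputable def castW : W ℚ m ℓ →ₗ[ℚ] W F m ℓ where
  toFun x := ⟨castV F x, castV_mem_W F m ℓ x⟩
  map_add' x y := by ext i; simp
  map_smul' c x := by ext i; simp

/-- The inclusion of Clifford algebras `A(V₀) → A(V₀ ⊗ F)`. -/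
noncomputable def clifCastV : CliffordAlgebra (quad ℚ m) →ₐ[ℚ] CliffordAlgebra (quad F m) :=
  CliffordAlgebra.lift (quad ℚ m)
    ⟨((ι (quad F m)).restrictScalars ℚ) ∘ₗ castV F, fun x => by
      change ι (quad F m) (castV F x) * ι (quad F m) (castV F x) = _
      rw [ι_sq_scalar]
      change algebraMap F _ (phi F m _ _) = _
      rw [phi_castV]
      exact (IsScalarTower.algebraMap_apply ℚ F (CliffordAlgebra (quad F m)) _).symm⟩

/-- The inclusion of Clifford algebras `A(W) → A(W ⊗ F)`. -/
noncomputable def clifCastW : CliffordAlgebra (quadW ℚ m ℓ) →ₐ[ℚ] CliffordAlgebra (quadW F m ℓ) :=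
  CliffordAlgebra.lift (quadW ℚ m ℓ)
    ⟨((ι (quadW F m ℓ)).restrictScalars ℚ) ∘ₗ castW F m ℓ, fun x => by
      change ι (quadW F m ℓ) (castW F m ℓ x) * ι (quadW F m ℓ) (castW F m ℓ x) = _
      rw [ι_sq_scalar]
      change algebraMap F _ (phi F m (castV F x) (castV F x)) = _
      rw [phi_castV]
      exact (IsScalarTower.algebraMap_apply ℚ F (CliffordAlgebra (quadW F m ℓ)) _).symm⟩

variable {m ℓ}

/-- The image in `A(W ⊗ F)^×` of a rational element of `G⁺(W)`. -/
noncomputable def unitCastW (γ : GW ℚ m ℓ) : (CliffordAlgebra (quadW F m ℓ))ˣ :=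
  Units.map (clifCastW F m ℓ : CliffordAlgebra (quadW ℚ m ℓ) →* CliffordAlgebra (quadW F m ℓ)) γ.1

/-- The image in `A(V₀ ⊗ F)^×` of a rational element of `G⁺(V₀)`. -/
noncomputable def unitCastV (γ : GV ℚ m) : (CliffordAlgebra (quad F m))ˣ :=
  Units.map (clifCastV F m : CliffordAlgebra (quad ℚ m) →* CliffordAlgebra (quad F m)) γ.1

variable {F}

/-- `g ∈ SO(V₀ ⊗ F)` is the `F`-linear extension of `h ∈ SO(V₀)`. -/
def IsCastV (h : SOV ℚ m) (g : SOV F m) : Prop := ∀ x, g.1 (castV F x) = castV F (h.1 x)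

/-- `g ∈ SO(W ⊗ F)` is the `F`-linear extension of `h ∈ SO(W)`. -/
def IsCastW (h : SOW ℚ m ℓ) (g : SOW F m ℓ) : Prop :=
  ∀ x, g.1 (castW F m ℓ x) = castW F m ℓ (h.1 x)

theorem isCastW_tau {γ : GW ℚ m ℓ} {ε : GW F m ℓ} (h : ε.1 = unitCastW F γ) :
    IsCastW (tau γ) (tau ε) := by
  intro x
  apply ι_inj (quadW F m ℓ)
  have h1 : (ε.1 : CliffordAlgebra (quadW F m ℓ)) = clifCastW F m ℓ (γ.1 : CliffordAlgebra _) :=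
    congrArg Units.val h
  have h2 : ((ε.1⁻¹ : (CliffordAlgebra (quadW F m ℓ))ˣ) : CliffordAlgebra (quadW F m ℓ)) =
      clifCastW F m ℓ ((γ.1⁻¹ : (CliffordAlgebra (quadW ℚ m ℓ))ˣ) : CliffordAlgebra _) := by
    rw [h]
    simp [unitCastW]
  have h3 : ∀ v, ι (quadW F m ℓ) (castW F m ℓ v) = clifCastW F m ℓ (ι (quadW ℚ m ℓ) v) :=
    fun v => (CliffordAlgebra.lift_ι_apply (Q := quadW ℚ m ℓ)
      (((ι (quadW F m ℓ)).restrictScalars ℚ) ∘ₗ castW F m ℓ) _ v).symm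
  rw [ι_tau, h3, h3, ι_tau, h1, h2, map_mul, map_mul]

end Cast

/-! ### Adelic groups -/

instance factPrimes (p : Nat.Primes) : Fact (p : ℕ).Prime := ⟨p.2⟩

section Adelic
variable (m ℓ : ℕ)
open scoped RestrictedProduct

/-- `ℤ_p` as a subring of `ℚ_p`. -/
abbrev Zp (p : Nat.Primes) : Subring ℚ_[p] := PadicInt.subring p

/-- The integral points of `G⁺(W ⊗ ℚ_p)`. -/
noncomputable abbrev intGW (p : Nat.Primes) : Subgroup (GW ℚ_[p] m ℓ) :=
  integralCliffordGroup (quadW ℚ_[p] m ℓ) (Zp p) (latticeW m ℓ (Zp p))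

/-- The integral points of `SO(W ⊗ ℚ_p)`. -/
noncomputable abbrev intSOW (p : Nat.Primes) : Subgroup (SOW ℚ_[p] m ℓ) :=
  stabilizer (quadW ℚ_[p] m ℓ) (latticeW m ℓ (Zp p))

/-- `G⁺(W)_𝔸`: the real component, times the restricted product of the `p`-adic components. -/
abbrev GWA : Type := GW ℝ m ℓ × Πʳ p : Nat.Primes, [GW ℚ_[p] m ℓ, intGW m ℓ p]

/-- `H(ξ)_𝔸`: the real component, times the restricted product of the `p`-adic components. -/
abbrev HA : Type := SOW ℝ m ℓ × Πʳ p : Nat.Primes, [SOW ℚ_[p] m ℓ, intSOW m ℓ p]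

/-- `τ : G⁺(W)_𝔸 → H(ξ)_𝔸`, which is `τ` at every place. -/
noncomputable def tauA : GWA m ℓ →* HA m ℓ :=
  MonoidHom.prodMap tau
    (RestrictedProduct.mapAlongMonoidHom _ _ id Filter.tendsto_id (fun _ => tau)
      (Filter.Eventually.of_forall fun _ _ h => h.2.2))

/-- `G⁺(W)_ℚ`, embedded diagonally in `G⁺(W)_𝔸`. -/
noncomputable def GWQ : Subgroup (GWA m ℓ) where
  carrier := {ε | ∃ γ : GW ℚ m ℓ, ε.1.1 = unitCastW ℝ γ ∧
    ∀ p : Nat.Primes, (ε.2 p).1 = unitCastW ℚ_[p] γ}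
  one_mem' := ⟨1, by simp [unitCastW], fun p => by simp [unitCastW]⟩
  mul_mem' := by
    rintro a b ⟨γ, h1, h2⟩ ⟨γ', h1', h2'⟩
    refine ⟨γ * γ', ?_, fun p => ?_⟩
    · simp [unitCastW] at *
      rw [h1, h1']
    · have := h2 p
      have := h2' p
      simp [unitCastW] at *
      simp [*]
  inv_mem' := by
    rintro a ⟨γ, h1, h2⟩
    refine ⟨γ⁻¹, ?_, fun p => ?_⟩
    · simp [unitCastW] at *
      rw [h1]
    · have := h2 p
      simp [unitCastW] at *
      simp [*]

/-- `H(ξ)_ℚ`, embedded diagonally in `H(ξ)_𝔸`. -/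
noncomputable def HQ : Subgroup (HA m ℓ) where
  carrier := {ε | ∃ h : SOW ℚ m ℓ, IsCastW h ε.1 ∧ ∀ p : Nat.Primes, IsCastW h (ε.2 p)}
  one_mem' := ⟨1, fun _ => rfl, fun p _ => rfl⟩
  mul_mem' := by
    have key : ∀ {F : Type} [Field F] [CharZero F] {a b : SOW F m ℓ} {h h' : SOW ℚ m ℓ},
        IsCastW h a → IsCastW h' b → IsCastW (h * h') (a * b) := by
      intro F _ _ a b h h' h1 h2 x
      change a.1 (b.1 _) = _
      rw [h2, h1]; rfl
    rintro a b ⟨h, h1, h2⟩ ⟨h', h1', h2'⟩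
    exact ⟨h * h', key h1 h1', fun p => key (h2 p) (h2' p)⟩
  inv_mem' := by
    have key : ∀ {F : Type} [Field F] [CharZero F] {a : SOW F m ℓ} {h : SOW ℚ m ℓ},
        IsCastW h a → IsCastW h⁻¹ a⁻¹ := by
      intro F _ _ a h h1 x
      change a.1.symm _ = _
      rw [LinearEquiv.symm_apply_eq, h1]
      congr 1
      exact (LinearEquiv.apply_symm_apply h.1 x).symm
    rintro a ⟨h, h1, h2⟩
    exact ⟨h⁻¹, key h1, fun p => key (h2 p)⟩

/-- `G⁺(W)_𝔸 ∩ J`, where `J = G⁺(V₀)_∞ ∏_p J_p`: there is no condition at infinity. -/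
noncomputable def GWJ : Subgroup (GWA m ℓ) where
  carrier := {ε | ∀ p : Nat.Primes, ε.2 p ∈ levelG m ℓ (Zp p)}
  one_mem' := fun _ => one_mem _
  mul_mem' := fun ha hb p => mul_mem (ha p) (hb p)
  inv_mem' := fun ha p => inv_mem (ha p)

/-- `H(ξ)_𝔸 ∩ C`, where `C = SO(V₀)_∞ ∏_p C_p`: there is no condition at infinity. -/
noncomputable def HC : Subgroup (HA m ℓ) where
  carrier := {ε | ∀ p : Nat.Primes, ε.2 p ∈ levelH m ℓ (Zp p)}
  one_mem' := fun _ => one_mem _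
  mul_mem' := fun ha hb p => mul_mem (ha p) (hb p)
  inv_mem' := fun ha p => inv_mem (ha p)

/-- `G⁺(W)_ℚ \ G⁺(W)_𝔸 / (G⁺(W)_𝔸 ∩ J)`. -/
abbrev ClassesG : Type := DoubleCoset.Quotient (GWQ m ℓ : Set (GWA m ℓ)) (GWJ m ℓ)

/-- `H(ξ)_ℚ \ H(ξ)_𝔸 / (H(ξ)_𝔸 ∩ C)`. -/
abbrev ClassesH : Type := DoubleCoset.Quotient (HQ m ℓ : Set (HA m ℓ)) (HC m ℓ)

theorem tauA_mem_HQ {ε : GWA m ℓ} (h : ε ∈ GWQ m ℓ) : tauA m ℓ ε ∈ HQ m ℓ := by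
  obtain ⟨γ, h1, h2⟩ := h
  exact ⟨tau γ, isCastW_tau h1, fun p => isCastW_tau (h2 p)⟩

theorem tauA_mem_HC {ε : GWA m ℓ} (h : ε ∈ GWJ m ℓ) : tauA m ℓ ε ∈ HC m ℓ :=
  fun p => tau_mem_levelH m ℓ (Zp p) (h p)

/-- The map of double cosets induced by `τ`. -/
noncomputable def tauClasses : ClassesG m ℓ → ClassesH m ℓ :=
  Quotient.map' (tauA m ℓ) (by
    intro x y hxy
    obtain ⟨a, ha, b, hb, rfl⟩ := DoubleCoset.rel_iff.mp hxy
    refine DoubleCoset.rel_iff.mpr ⟨_, tauA_mem_HQ m ℓ ha, _, tauA_mem_HC m ℓ hb, ?_⟩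
    rw [map_mul, map_mul])

variable {m ℓ}

/-- `ε ∈ α J`, for `α ∈ G⁺(V₀)` rational and `ε ∈ G⁺(W)_𝔸 ⊂ G⁺(V₀)_𝔸`: for every prime `p` one has
`ε_p = α j_p` with `j_p ∈ J_p` (there is no condition at infinity). -/
def MemMulJ (α : GV ℚ m) (ε : GWA m ℓ) : Prop :=
  ∀ p : Nat.Primes, ∃ j ∈ unitNormStabilizer (quad ℚ_[p] m) (Zp p) (lattice (Zp p)),
    Units.map (clifIncl ℚ_[p] m ℓ :
      CliffordAlgebra (quadW ℚ_[p] m ℓ) →* CliffordAlgebra (quad ℚ_[p] m)) (ε.2 p).1 =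
      unitCastV ℚ_[p] α * j.1

/-- `ε ∈ α C`, for `α ∈ SO(V₀)` rational and `ε ∈ H(ξ)_𝔸 ⊂ SO(V₀)_𝔸`: for every prime `p` one has
`ε_p = α c_p` with `c_p ∈ C_p` (there is no condition at infinity). -/
def MemMulC (α : SOV ℚ m) (ε : HA m ℓ) : Prop :=
  ∀ p : Nat.Primes, ∃ c ∈ stabilizer (quad ℚ_[p] m) (lattice (Zp p)),
    ∃ a : SOV ℚ_[p] m, IsCastV α a ∧ Extends (ε.2 p) (a * c)

end Adelic

/-! ### Orbits of integral vectors -/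

section Orbits
variable (m : ℕ)

/-- `ℤ` as a subring of `ℚ`. -/
abbrev ZZ : Subring ℚ := (Int.castRingHom ℚ).range

/-- `L[q, 𝔟] = {x | φ[x] = q, φ(x, L) = 𝔟}`. -/
def vectors {M : Type*} [AddCommGroup M] [Module ℚ M] (φ : LinearMap.BilinForm ℚ M)
    (L : AddSubgroup M) (q : ℚ) (b : AddSubgroup ℚ) : Set M :=
  {x | φ x x = q ∧ L.map (φ x).toAddMonoidHom = b}

/-- `L₀[ℓ, 2⁻¹ℤ]`. -/
abbrev X (ℓ : ℕ) : Set (Fin 4 → ℚ) :=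
  vectors (phi ℚ m) (lattice ZZ) ℓ (AddSubgroup.zmultiples (2⁻¹ : ℚ))

/-- `Γ(L₀) = {g ∈ SO(V₀) | g L₀ = L₀}`. -/
noncomputable abbrev Gam : Subgroup (SOV ℚ m) := stabilizer (quad ℚ m) (lattice ZZ)

/-- `Γ̂(L₀)`: the elements of `Γ(L₀)` whose matrix is in `1 + M₄(ℤ) S₀`. -/
noncomputable def GamHat : Subgroup (Gam m) where
  carrier := {γ | ∃ A : Matrix (Fin 4) (Fin 4) ℤ,
    LinearMap.toMatrix' (γ.1.1 : (Fin 4 → ℚ) →ₗ[ℚ] (Fin 4 → ℚ)) =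
      1 + (A * matS0 m).map (Int.cast : ℤ → ℚ)}
  one_mem' := ⟨0, by
    have h : (((1 : Gam m).1.1 : (Fin 4 → ℚ) ≃ₗ[ℚ] (Fin 4 → ℚ)) :
        (Fin 4 → ℚ) →ₗ[ℚ] (Fin 4 → ℚ)) = LinearMap.id := rfl
    rw [h, LinearMap.toMatrix'_id]
    simp⟩
  mul_mem' := by
    rintro a b ⟨A, hA⟩ ⟨B, hB⟩
    refine ⟨A + B + A * matS0 m * B, ?_⟩
    have h : (((a * b).1.1 : (Fin 4 → ℚ) ≃ₗ[ℚ] (Fin 4 → ℚ)) : (Fin 4 → ℚ) →ₗ[ℚ] (Fin 4 → ℚ)) =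
        (a.1.1 : (Fin 4 → ℚ) →ₗ[ℚ] (Fin 4 → ℚ)) ∘ₗ (b.1.1 : (Fin 4 → ℚ) →ₗ[ℚ] (Fin 4 → ℚ)) := rfl
    rw [h, LinearMap.toMatrix'_comp, hA, hB]
    have hm : ∀ P : Matrix (Fin 4) (Fin 4) ℤ,
        P.map (Int.cast : ℤ → ℚ) = (Int.castRingHom ℚ).mapMatrix P := fun _ => rfl
    simp only [hm, map_mul, map_add]
    noncomm_ring
  inv_mem' := by
    rintro a ⟨A, hA⟩
    have hm : ∀ P : Matrix (Fin 4) (Fin 4) ℤ,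
        P.map (Int.cast : ℤ → ℚ) = (Int.castRingHom ℚ).mapMatrix P := fun _ => rfl
    have hint : ∀ i j, ∃ n : ℤ, (n : ℚ) =
        LinearMap.toMatrix' ((a⁻¹).1.1 : (Fin 4 → ℚ) →ₗ[ℚ] (Fin 4 → ℚ)) i j := by
      intro i j
      have h1 : (Pi.single j 1 : Fin 4 → ℚ) ∈ lattice ZZ := by
        intro k
        by_cases hk : k = j
        · subst hk; simp
        · rw [Pi.single_eq_of_ne hk]; exact zero_mem ZZ
      obtain ⟨n, hn⟩ := ((a⁻¹).2 _).2 h1 i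
      refine ⟨n, ?_⟩
      rw [LinearMap.toMatrix'_apply]
      exact hn
    choose B hB using hint
    set N := LinearMap.toMatrix' ((a⁻¹).1.1 : (Fin 4 → ℚ) →ₗ[ℚ] (Fin 4 → ℚ)) with hN
    have hBN : (Int.castRingHom ℚ).mapMatrix (Matrix.of B) = N := by
      ext i j; exact hB i j
    have h : N * LinearMap.toMatrix' (a.1.1 : (Fin 4 → ℚ) →ₗ[ℚ] (Fin 4 → ℚ)) = 1 := by
      rw [hN, ← LinearMap.toMatrix'_comp, ← LinearMap.toMatrix'_id]
      congr 1
      ext1 x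
      exact LinearMap.ext fun c => LinearEquiv.symm_apply_apply a.1.1 _
    refine ⟨-(Matrix.of B * A), ?_⟩
    rw [hA, mul_add, mul_one, hm, ← hBN] at h
    rw [hm]
    refine hBN.symm.trans ?_
    rw [eq_sub_of_add_eq h]
    simp only [map_mul, map_neg]
    noncomm_ring

theorem phi_map (g : SOV ℚ m) (x y : Fin 4 → ℚ) : phi ℚ m (g.1 x) (g.1 y) = phi ℚ m x y := by
  have h : ∀ z, phi ℚ m (g.1 z) (g.1 z) = phi ℚ m z z := g.2.1
  have h1 := h (x + y)
  simp only [map_add, LinearMap.add_apply, h] at h1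
  have h2 := phi_symm ℚ m x y
  have h3 := phi_symm ℚ m (g.1 x) (g.1 y)
  linarith

theorem smul_mem_X {ℓ : ℕ} (γ : Gam m) {x : Fin 4 → ℚ} (hx : x ∈ X m ℓ) : γ.1.1 x ∈ X m ℓ := by
  refine ⟨by rw [phi_map]; exact hx.1, ?_⟩
  rw [← hx.2]
  ext t
  constructor
  · rintro ⟨y, hy, rfl⟩
    refine ⟨γ.1.1.symm y, (γ.2 _).1 (by rwa [LinearEquiv.apply_symm_apply]), ?_⟩
    have := phi_map m γ.1 x (γ.1.1.symm y)
    rw [LinearEquiv.apply_symm_apply] at this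
    exact this.symm
  · rintro ⟨y, hy, rfl⟩
    exact ⟨γ.1.1 y, (γ.2 _).2 hy, phi_map m γ.1 x y⟩

/-- `Γ(L₀)` acts on `L₀[ℓ, 2⁻¹ℤ]`. -/
noncomputable instance actionX (ℓ : ℕ) : MulAction (Gam m) (X m ℓ) where
  smul γ x := ⟨γ.1.1 x, smul_mem_X m γ x.2⟩
  one_smul _ := rfl
  mul_smul _ _ _ := rfl

variable (ℓ : ℕ)

/-- `L₀[ℓ, 2⁻¹ℤ] / Γ(L₀)`. -/
noncomputable abbrev Orbits : Type := MulAction.orbitRel.Quotient (Gam m) (X m ℓ)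

/-- `L₀[ℓ, 2⁻¹ℤ] / Γ̂(L₀)`. -/
noncomputable abbrev OrbitsHat : Type := MulAction.orbitRel.Quotient (GamHat m) (X m ℓ)

/-- `ι : Γ̂(L₀) v ↦ Γ(L₀) v`. -/
noncomputable def iota : OrbitsHat m ℓ → Orbits m ℓ :=
  Quotient.map' id (by
    rintro x y ⟨γ, hγ⟩
    exact ⟨γ.1, hγ⟩)

variable {m ℓ}

/-- The orbit `Γ(L₀) v`. -/
noncomputable def orb (v : X m ℓ) : Orbits m ℓ := Quotient.mk'' v

/-- The orbit `Γ̂(L₀) v`. -/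
noncomputable def orbHat (v : X m ℓ) : OrbitsHat m ℓ := Quotient.mk'' v

end Orbits
end QuadSpace

open QuadSpace

/-! ### Clifford algebras over a field: scalars, norms, reflections and Eichler elements -/

namespace QuadSpace
open CliffordAlgebra

section CliffordGeneric
variable {F M : Type*} [Field F] [CharZero F] [AddCommGroup M] [Module F M]

/-! Two facts about G⁺(V₀) carry the theorem. The first is class number one, G⁺(V₀)_𝔸 = G⁺(V₀)·J̃.
The vectors e = (1,0,0,0) and f = (0,0,0,1) span a hyperbolic plane, so over a field every element
of G⁺(V₀) is a scalar times a product of unipotents 1 + ex, 1 + fx, times one torus element (e +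
cf)(e + f). At a prime p, unipotents can be approximated by unipotents over ℤ[1/p], and scalars and
torus parameters by powers of p, without losing integrality at other primes. The finitely many bad
primes are thus cleared one at a time (`isApprox`, `exists_rational_approx`). Since τ is surjective,
the existence statement in (b) follows as well.

The second fact is that the rational elements of J̃ have image exactly Γ̂(L₀) under τ. The group
Γ̂(L₀) is the kernel of the action of Γ(L₀) on the discriminant module (dual lattice modulo L₀).
Over ℤ_p, a lattice-preserving isometry can be moved by integral elementary elements to one fixing e
and f. Such an isometry is multiplication by a norm-one element u of the quadratic algebra with norm
form `qS`, and Hilbert 90 writes u = z/z̄. If ν is a unit, square-freeness of m makes a suitably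
scaled z integral, and u then acts trivially on the discriminant module
(`tau_mem_discKernel_of_mem_unitG`). Conversely, trivial action allows z to be chosen integral of
unit norm (`exists_unitG_of_mem_discKernel`). Globally, the norm of a lift of an element of Γ̂(L₀)
then has even valuation everywhere, so it is ± a rational square and the lift can be scaled into J̃
(`exists_lift_of_mem_GamHat`).

Given these, let ε ∈ αJ̃ and aεb ∈ α'J̃ with a rational and b in the level group. Then β = α'⁻¹aα is
rational, lies in J̃, and τ(β) carries τ(α)⁻¹ξ to τ(α')⁻¹ξ, so κ is well defined. Conversely, an
element of Γ̂(L₀) carrying one vector to the other lifts to such a β, and α'βα⁻¹ fixes ξ, hence lies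
in G⁺(W̃) (`exists_inclG_eq`); this gives injectivity. For surjectivity, a vector of L₀[ℓ, 2⁻¹ℤ]
lies in L₀ because the form is maximal (`mem_lattice_of_mem_X`), and it pairs to 1 with some lattice
vector under 2φ₀. It is therefore moved to ξ over ℚ and over every ℤ_p, and the quotients of the
global and local transformations fix ξ and form the required ε.

For λ, well-definedness and injectivity use the same argument with SO, C̃ and Γ(L₀). Its
surjectivity is inherited from κ through λ∘τ = ι∘κ. -/

theorem contractLeft_polar (Q : QuadraticForm F M) (v : M) (x : CliffordAlgebra Q) :
    contractLeft (QuadraticMap.polarBilin Q v) x = ι Q v * x - involute x * ι Q v := by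
  induction x using CliffordAlgebra.left_induction with
  | algebraMap r =>
    rw [contractLeft_algebraMap, AlgHom.commutes, Algebra.commutes, sub_self]
  | add a b ha hb => rw [map_add, map_add, ha, hb]; noncomm_ring
  | ι_mul x w hx =>
    have h := ι_mul_ι_add_swap (Q := Q) v w
    rw [contractLeft_ι_mul, hx, map_mul, involute_ι, QuadraticMap.polarBilin_apply_apply,
      Algebra.smul_def, ← h]
    noncomm_ring

/-- The part of a multivector free of `e`, for a dual pair `(e, d)`. -/
noncomputable def stripPart (p : M × Module.Dual F M) :
    ExteriorAlgebra F M →ₗ[F] ExteriorAlgebra F M :=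
  LinearMap.id - LinearMap.mulLeft F (ι (0 : QuadraticForm F M) p.1) ∘ₗ
    contractLeft (Q := (0 : QuadraticForm F M)) p.2

theorem stripPart_apply (p : M × Module.Dual F M) (x : ExteriorAlgebra F M) :
    stripPart p x = x - ι (0 : QuadraticForm F M) p.1 *
      contractLeft (Q := (0 : QuadraticForm F M)) p.2 x := rfl

theorem stripPart_ι_mul (p : M × Module.Dual F M) (hp : p.2 p.1 = 1) (v : M)
    (x : ExteriorAlgebra F M) :
    stripPart p (ι (0 : QuadraticForm F M) v * x) =
      ι (0 : QuadraticForm F M) (v - p.2 v • p.1) * stripPart p x := by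
  obtain ⟨e, d⟩ := p
  have h1 : ι (0 : QuadraticForm F M) e * ι (0 : QuadraticForm F M) v =
      - (ι (0 : QuadraticForm F M) v * ι (0 : QuadraticForm F M) e) := by
    have := ι_mul_ι_add_swap (Q := (0 : QuadraticForm F M)) e v
    rw [show QuadraticMap.polar (0 : QuadraticForm F M) e v = 0 by simp [QuadraticMap.polar],
      map_zero] at this
    exact eq_neg_of_add_eq_zero_left this
  have h2 : ι (0 : QuadraticForm F M) e * ι (0 : QuadraticForm F M) e = 0 := by
    rw [ι_sq_scalar]; simp
  have h3 : contractLeft (Q := (0 : QuadraticForm F M)) d (ι (0 : QuadraticForm F M) v * x) =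
      d v • x - ι (0 : QuadraticForm F M) v * contractLeft (Q := (0 : QuadraticForm F M)) d x :=
    contractLeft_ι_mul _ _ _
  rw [stripPart_apply, stripPart_apply, h3, map_sub, map_smul, mul_sub, mul_sub, sub_mul, sub_mul, ← mul_assoc, ← mul_assoc, h1,
    smul_mul_assoc, smul_mul_assoc, ← mul_assoc, h2]
  simp only [zero_mul, smul_zero, mul_smul_comm, neg_mul, mul_assoc]
  abel

/-- In the exterior algebra the operators `stripPart` of the basis vectors remove every component
involving a basis vector, so their composite takes only scalar values. On an element killed by all
contractions each of them is the identity. `equivExterior` transports this to the Clifford algebra.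
-/
theorem exists_scalar_of_contractLeft_eq_zero {n : ℕ} (Q : QuadraticForm F M)
    (b : Module.Basis (Fin n) F M) (x : CliffordAlgebra Q)
    (hx : ∀ i, contractLeft (b.coord i) x = 0) :
    ∃ r : F, x = algebraMap F _ r := by
  haveI : Invertible (2 : F) := invertibleOfNonzero two_ne_zero
  let Sp : Fin n → ExteriorAlgebra F M →ₗ[F] ExteriorAlgebra F M :=
    fun i => stripPart (b i, b.coord i)
  -- Passing a leading vector through the strips subtracts its components along the basis vectors in
  -- `l`. For the full list nothing of it remains.
  have key : ∀ (l : List (Fin n)) (y : ExteriorAlgebra F M) (v : M),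
      ∃ w : M, (l.map Sp).prod (ι (0 : QuadraticForm F M) v * y) =
        ι (0 : QuadraticForm F M) w * (l.map Sp).prod y ∧
        ∀ i, b.coord i w = if i ∈ l then 0 else b.coord i v := by
    intro l
    induction l with
    | nil => exact fun y v => ⟨v, rfl, fun i => by simp⟩
    | cons j l ih =>
      intro y v
      obtain ⟨w, hw, hc⟩ := ih y v
      refine ⟨w - b.coord j w • b j, ?_, fun i => ?_⟩
      · rw [List.map_cons, List.prod_cons, Module.End.mul_apply, hw, Module.End.mul_apply]
        exact stripPart_ι_mul (b j, b.coord j) (by simp) w _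
      · rw [map_sub, map_smul]
        by_cases hij : i = j
        · subst hij; simp
        · have : b.coord i (b j) = 0 := by simp [Ne.symm hij]
          rw [this, smul_zero, sub_zero, hc]
          simp [hij]
  have hall : ∀ y : ExteriorAlgebra F M,
      ∃ r : F, (((List.finRange n).map Sp).prod) y = algebraMap F _ r := by
    intro y
    have hs : ∀ (l : List (Fin n)) (r : F), (l.map Sp).prod (algebraMap F _ r) =
        algebraMap F (ExteriorAlgebra F M) r := by
      intro l r
      induction l with
      | nil => rfl
      | cons j l ih =>
        rw [List.map_cons, List.prod_cons, Module.End.mul_apply, ih]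
        refine (stripPart_apply _ _).trans ?_
        have := contractLeft_algebraMap (0 : QuadraticForm F M) (b.coord j) r
        erw [this]
        rw [mul_zero, sub_zero]
    induction y using CliffordAlgebra.left_induction with
    | algebraMap r => exact ⟨r, hs _ r⟩
    | add a c ha hc =>
      obtain ⟨r, hr⟩ := ha
      obtain ⟨s, hs⟩ := hc
      exact ⟨r + s, by rw [map_add, map_add]; exact congrArg₂ _ hr hs⟩
    | ι_mul a v _ =>
      obtain ⟨w, hw, hc⟩ := key (List.finRange n) a v
      have : w = 0 := by
        apply b.ext_elem
        intro i
        have := hc i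
        simpa using this
      refine ⟨0, ?_⟩
      rw [this, map_zero, zero_mul] at hw
      exact hw.trans (map_zero _).symm
  obtain ⟨r, hr⟩ := hall (equivExterior Q x)
  refine ⟨r, (equivExterior Q).injective ?_⟩
  have h1 : equivExterior Q (algebraMap F _ r) = algebraMap F _ r := by
    simp only [equivExterior, changeFormEquiv_apply, changeForm_algebraMap]
  rw [h1, ← hr]
  have h2 : ∀ i, contractLeft (Q := (0 : QuadraticForm F M)) (b.coord i) (equivExterior Q x) = 0 := by
    intro i
    simp only [equivExterior, changeFormEquiv_apply]
    rw [← changeForm_contractLeft, hx, map_zero]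
  generalize List.finRange n = l
  induction l with
  | nil => rfl
  | cons j l ih =>
    rw [List.map_cons, List.prod_cons, Module.End.mul_apply, ← ih]
    refine Eq.trans ?_ (stripPart_apply _ _).symm
    rw [h2, mul_zero, sub_zero]

variable {Q : QuadraticForm F M}

/-- An even unit, given with its inverse, that maps vectors to vectors by conjugation. -/
def evenCliffordGroup.mk' (a b : CliffordAlgebra Q) (hab : a * b = 1) (hba : b * a = 1)
    (ha : involute a = a) (h : ∀ v, a * ι Q v * b ∈ LinearMap.range (ι Q))
    (h' : ∀ v, b * ι Q v * a ∈ LinearMap.range (ι Q)) : evenCliffordGroup Q :=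
  ⟨⟨a, b, hab, hba⟩, ha, fun y => ⟨fun hy => by
    obtain ⟨v, hv⟩ := hy
    have : y = b * (a * y * b) * a := by
      simp only [mul_assoc, hba, mul_one]
      rw [← mul_assoc, hba, one_mul]
    rw [this]
    rw [show a * y * b = ι Q v from hv.symm]
    exact h' v, by rintro ⟨v, rfl⟩; exact h v⟩⟩

theorem mem_range_of_eq {x : CliffordAlgebra Q} {v : M} (h : x = ι Q v) :
    x ∈ LinearMap.range (ι Q) := ⟨v, h.symm⟩

theorem tau_apply_of_eq [FiniteDimensional F M] {α : evenCliffordGroup Q} {v w : M}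
    (h : (α.1 : CliffordAlgebra Q) * ι Q v * (α.1⁻¹ : (CliffordAlgebra Q)ˣ) = ι Q w) :
    (tau α).1 v = w := by
  apply ι_inj Q
  rw [ι_tau, h]

/-- `HasNorm α c` says that `ν(α) = α α^*` is the scalar `c`. -/
def HasNorm (α : evenCliffordGroup Q) (c : F) : Prop :=
  (α.1 : CliffordAlgebra Q) * reverse (α.1 : CliffordAlgebra Q) = algebraMap F _ c

theorem HasNorm.mul {α β : evenCliffordGroup Q} {a b : F} (ha : HasNorm α a) (hb : HasNorm β b) :
    HasNorm (α * β) (a * b) := by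
  have h : ((α * β : evenCliffordGroup Q).1 : CliffordAlgebra Q) = α.1 * β.1 := by simp
  unfold HasNorm at *
  rw [h, reverse.map_mul, mul_assoc, ← mul_assoc (β.1 : CliffordAlgebra Q), hb, Algebra.commutes,
    ← mul_assoc, ha, map_mul]

theorem HasNorm.unique {α : evenCliffordGroup Q} {a b : F} (ha : HasNorm α a)
    (hb : HasNorm α b) : a = b :=
  algebraMap_inj Q (ha.symm.trans hb)

theorem hasNorm_one : HasNorm (1 : evenCliffordGroup Q) 1 := by simp [HasNorm]

/-- A non-zero scalar, as an element of the even Clifford group. -/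
def scalarG (Q : QuadraticForm F M) (c : F) (hc : c ≠ 0) : evenCliffordGroup Q :=
  evenCliffordGroup.mk' (algebraMap F _ c) (algebraMap F _ c⁻¹)
    (by rw [← map_mul, mul_inv_cancel₀ hc, map_one])
    (by rw [← map_mul, inv_mul_cancel₀ hc, map_one]) (AlgHom.commutes _ _)
    (fun v => mem_range_of_eq (v := v) (by
      rw [Algebra.commutes, mul_assoc, ← map_mul, mul_inv_cancel₀ hc, map_one, mul_one]))
    (fun v => mem_range_of_eq (v := v) (by
      rw [Algebra.commutes, mul_assoc, ← map_mul, inv_mul_cancel₀ hc, map_one, mul_one]))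

theorem scalarG_val (c : F) (hc : c ≠ 0) :
    ((scalarG Q c hc).1 : CliffordAlgebra Q) = algebraMap F _ c := rfl

theorem hasNorm_scalarG (c : F) (hc : c ≠ 0) : HasNorm (scalarG Q c hc) (c * c) := by
  rw [HasNorm, scalarG_val, reverse.commutes, map_mul]

theorem scalarG_mul_comm (c : F) (hc : c ≠ 0) (α : evenCliffordGroup Q) :
    scalarG Q c hc * α = α * scalarG Q c hc :=
  Subtype.ext (Units.ext (Algebra.commutes c (α.1 : CliffordAlgebra Q)))

theorem tau_scalarG [FiniteDimensional F M] (c : F) (hc : c ≠ 0) :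
    tau (scalarG Q c hc) = 1 := by
  ext v
  refine tau_apply_of_eq (w := v) ?_
  change algebraMap F _ c * ι Q v * algebraMap F _ c⁻¹ = _
  rw [Algebra.commutes, mul_assoc, ← map_mul, mul_inv_cancel₀ hc, map_one, mul_one]

/-- The reflection in an anisotropic vector. -/
def reflect (Q : QuadraticForm F M) (a v : M) : M := v - (QuadraticMap.polar Q a v / Q a) • a

theorem ι_mul_ι_mul_ι_inv {a : M} (ha : Q a ≠ 0) (v : M) :
    ι Q a * ι Q v * ((Q a)⁻¹ • ι Q a) = - ι Q (reflect Q a v) := by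
  rw [mul_smul_comm, ι_mul_ι_mul_ι, ← map_smul, ← map_neg]
  congr 1
  rw [reflect, smul_sub, smul_smul, smul_smul, inv_mul_cancel₀ ha, one_smul, neg_sub, div_eq_inv_mul]

theorem inv_ι_mul_ι_mul_ι {a : M} (ha : Q a ≠ 0) (v : M) :
    ((Q a)⁻¹ • ι Q a) * ι Q v * ι Q a = - ι Q (reflect Q a v) := by
  rw [← ι_mul_ι_mul_ι_inv ha, smul_mul_assoc, smul_mul_assoc, mul_smul_comm]

theorem ι_mul_inv {a : M} (ha : Q a ≠ 0) : ι Q a * ((Q a)⁻¹ • ι Q a) = 1 := by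
  rw [mul_smul_comm, ι_sq_scalar, Algebra.smul_def, ← map_mul, inv_mul_cancel₀ ha, map_one]

theorem inv_mul_ι {a : M} (ha : Q a ≠ 0) : ((Q a)⁻¹ • ι Q a) * ι Q a = 1 := by
  rw [smul_mul_assoc, ι_sq_scalar, Algebra.smul_def, ← map_mul, inv_mul_cancel₀ ha, map_one]

/-- The product of two anisotropic vectors, as an element of the even Clifford group. -/
def pairG (a b : M) (ha : Q a ≠ 0) (hb : Q b ≠ 0) : evenCliffordGroup Q :=
  evenCliffordGroup.mk' (ι Q a * ι Q b) (((Q b)⁻¹ • ι Q b) * ((Q a)⁻¹ • ι Q a))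
    (by rw [mul_assoc, ← mul_assoc (ι Q b), ι_mul_inv hb, one_mul, ι_mul_inv ha])
    (by rw [mul_assoc, ← mul_assoc _ (ι Q a), inv_mul_ι ha, one_mul, inv_mul_ι hb])
    (by simp)
    (fun v => mem_range_of_eq (v := reflect Q a (reflect Q b v)) (by
      rw [show ι Q a * ι Q b * ι Q v * (((Q b)⁻¹ • ι Q b) * ((Q a)⁻¹ • ι Q a)) =
        ι Q a * (ι Q b * ι Q v * ((Q b)⁻¹ • ι Q b)) * ((Q a)⁻¹ • ι Q a) by simp only [mul_assoc],
        ι_mul_ι_mul_ι_inv hb, mul_neg, neg_mul, ι_mul_ι_mul_ι_inv ha, neg_neg]))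
    (fun v => mem_range_of_eq (v := reflect Q b (reflect Q a v)) (by
      rw [show ((Q b)⁻¹ • ι Q b) * ((Q a)⁻¹ • ι Q a) * ι Q v * (ι Q a * ι Q b) =
        ((Q b)⁻¹ • ι Q b) * (((Q a)⁻¹ • ι Q a) * ι Q v * ι Q a) * ι Q b by simp only [mul_assoc],
        inv_ι_mul_ι_mul_ι ha, mul_neg, neg_mul, inv_ι_mul_ι_mul_ι hb, neg_neg]))

theorem tau_pairG [FiniteDimensional F M] (a b : M) (ha : Q a ≠ 0) (hb : Q b ≠ 0) (v : M) :
    (tau (pairG a b ha hb)).1 v = reflect Q a (reflect Q b v) := by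
  refine tau_apply_of_eq ?_
  change ι Q a * ι Q b * ι Q v * (((Q b)⁻¹ • ι Q b) * ((Q a)⁻¹ • ι Q a)) = _
  rw [show ι Q a * ι Q b * ι Q v * (((Q b)⁻¹ • ι Q b) * ((Q a)⁻¹ • ι Q a)) =
        ι Q a * (ι Q b * ι Q v * ((Q b)⁻¹ • ι Q b)) * ((Q a)⁻¹ • ι Q a) by simp only [mul_assoc],
        ι_mul_ι_mul_ι_inv hb, mul_neg, neg_mul, ι_mul_ι_mul_ι_inv ha, neg_neg]

theorem hasNorm_pairG (a b : M) (ha : Q a ≠ 0) (hb : Q b ≠ 0) :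
    HasNorm (pairG a b ha hb) (Q a * Q b) := by
  change ι Q a * ι Q b * reverse (ι Q a * ι Q b) = _
  rw [reverse.map_mul, reverse_ι, reverse_ι, mul_assoc, ← mul_assoc (ι Q b), ι_sq_scalar,
    Algebra.commutes, ← mul_assoc, ι_sq_scalar, map_mul]

/-- The Eichler transformation of an isotropic vector `e` and a vector `x` orthogonal to it. -/
def eichlerMap (Q : QuadraticForm F M) (e x v : M) : M :=
  v + QuadraticMap.polar Q v x • e - QuadraticMap.polar Q v e • x -
    (QuadraticMap.polar Q v e * Q x) • e

theorem eichler_mul {e x : M} (he : Q e = 0) (hx : QuadraticMap.polar Q e x = 0) (y : M) :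
    (1 + ι Q e * ι Q x) * (1 + ι Q e * ι Q y) = 1 + ι Q e * ι Q (x + y) := by
  have h1 : ι Q x * ι Q e = - (ι Q e * ι Q x) := by
    have := ι_mul_ι_add_swap (Q := Q) e x
    rw [hx, map_zero] at this
    exact eq_neg_of_add_eq_zero_right this
  have h2 : ι Q e * ι Q e = 0 := by rw [ι_sq_scalar, he, map_zero]
  have h3 : ι Q e * ι Q x * (ι Q e * ι Q y) = 0 := by
    rw [mul_assoc, ← mul_assoc (ι Q x), h1, neg_mul, mul_neg, mul_assoc, ← mul_assoc, h2, zero_mul,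
      neg_zero]
  rw [mul_add, mul_one, add_mul, h3, one_mul, map_add, mul_add]
  abel

theorem eichler_conj {e x : M} (he : Q e = 0) (hx : QuadraticMap.polar Q e x = 0) (v : M) :
    (1 + ι Q e * ι Q x) * ι Q v * (1 + ι Q e * ι Q (-x)) = ι Q (eichlerMap Q e x v) := by
  have h2 : ι Q e * ι Q e = 0 := by rw [ι_sq_scalar, he, map_zero]
  have h1 : ι Q x * ι Q e = - (ι Q e * ι Q x) := by
    have := ι_mul_ι_add_swap (Q := Q) e x
    rw [hx, map_zero] at this
    exact eq_neg_of_add_eq_zero_right this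
  have h3 : ι Q v * ι Q e = algebraMap F _ (QuadraticMap.polar Q v e) - ι Q e * ι Q v :=
    eq_sub_of_add_eq (ι_mul_ι_add_swap v e)
  have h4 : ι Q x * ι Q v = algebraMap F _ (QuadraticMap.polar Q v x) - ι Q v * ι Q x := by
    rw [← ι_mul_ι_add_swap v x]; abel
  have h5 : ι Q e * ι Q x * ι Q v * (ι Q e * ι Q x) =
      (QuadraticMap.polar Q v e * Q x) • ι Q e := by
    calc ι Q e * ι Q x * ι Q v * (ι Q e * ι Q x)
        = ι Q e * ι Q x * (ι Q v * ι Q e) * ι Q x := by simp only [mul_assoc]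
      _ = ι Q e * ι Q x * algebraMap F _ (QuadraticMap.polar Q v e) * ι Q x -
          ι Q e * (ι Q x * ι Q e) * ι Q v * ι Q x := by rw [h3]; noncomm_ring
      _ = algebraMap F _ (QuadraticMap.polar Q v e) * (ι Q e * (ι Q x * ι Q x)) +
          (ι Q e * ι Q e) * ι Q x * ι Q v * ι Q x := by
            rw [h1, ← Algebra.commutes]; noncomm_ring
      _ = _ := by
            rw [h2, ι_sq_scalar, ← Algebra.commutes, ← mul_assoc, ← map_mul, Algebra.smul_def]
            simp
  have h6 : ι Q e * ι Q x * ι Q v - ι Q v * (ι Q e * ι Q x) =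
      QuadraticMap.polar Q v x • ι Q e - QuadraticMap.polar Q v e • ι Q x := by
    rw [mul_assoc, h4, ← mul_assoc (ι Q v), h3, Algebra.smul_def, Algebra.smul_def, mul_sub,
      ← Algebra.commutes, sub_mul]
    noncomm_ring
  calc _ = ι Q v + (ι Q e * ι Q x * ι Q v - ι Q v * (ι Q e * ι Q x)) -
        ι Q e * ι Q x * ι Q v * (ι Q e * ι Q x) := by rw [map_neg]; noncomm_ring
    _ = _ := by
      rw [h5, h6]
      simp only [eichlerMap, map_add, map_sub, map_smul]
      abel

/-- `1 + e x`, as an element of the even Clifford group. -/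
def eichlerG (e x : M) (he : Q e = 0) (hx : QuadraticMap.polar Q e x = 0) : evenCliffordGroup Q :=
  have hx' : QuadraticMap.polar Q e (-x) = 0 := by rw [QuadraticMap.polar_neg_right, hx, neg_zero]
  evenCliffordGroup.mk' (1 + ι Q e * ι Q x) (1 + ι Q e * ι Q (-x))
    (by rw [eichler_mul he hx]; simp) (by rw [eichler_mul he hx']; simp) (by simp)
    (fun v => mem_range_of_eq (eichler_conj he hx v))
    (fun v => mem_range_of_eq (by
      have := eichler_conj he hx' v
      rwa [neg_neg] at this))

theorem tau_eichlerG [FiniteDimensional F M] (e x : M) (he : Q e = 0)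
    (hx : QuadraticMap.polar Q e x = 0) (v : M) :
    (tau (eichlerG e x he hx)).1 v = eichlerMap Q e x v :=
  tau_apply_of_eq (eichler_conj he hx v)

theorem hasNorm_eichlerG (e x : M) (he : Q e = 0) (hx : QuadraticMap.polar Q e x = 0) :
    HasNorm (eichlerG e x he hx) 1 := by
  change (1 + ι Q e * ι Q x) * reverse (1 + ι Q e * ι Q x) = _
  have h1 : ι Q x * ι Q e = ι Q e * ι Q (-x) := by
    have := ι_mul_ι_add_swap (Q := Q) e x
    rw [hx, map_zero] at this
    rw [map_neg, mul_neg]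
    exact eq_neg_of_add_eq_zero_right this
  rw [map_add, reverse.map_mul, reverse_ι, reverse_ι, h1, reverse.map_one, eichler_mul he hx]
  simp

theorem eichlerG_mul (e x y : M) (he : Q e = 0) (hx : QuadraticMap.polar Q e x = 0)
    (hy : QuadraticMap.polar Q e y = 0) (hxy : QuadraticMap.polar Q e (x + y) = 0) :
    eichlerG e x he hx * eichlerG e y he hy = eichlerG e (x + y) he hxy :=
  Subtype.ext (Units.ext (eichler_mul he hx y))

theorem polar_tau [FiniteDimensional F M] (g : specialOrthogonal Q) (x y : M) :
    QuadraticMap.polar Q (g.1 x) (g.1 y) = QuadraticMap.polar Q x y := by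
  simp only [QuadraticMap.polar, ← map_add, g.2.1]

theorem conj_eichlerG [FiniteDimensional F M] (g : evenCliffordGroup Q) (e x : M) (he : Q e = 0)
    (hx : QuadraticMap.polar Q e x = 0) :
    g * eichlerG e x he hx * g⁻¹ = eichlerG ((tau g).1 e) ((tau g).1 x)
      (((tau g).2.1 e).trans he) ((polar_tau (tau g) e x).trans hx) := by
  refine Subtype.ext (Units.ext ?_)
  change (g.1 : CliffordAlgebra Q) * (1 + ι Q e * ι Q x) * ((g.1⁻¹ : (CliffordAlgebra Q)ˣ) : _) =
    1 + ι Q _ * ι Q _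
  rw [ι_tau, ι_tau, mul_add, add_mul, mul_one, Units.mul_inv]
  simp only [mul_assoc, Units.inv_mul_cancel_left]

/-- Only the product e·x matters, so a scalar may move from one factor to the other. A denominator
of `e` can thus be absorbed by a sufficiently divisible `x`. -/
theorem eichlerG_smul (e x : M) (he : Q e = 0) (hx : QuadraticMap.polar Q e x = 0) (c : F)
    (hc : c ≠ 0) (he' : Q (c • e) = 0) (hx' : QuadraticMap.polar Q (c • e) (c⁻¹ • x) = 0) :
    eichlerG e x he hx = eichlerG (c • e) (c⁻¹ • x) he' hx' := by
  refine Subtype.ext (Units.ext ?_)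
  change 1 + ι Q e * ι Q x = 1 + ι Q (c • e) * ι Q (c⁻¹ • x)
  rw [map_smul, map_smul, smul_mul_assoc, mul_smul_comm, smul_smul, mul_inv_cancel₀ hc, one_smul]

end CliffordGeneric

end QuadSpace

/-! ### Coordinates on V₀ and explicit elements of G⁺(V₀) -/

namespace QuadSpace
open CliffordAlgebra

/-- The off-diagonal entry of `S`. -/
def tS (m : ℕ) : ℤ := if m % 4 = 3 then 1 else 0

/-- Half of the last entry of `S`. -/
def nS (m : ℕ) : ℤ := if m % 4 = 3 then ((m : ℤ) + 1) / 4 else m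

theorem matS_eq (m : ℕ) : matS m = !![2, tS m; tS m, 2 * nS m] := by
  unfold matS tS nS
  split_ifs with h
  · congr
    omega
  · rfl

section Coordinates
variable {F : Type*} [Field F] [CharZero F] (m ℓ : ℕ)

/-- The norm form `½ xᵗ S x`. -/
def qS (m : ℕ) (x y : F) : F := x ^ 2 + tS m * x * y + nS m * y ^ 2

/-- The bilinear form `xᵗ S y`. -/
def bS (m : ℕ) (x₁ x₂ y₁ y₂ : F) : F :=
  x₁ * (2 * y₁ + tS m * y₂) + x₂ * (tS m * y₁ + 2 * nS m * y₂)

theorem phi_eq (v w : Fin 4 → F) : phi F m v w =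
    2⁻¹ * (v 0 * w 3 + v 3 * w 0 - bS m (v 1) (v 2) (w 1) (w 2)) := by
  simp only [phi, LinearMap.smul_apply, Matrix.toBilin'_apply, Fin.sum_univ_four, matS0,
    Matrix.map_apply, matS_eq, bS]
  simp
  ring

theorem quad_eq (v : Fin 4 → F) : quad F m v = v 0 * v 3 - qS m (v 1) (v 2) := by
  change phi F m v v = _
  rw [phi_eq, bS, qS]
  field_simp
  ring

theorem polar_eq_two_phi (v w : Fin 4 → F) :
    QuadraticMap.polar (quad F m) v w = 2 * phi F m v w := by
  rw [QuadraticMap.polar, quad_eq, quad_eq, quad_eq, phi_eq]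
  simp only [Pi.add_apply, qS, bS]
  ring

theorem polar_eq (v w : Fin 4 → F) : QuadraticMap.polar (quad F m) v w =
    v 0 * w 3 + v 3 * w 0 - bS m (v 1) (v 2) (w 1) (w 2) := by
  rw [polar_eq_two_phi, phi_eq]
  ring

theorem vec4_ext {v w : Fin 4 → F} (h0 : v 0 = w 0) (h1 : v 1 = w 1) (h2 : v 2 = w 2)
    (h3 : v 3 = w 3) : v = w := by
  ext i; fin_cases i <;> assumption

theorem exists_eq_vec4 (v : Fin 4 → F) : ∃ a b c d : F, v = ![a, b, c, d] :=
  ⟨v 0, v 1, v 2, v 3, vec4_ext rfl rfl rfl rfl⟩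

theorem quad_neg_plane (x y : F) : quad F m ![0, -x, -y, 0] = -qS m x y := by
  simp [quad_eq, qS]

/-- `1 + e x` with `e` the first basis vector. -/
noncomputable def uG (x y : F) : GV F m :=
  eichlerG ![1, 0, 0, 0] ![0, x, y, 0] (by simp [quad_eq, qS]) (by simp [polar_eq, bS])

/-- `1 + f x` with `f` the last basis vector. -/
noncomputable def lG (x y : F) : GV F m :=
  eichlerG ![0, 0, 0, 1] ![0, x, y, 0] (by simp [quad_eq, qS]) (by simp [polar_eq, bS])

/-- `(e + c f)(e + f)`. -/
noncomputable def deltaG (c : F) (hc : c ≠ 0) : GV F m :=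
  pairG ![1, 0, 0, c] ![1, 0, 0, 1] (by simpa [quad_eq, qS] using hc) (by simp [quad_eq, qS])

/-- The element `x + y ω` of the even Clifford algebra of the plane `⟨e, f⟩^⊥`. -/
noncomputable def rotG (x y : F) (h : qS m x y ≠ 0) : GV F m :=
  pairG ![0, -x, -y, 0] ![0, 1, 0, 0] (by
    rw [quad_neg_plane]; exact neg_ne_zero.mpr h) (by simp [quad_eq, qS])

theorem tau_uG (x y : F) (v : Fin 4 → F) : (tau (uG m x y)).1 v =
    ![v 0 - bS m x y (v 1) (v 2) + v 3 * qS m x y, v 1 - v 3 * x, v 2 - v 3 * y, v 3] := by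
  obtain ⟨a, b, r, d, rfl⟩ := exists_eq_vec4 v
  rw [uG, tau_eichlerG, eichlerMap]
  simp only [polar_eq, quad_eq, bS, qS]
  apply vec4_ext <;> simp <;> ring

theorem tau_lG (x y : F) (v : Fin 4 → F) : (tau (lG m x y)).1 v =
    ![v 0, v 1 - v 0 * x, v 2 - v 0 * y, v 3 - bS m x y (v 1) (v 2) + v 0 * qS m x y] := by
  obtain ⟨a, b, r, d, rfl⟩ := exists_eq_vec4 v
  rw [lG, tau_eichlerG, eichlerMap]
  simp only [polar_eq, quad_eq, bS, qS]
  apply vec4_ext <;> simp <;> ring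

theorem tau_deltaG (c : F) (hc : c ≠ 0) (v : Fin 4 → F) : (tau (deltaG m c hc)).1 v =
    ![c⁻¹ * v 0, v 1, v 2, c * v 3] := by
  obtain ⟨a, b, r, d, rfl⟩ := exists_eq_vec4 v
  rw [deltaG, tau_pairG, reflect, reflect]
  simp only [polar_eq, quad_eq, bS, qS]
  apply vec4_ext <;> simp <;> field_simp <;> ring

/-- Identify (0, a, b, 0) with a + bω, where ω² = tω − n, t = `tS m` and n = `nS m`; then `qS` is
the norm form N. The product of the two reflections is multiplication by z²/N(z) = z/z̄ with z = x +
yω. -/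
theorem tau_rotG (x y : F) (h : qS m x y ≠ 0) (v : Fin 4 → F) : (tau (rotG m x y h)).1 v =
    ![v 0, ((x ^ 2 - nS m * y ^ 2) * v 1 - nS m * (2 * x * y + tS m * y ^ 2) * v 2) / qS m x y,
      ((2 * x * y + tS m * y ^ 2) * v 1 +
        (x ^ 2 - nS m * y ^ 2 + tS m * (2 * x * y + tS m * y ^ 2)) * v 2) / qS m x y, v 3] := by
  obtain ⟨a, b, r, d, rfl⟩ := exists_eq_vec4 v
  have h1 : quad F m ![0, 1, 0, 0] = -1 := by simp [quad_eq, qS]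
  rw [rotG, tau_pairG, reflect, reflect, quad_neg_plane, h1]
  simp only [polar_eq, bS]
  apply vec4_ext <;> simp <;> field_simp <;> simp only [qS] <;> ring

theorem hasNorm_uG (x y : F) : HasNorm (uG m x y) 1 := hasNorm_eichlerG _ _ _ _
theorem hasNorm_lG (x y : F) : HasNorm (lG m x y) 1 := hasNorm_eichlerG _ _ _ _

theorem hasNorm_deltaG (c : F) (hc : c ≠ 0) : HasNorm (deltaG m c hc) c := by
  have h : quad F m ![1, 0, 0, c] * quad F m ![1, 0, 0, 1] = c := by simp [quad_eq, qS]
  have := hasNorm_pairG (Q := quad F m) ![1, 0, 0, c] ![1, 0, 0, 1]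
    (by simpa [quad_eq, qS] using hc) (by simp [quad_eq, qS])
  rwa [h] at this

theorem hasNorm_rotG (x y : F) (h : qS m x y ≠ 0) : HasNorm (rotG m x y h) (qS m x y) := by
  have h' : quad F m ![0, -x, -y, 0] * quad F m ![0, 1, 0, 0] = qS m x y := by
    rw [quad_neg_plane]; simp [quad_eq, qS]
  have := hasNorm_pairG (Q := quad F m) ![0, -x, -y, 0] ![0, 1, 0, 0]
    (by rw [quad_neg_plane]; exact neg_ne_zero.mpr h) (by simp [quad_eq, qS])
  rwa [h'] at this

theorem uG_mul (x y x' y' : F) : uG m x y * uG m x' y' = uG m (x + x') (y + y') := by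
  rw [uG, uG, eichlerG_mul _ _ _ _ _ _ (by simp [polar_eq, bS]), uG]
  congr 1
  apply vec4_ext <;> simp

theorem lG_mul (x y x' y' : F) : lG m x y * lG m x' y' = lG m (x + x') (y + y') := by
  rw [lG, lG, eichlerG_mul _ _ _ _ _ _ (by simp [polar_eq, bS]), lG]
  congr 1
  apply vec4_ext <;> simp

theorem uG_zero : uG m (0 : F) 0 = 1 := by
  have := uG_mul m (0 : F) 0 0 0
  rw [add_zero] at this
  exact mul_eq_left.mp this

theorem lG_zero : lG m (0 : F) 0 = 1 := by
  have := lG_mul m (0 : F) 0 0 0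
  rw [add_zero] at this
  exact mul_eq_left.mp this

theorem uG_inv (x y : F) : (uG m x y)⁻¹ = uG m (-x) (-y) :=
  inv_eq_of_mul_eq_one_right (by rw [uG_mul, add_neg_cancel, add_neg_cancel, uG_zero])

theorem lG_inv (x y : F) : (lG m x y)⁻¹ = lG m (-x) (-y) :=
  inv_eq_of_mul_eq_one_right (by rw [lG_mul, add_neg_cancel, add_neg_cancel, lG_zero])

theorem SOV_ext {g h : SOV F m} (H : ∀ v, g.1 v = h.1 v) : g = h :=
  Subtype.ext (LinearEquiv.ext H)

theorem SOV_mul_apply (g h : SOV F m) (v : Fin 4 → F) : (g * h).1 v = g.1 (h.1 v) := rfl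

theorem SOV_inv_apply_apply (g : SOV F m) (v : Fin 4 → F) : g⁻¹.1 (g.1 v) = v :=
  LinearEquiv.symm_apply_apply g.1 v

theorem SOV_apply_inv_apply (g : SOV F m) (v : Fin 4 → F) : g.1 (g⁻¹.1 v) = v :=
  LinearEquiv.apply_symm_apply g.1 v

theorem SOV_inv_apply_eq {g : SOV F m} {v w : Fin 4 → F} : g⁻¹.1 v = w ↔ v = g.1 w :=
  LinearEquiv.symm_apply_eq g.1

end Coordinates

/-! ### The kernel of τ and the norm ν -/

section Kernel
variable {F : Type*} [Field F] [CharZero F] {m : ℕ}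

theorem disc_ne_zero (hm : Squarefree m) : (4 * nS m - tS m ^ 2 : F) ≠ 0 := by
  have h : (4 * nS m - tS m ^ 2 : ℤ) ≠ 0 := by
    have := hm.ne_zero
    unfold nS tS
    split_ifs <;> omega
  exact_mod_cast (Int.cast_ne_zero (α := F)).mpr h

/-- The polar form of `φ₀` is non-degenerate: this solves `2 φ₀(·, w) = d`. -/
theorem exists_polar_eq (hm : Squarefree m) (d : Module.Dual F (Fin 4 → F)) :
    ∃ w, QuadraticMap.polarBilin (quad F m) w = d := by
  have hD := disc_ne_zero (F := F) hm
  set D : F := 4 * nS m - tS m ^ 2 with hDdef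
  let c : Fin 4 → F := fun i => d (Pi.single i 1)
  refine ⟨![c 3, -(2 * nS m * c 1 - tS m * c 2) / D, -(2 * c 2 - tS m * c 1) / D, c 0], ?_⟩
  refine (Pi.basisFun F (Fin 4)).ext fun i => ?_
  rw [Pi.basisFun_apply, QuadraticMap.polarBilin_apply_apply, polar_eq]
  change _ = c i
  fin_cases i <;> simp [bS] <;> field_simp <;> rw [hDdef] <;> ring

/-- On even elements, contraction with 2φ₀(w, ·) is the commutator with w (`contractLeft_polar`). By
non-degeneracy every coordinate functional has this form, so all contractions of x vanish. -/
theorem exists_scalar_of_commute (hm : Squarefree m) (x : CliffordAlgebra (quad F m))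
    (hx : involute x = x) (hc : ∀ v, ι (quad F m) v * x = x * ι (quad F m) v) :
    ∃ r : F, x = algebraMap F _ r := by
  refine exists_scalar_of_contractLeft_eq_zero _ (Pi.basisFun F (Fin 4)) x fun i => ?_
  obtain ⟨w, hw⟩ := exists_polar_eq hm ((Pi.basisFun F (Fin 4)).coord i)
  rw [← hw, contractLeft_polar, hx, hc, sub_self]

theorem exists_scalarG_of_tau_eq_one (hm : Squarefree m) {α : GV F m} (h : tau α = 1) :
    ∃ (c : F) (hc : c ≠ 0), α = scalarG _ c hc := by
  obtain ⟨c, hc⟩ := exists_scalar_of_commute hm (α.1 : CliffordAlgebra (quad F m)) α.2.1 (fun v => by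
    have h1 := ι_tau α v
    rw [h] at h1
    change ι _ v = _ at h1
    calc ι (quad F m) v * (α.1 : CliffordAlgebra (quad F m)) = _ := congrArg (· * _) h1
      _ = _ := by simp only [mul_assoc, Units.inv_mul, mul_one])
  have hc0 : c ≠ 0 := by
    rintro rfl
    rw [map_zero] at hc
    exact α.1.ne_zero hc
  exact ⟨c, hc0, Subtype.ext (Units.ext hc)⟩

theorem exists_scalarG_mul_of_tau_eq (hm : Squarefree m) {α β : GV F m} (h : tau α = tau β) :
    ∃ (c : F) (hc : c ≠ 0), α = scalarG _ c hc * β := by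
  obtain ⟨c, hc, h'⟩ := exists_scalarG_of_tau_eq_one hm (α := α * β⁻¹)
    (by rw [map_mul, h, ← map_mul, mul_inv_cancel, map_one])
  exact ⟨c, hc, by rw [← h', inv_mul_cancel_right]⟩

/-- The vector αvα⁻¹ is fixed by reversal; comparing it with its reverse shows that α^*α commutes
with all vectors, so it is a scalar. Conjugation by α then gives the same value for αα^*. -/
theorem exists_hasNorm (hm : Squarefree m) (α : GV F m) : ∃ c : F, c ≠ 0 ∧ HasNorm α c := by
  set a : CliffordAlgebra (quad F m) := (α.1 : CliffordAlgebra (quad F m))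
  set b : CliffordAlgebra (quad F m) := ((α.1⁻¹ : (CliffordAlgebra (quad F m))ˣ) :
    CliffordAlgebra (quad F m))
  have hab : a * b = 1 := α.1.mul_inv
  have hba : b * a = 1 := α.1.inv_mul
  have hra : reverse b * reverse a = 1 := by rw [← reverse.map_mul, hab, reverse.map_one]
  have hinv : involute (reverse a) = reverse a := by
    rw [← reverse_involute]
    exact congrArg reverse α.2.1
  have hcomm : ∀ v, ι (quad F m) v * (reverse a * a) = (reverse a * a) * ι (quad F m) v := by
    intro v
    have h1 := ι_tau α v
    have h2 := congrArg reverse h1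
    rw [reverse_ι, reverse.map_mul, reverse.map_mul, reverse_ι, h1] at h2
    change a * ι _ v * b = reverse b * (ι _ v * reverse a) at h2
    have hra' : reverse a * reverse b = 1 := by rw [← reverse.map_mul, hba, reverse.map_one]
    calc ι (quad F m) v * (reverse a * a)
        = (reverse a * reverse b) * (ι (quad F m) v * reverse a) * a := by
          rw [hra', one_mul, mul_assoc]
      _ = reverse a * (a * ι _ v * b) * a := by rw [mul_assoc (reverse a), ← h2]
      _ = _ := by simp only [mul_assoc, hba, mul_one]
  obtain ⟨c, hc⟩ := exists_scalar_of_commute hm (reverse a * a) (by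
    rw [map_mul, hinv]; congr 1; exact α.2.1) hcomm
  have h1 : HasNorm α c := by
    change a * reverse a = _
    calc a * reverse a = a * (reverse a * a) * b := by
          simp only [mul_assoc, hab, mul_one]
      _ = _ := by rw [hc, ← Algebra.commutes, mul_assoc, hab, mul_one]
  refine ⟨c, ?_, h1⟩
  rintro rfl
  have h2 : a * reverse a = 0 := by rw [← map_zero (algebraMap F _)]; exact h1
  have h3 : reverse a = 0 := by rw [← one_mul (reverse a), ← hba, mul_assoc, h2, mul_zero]
  rw [h3, mul_zero] at hra
  have : Nontrivial (CliffordAlgebra (quad F m)) := (algebraMap_inj (quad F m)).nontrivial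
  exact zero_ne_one hra

end Kernel
end QuadSpace

/-! ### Lattices over local rings and elementary transformations -/

namespace QuadSpace
open CliffordAlgebra

section Local
variable {F : Type*} [Field F] [CharZero F] (O : Subring F) {m : ℕ}

/-- `c` is a unit of the subring `O`. -/
def IsUnitIn (c : F) : Prop := c ≠ 0 ∧ c ∈ O ∧ c⁻¹ ∈ O

variable {O}

theorem IsUnitIn.neg {c : F} (h : IsUnitIn O c) : IsUnitIn O (-c) :=
  ⟨neg_ne_zero.mpr h.1, O.neg_mem h.2.1, by rw [inv_neg]; exact O.neg_mem h.2.2⟩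

theorem IsUnitIn.inv {c : F} (h : IsUnitIn O c) : IsUnitIn O c⁻¹ :=
  ⟨inv_ne_zero h.1, h.2.2, by rw [inv_inv]; exact h.2.1⟩

theorem IsUnitIn.mul {a b : F} (ha : IsUnitIn O a) (hb : IsUnitIn O b) : IsUnitIn O (a * b) :=
  ⟨mul_ne_zero ha.1 hb.1, O.mul_mem ha.2.1 hb.2.1, by
    rw [mul_inv]; exact O.mul_mem ha.2.2 hb.2.2⟩

theorem isUnitIn_one : IsUnitIn O (1 : F) :=
  ⟨one_ne_zero, O.one_mem, by rw [inv_one]; exact O.one_mem⟩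

theorem IsUnitIn.of_mul_left {a b : F} (ha : a ∈ O) (hb : b ∈ O) (h : IsUnitIn O (a * b)) :
    IsUnitIn O a := by
  refine ⟨left_ne_zero_of_mul h.1, ha, ?_⟩
  have : a⁻¹ = b * (a * b)⁻¹ := by
    have := left_ne_zero_of_mul h.1
    have := right_ne_zero_of_mul h.1
    field_simp
  rw [this]
  exact O.mul_mem hb h.2.2

theorem div_mem_of_isUnitIn {a c : F} (ha : a ∈ O) (h : IsUnitIn O c) : a / c ∈ O := by
  rw [div_eq_mul_inv]
  exact O.mul_mem ha h.2.2

variable (O) in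
/-- The subring `O` of `F` is local. -/
def IsLocalIn : Prop :=
  ∀ a ∈ O, ∀ b ∈ O, IsUnitIn O (a + b) → IsUnitIn O a ∨ IsUnitIn O b

/-- With `O = ⊤` the lattice statements below become statements over the field, in the manner of
Witt's theorem. -/
theorem isLocalIn_top : IsLocalIn (⊤ : Subring F) := by
  intro a _ b _ h
  by_cases ha : a = 0
  · exact Or.inr (by simpa [ha] using h)
  · exact Or.inl ⟨ha, trivial, trivial⟩

theorem qS_mem {x y : F} (hx : x ∈ O) (hy : y ∈ O) : qS m x y ∈ O :=
  O.add_mem (O.add_mem (O.pow_mem hx 2) (O.mul_mem (O.mul_mem (intCast_mem O _) hx) hy))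
    (O.mul_mem (intCast_mem O _) (O.pow_mem hy 2))

variable (O) in
/-- Membership in the dual of the lattice `O⁴` with respect to `2 φ₀`. -/
def IsDual (m : ℕ) (v : Fin 4 → F) : Prop :=
  v 0 ∈ O ∧ v 3 ∈ O ∧ 2 * v 1 + tS m * v 2 ∈ O ∧ tS m * v 1 + 2 * nS m * v 2 ∈ O

theorem isDual_of_mem {v : Fin 4 → F} (h : v ∈ lattice O) : IsDual O m v := by
  have h2 : (2 : F) ∈ O := by exact_mod_cast natCast_mem O 2
  exact ⟨h 0, h 3, O.add_mem (O.mul_mem h2 (h 1)) (O.mul_mem (intCast_mem O _) (h 2)),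
    O.add_mem (O.mul_mem (intCast_mem O _) (h 1))
      (O.mul_mem (O.mul_mem h2 (intCast_mem O _)) (h 2))⟩

theorem bS_mem {x y a b : F} (hx : x ∈ O) (hy : y ∈ O) (ha : 2 * a + tS m * b ∈ O)
    (hb : tS m * a + 2 * nS m * b ∈ O) : bS m x y a b ∈ O :=
  O.add_mem (O.mul_mem hx ha) (O.mul_mem hy hb)

theorem vec4_mem_lattice {a b c d : F} (ha : a ∈ O) (hb : b ∈ O) (hc : c ∈ O) (hd : d ∈ O) :
    ![a, b, c, d] ∈ lattice O := by
  intro i; fin_cases i <;> assumption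

theorem IsDual.add {v w : Fin 4 → F} (hv : IsDual O m v) (hw : IsDual O m w) :
    IsDual O m (v + w) := by
  refine ⟨O.add_mem hv.1 hw.1, O.add_mem hv.2.1 hw.2.1, ?_, ?_⟩
  · rw [show 2 * (v + w) 1 + tS m * (v + w) 2 =
      (2 * v 1 + tS m * v 2) + (2 * w 1 + tS m * w 2) by simp only [Pi.add_apply]; ring]
    exact O.add_mem hv.2.2.1 hw.2.2.1
  · rw [show tS m * (v + w) 1 + 2 * nS m * (v + w) 2 =
      (tS m * v 1 + 2 * nS m * v 2) + (tS m * w 1 + 2 * nS m * w 2) by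
        simp only [Pi.add_apply]; ring]
    exact O.add_mem hv.2.2.2 hw.2.2.2

theorem mem_stabilizer_of {g : SOV F m} (h : ∀ v ∈ lattice O, g.1 v ∈ lattice O)
    (h' : ∀ v ∈ lattice O, g⁻¹.1 v ∈ lattice O) : g ∈ stabilizer (quad F m) (lattice O) :=
  fun v => ⟨fun hv => by
    have := h' _ hv
    rwa [SOV_inv_apply_apply] at this, h v⟩

variable (O m) in
/-- The kernel of the action of the stabiliser of `O⁴` on the discriminant module. -/
noncomputable def discKernel : Subgroup (SOV F m) where
  carrier := {g | g ∈ stabilizer (quad F m) (lattice O) ∧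
    ∀ v, IsDual O m v → g.1 v - v ∈ lattice O}
  one_mem' := ⟨one_mem _, fun v _ => by
    change v - v ∈ _
    rw [sub_self]; exact zero_mem _⟩
  mul_mem' := by
    rintro a b ⟨ha, ha'⟩ ⟨hb, hb'⟩
    refine ⟨mul_mem ha hb, fun v hv => ?_⟩
    have h1 := hb' v hv
    have h2 : IsDual O m (b.1 v) := by
      have := hv.add (isDual_of_mem h1)
      rwa [add_sub_cancel] at this
    have := add_mem (ha' _ h2) h1
    rwa [sub_add_sub_cancel] at this
  inv_mem' := by
    rintro a ⟨ha, ha'⟩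
    refine ⟨inv_mem ha, fun v hv => ?_⟩
    have h1 := neg_mem ((inv_mem ha (a.1 v - v)).2 (ha' v hv))
    rwa [map_sub, SOV_inv_apply_apply, neg_sub] at h1

variable (O m) in
/-- `{γ | τ(γ) O⁴ = O⁴, ν(γ) ∈ O^×}`. -/
noncomputable abbrev unitG : Subgroup (GV F m) := unitNormStabilizer (quad F m) O (lattice O)

theorem mem_unitG_iff {γ : GV F m} : γ ∈ unitG O m ↔
    tau γ ∈ stabilizer (quad F m) (lattice O) ∧ ∃ c, IsUnitIn O c ∧ HasNorm γ c := by
  constructor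
  · rintro ⟨h, u, hu⟩
    have h1 : ((u : O) : F) * (((u⁻¹ : Oˣ) : O) : F) = 1 := by
      rw [← Subring.coe_mul, Units.mul_inv]; rfl
    refine ⟨h, (u : O), ⟨left_ne_zero_of_mul_eq_one h1, (u : O).2, ?_⟩, hu⟩
    rw [inv_eq_of_mul_eq_one_right h1]
    exact ((u⁻¹ : Oˣ) : O).2
  · rintro ⟨h, c, ⟨h0, h1, h2⟩, hc⟩
    exact ⟨h, ⟨⟨c, h1⟩, ⟨c⁻¹, h2⟩, Subtype.ext (mul_inv_cancel₀ h0),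
      Subtype.ext (inv_mul_cancel₀ h0)⟩, hc⟩

variable (O m) in
/-- The subgroup generated by the `1 + e x`, `1 + f x` with `x` integral and the `(e + c f)(e + f)`
with `c` a unit. -/
noncomputable def elemGroup : Subgroup (GV F m) :=
  Subgroup.closure ({g | ∃ x ∈ O, ∃ y ∈ O, g = uG m x y} ∪ {g | ∃ x ∈ O, ∃ y ∈ O, g = lG m x y} ∪
    {g | ∃ c, ∃ h : IsUnitIn O c, g = deltaG m c h.1})

theorem uG_mem_elemGroup {x y : F} (hx : x ∈ O) (hy : y ∈ O) : uG m x y ∈ elemGroup O m :=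
  Subgroup.subset_closure (Or.inl (Or.inl ⟨x, hx, y, hy, rfl⟩))

theorem lG_mem_elemGroup {x y : F} (hx : x ∈ O) (hy : y ∈ O) : lG m x y ∈ elemGroup O m :=
  Subgroup.subset_closure (Or.inl (Or.inr ⟨x, hx, y, hy, rfl⟩))

theorem deltaG_mem_elemGroup {c : F} (h : IsUnitIn O c) : deltaG m c h.1 ∈ elemGroup O m :=
  Subgroup.subset_closure (Or.inr ⟨c, h, rfl⟩)

theorem uG_disc {x y : F} (hx : x ∈ O) (hy : y ∈ O) {v : Fin 4 → F} (hv : IsDual O m v) :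
    (tau (uG m x y)).1 v - v ∈ lattice O := by
  rw [tau_uG]
  have : ![v 0 - bS m x y (v 1) (v 2) + v 3 * qS m x y, v 1 - v 3 * x, v 2 - v 3 * y, v 3] - v =
      ![- bS m x y (v 1) (v 2) + v 3 * qS m x y, -(v 3 * x), -(v 3 * y), 0] := by
    apply vec4_ext <;> simp
    ring
  rw [this]
  exact vec4_mem_lattice (O.add_mem (O.neg_mem (bS_mem hx hy hv.2.2.1 hv.2.2.2))
    (O.mul_mem hv.2.1 (qS_mem hx hy))) (O.neg_mem (O.mul_mem hv.2.1 hx))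
    (O.neg_mem (O.mul_mem hv.2.1 hy)) O.zero_mem

theorem lG_disc {x y : F} (hx : x ∈ O) (hy : y ∈ O) {v : Fin 4 → F} (hv : IsDual O m v) :
    (tau (lG m x y)).1 v - v ∈ lattice O := by
  rw [tau_lG]
  have : ![v 0, v 1 - v 0 * x, v 2 - v 0 * y, v 3 - bS m x y (v 1) (v 2) + v 0 * qS m x y] - v =
      ![0, -(v 0 * x), -(v 0 * y), - bS m x y (v 1) (v 2) + v 0 * qS m x y] := by
    apply vec4_ext <;> simp
    ring
  rw [this]
  exact vec4_mem_lattice O.zero_mem (O.neg_mem (O.mul_mem hv.1 hx))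
    (O.neg_mem (O.mul_mem hv.1 hy)) (O.add_mem (O.neg_mem (bS_mem hx hy hv.2.2.1 hv.2.2.2))
    (O.mul_mem hv.1 (qS_mem hx hy)))

theorem mem_lattice_of_sub {v w : Fin 4 → F} (hv : v ∈ lattice O) (h : w - v ∈ lattice O) :
    w ∈ lattice O := by
  have := add_mem h hv
  rwa [sub_add_cancel] at this

theorem uG_mem_discKernel {x y : F} (hx : x ∈ O) (hy : y ∈ O) :
    tau (uG m x y) ∈ discKernel O m := by
  refine ⟨mem_stabilizer_of (fun v hv => mem_lattice_of_sub hv (uG_disc hx hy (isDual_of_mem hv)))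
    (fun v hv => ?_), fun v hv => uG_disc hx hy hv⟩
  rw [← map_inv, uG_inv]
  exact mem_lattice_of_sub hv (uG_disc (O.neg_mem hx) (O.neg_mem hy) (isDual_of_mem hv))

theorem lG_mem_discKernel {x y : F} (hx : x ∈ O) (hy : y ∈ O) :
    tau (lG m x y) ∈ discKernel O m := by
  refine ⟨mem_stabilizer_of (fun v hv => mem_lattice_of_sub hv (lG_disc hx hy (isDual_of_mem hv)))
    (fun v hv => ?_), fun v hv => lG_disc hx hy hv⟩
  rw [← map_inv, lG_inv]
  exact mem_lattice_of_sub hv (lG_disc (O.neg_mem hx) (O.neg_mem hy) (isDual_of_mem hv))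

theorem tau_deltaG_inv (c : F) (hc : c ≠ 0) :
    (tau (deltaG m c hc))⁻¹ = tau (deltaG m c⁻¹ (inv_ne_zero hc)) := by
  refine inv_eq_of_mul_eq_one_right (SOV_ext _ fun v => ?_)
  rw [SOV_mul_apply, tau_deltaG, tau_deltaG]
  apply vec4_ext <;> simp [hc]

theorem deltaG_mem_discKernel {c : F} (hc : IsUnitIn O c) :
    tau (deltaG m c hc.1) ∈ discKernel O m := by
  have h1 : ∀ (c : F) (hc : IsUnitIn O c) (v : Fin 4 → F), IsDual O m v →
      (tau (deltaG m c hc.1)).1 v - v ∈ lattice O := by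
    intro c hc v hv
    rw [tau_deltaG]
    have : ![c⁻¹ * v 0, v 1, v 2, c * v 3] - v = ![c⁻¹ * v 0 - v 0, 0, 0, c * v 3 - v 3] := by
      apply vec4_ext <;> simp
    rw [this]
    exact vec4_mem_lattice (O.sub_mem (O.mul_mem hc.2.2 hv.1) hv.1) O.zero_mem O.zero_mem
      (O.sub_mem (O.mul_mem hc.2.1 hv.2.1) hv.2.1)
  refine ⟨mem_stabilizer_of (fun v hv => mem_lattice_of_sub hv (h1 c hc v (isDual_of_mem hv)))
    (fun v hv => ?_), h1 c hc⟩
  rw [tau_deltaG_inv]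
  exact mem_lattice_of_sub hv (h1 _ hc.inv v (isDual_of_mem hv))

theorem elemGroup_le_comap_discKernel : elemGroup O m ≤ (discKernel O m).comap tau := by
  rw [elemGroup, Subgroup.closure_le]
  rintro g ((⟨x, hx, y, hy, rfl⟩ | ⟨x, hx, y, hy, rfl⟩) | ⟨c, hc, rfl⟩)
  · exact uG_mem_discKernel hx hy
  · exact lG_mem_discKernel hx hy
  · exact deltaG_mem_discKernel hc

theorem elemGroup_le_unitG : elemGroup O m ≤ unitG O m := by
  have h := elemGroup_le_comap_discKernel (O := O) (m := m)
  rw [elemGroup, Subgroup.closure_le] at h ⊢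
  intro g hg
  refine mem_unitG_iff.mpr ⟨(h hg).1, ?_⟩
  obtain ((⟨x, hx, y, hy, rfl⟩ | ⟨x, hx, y, hy, rfl⟩) | ⟨c, hc, rfl⟩) := hg
  · exact ⟨1, isUnitIn_one, hasNorm_uG m x y⟩
  · exact ⟨1, isUnitIn_one, hasNorm_lG m x y⟩
  · exact ⟨c, hc, hasNorm_deltaG m c hc.1⟩

theorem elemGroup_apply_mem {g : GV F m} (hg : g ∈ elemGroup O m) {v : Fin 4 → F}
    (hv : v ∈ lattice O) : (tau g).1 v ∈ lattice O :=
  ((elemGroup_le_comap_discKernel hg).1 v).2 hv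

/-- A unit coordinate along e lets `lG` clear the middle coordinates and `deltaG` scale the first to
1. The last coordinate is then forced by the norm. -/
theorem exists_elemGroup_of_unit_zero {v : Fin 4 → F} (hv : v ∈ lattice O)
    (h : IsUnitIn O (v 0)) :
    ∃ g ∈ elemGroup O m, (tau g).1 v = ![1, 0, 0, quad F m v] := by
  refine ⟨deltaG m (v 0) h.1 * lG m (v 1 / v 0) (v 2 / v 0),
    mul_mem (deltaG_mem_elemGroup h) (lG_mem_elemGroup ?_ ?_), ?_⟩
  · exact div_mem_of_isUnitIn (hv 1) h
  · exact div_mem_of_isUnitIn (hv 2) h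
  · have h0 := h.1
    rw [map_mul, SOV_mul_apply, tau_lG, tau_deltaG, quad_eq]
    apply vec4_ext <;> simp [bS, qS] <;> field_simp
    · ring
    · ring
    · ring

/-- The group generated by elementary transformations acts transitively on the primitive vectors
of given norm in `O⁴`, for a local ring `O`. -/
theorem exists_elemGroup_of_primitive (hO : IsLocalIn O) {v w : Fin 4 → F} (hv : v ∈ lattice O)
    (hw : w ∈ lattice O) (h : QuadraticMap.polar (quad F m) v w = 1) :
    ∃ g ∈ elemGroup O m, (tau g).1 v = ![1, 0, 0, quad F m v] := by
  suffices H : ∃ g ∈ elemGroup O m, IsUnitIn O ((tau g).1 v 0) by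
    obtain ⟨g, hg, hu⟩ := H
    obtain ⟨k, hk, hk'⟩ := exists_elemGroup_of_unit_zero (m := m) (elemGroup_apply_mem hg hv) hu
    refine ⟨k * g, mul_mem hk hg, ?_⟩
    rw [map_mul, SOV_mul_apply, hk', (tau g).2.1]
  have hd := isDual_of_mem (m := m) hv
  by_cases h0 : IsUnitIn O (v 0)
  · exact ⟨1, one_mem _, by rw [map_one]; exact h0⟩
  by_cases h3 : IsUnitIn O (v 3)
  -- With `v 3` a unit the middle coordinates can be cleared. If the first coordinate is still not a
  -- unit, `uG m 1 0` adds `v 3` to it, and a non-unit plus a unit is a unit in a local ring.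
  · set v' := (tau (uG m (v 1 / v 3) (v 2 / v 3))).1 v with hv'
    have hg : uG m (v 1 / v 3) (v 2 / v 3) ∈ elemGroup O m :=
      uG_mem_elemGroup (div_mem_of_isUnitIn (hv 1) h3) (div_mem_of_isUnitIn (hv 2) h3)
    have hvm := elemGroup_apply_mem hg hv
    rw [← hv'] at hvm
    by_cases h0' : IsUnitIn O (v' 0)
    · exact ⟨_, hg, h0'⟩
    · refine ⟨uG m 1 0 * uG m (v 1 / v 3) (v 2 / v 3),
        mul_mem (uG_mem_elemGroup O.one_mem O.zero_mem) hg, ?_⟩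
      rw [map_mul, SOV_mul_apply, ← hv', tau_uG]
      have e1 : v' 1 = 0 := by rw [hv', tau_uG]; simp [mul_div_cancel₀ _ h3.1]
      have e2 : v' 2 = 0 := by rw [hv', tau_uG]; simp [mul_div_cancel₀ _ h3.1]
      have e3 : v' 3 = v 3 := by rw [hv', tau_uG]; simp
      have : ![v' 0 - bS m 1 0 (v' 1) (v' 2) + v' 3 * qS m 1 0, v' 1 - v' 3 * 1, v' 2 - v' 3 * 0,
          v' 3] 0 = v' 0 + v 3 := by simp [e1, e2, e3, bS, qS]
      rw [this]
      rcases hO (v' 0 + v 3) (O.add_mem (hvm 0) (hv 3)) (-v' 0) (O.neg_mem (hvm 0))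
        (by simpa using h3) with h' | h'
      · exact h'
      · exact absurd (by simpa using h'.neg) h0'
  -- Now `v 0` and `v 3` are non-units, so the new first coordinate differs from −`bS` by a
  -- non-unit. It is therefore enough that `bS` takes a unit value.
  have key : ∀ x ∈ O, ∀ y ∈ O, IsUnitIn O (bS m x y (v 1) (v 2)) →
      ∃ g ∈ elemGroup O m, IsUnitIn O ((tau g).1 v 0) := by
    intro x hx y hy hu
    refine ⟨uG m x y, uG_mem_elemGroup hx hy, ?_⟩
    rw [tau_uG]
    have hb := hu.2.1
    change IsUnitIn O (v 0 - bS m x y (v 1) (v 2) + v 3 * qS m x y)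
    have hq := O.mul_mem (hv 3) (qS_mem (m := m) hx hy)
    by_contra hcon
    rcases hO (-(v 0 - bS m x y (v 1) (v 2) + v 3 * qS m x y))
      (O.neg_mem (O.add_mem (O.sub_mem (hv 0) hb) hq)) (v 0 + v 3 * qS m x y)
      (O.add_mem (hv 0) hq) (by convert hu using 1; ring) with h' | h'
    · exact hcon (by simpa using h'.neg)
    · rcases hO _ (hv 0) _ hq h' with h' | h'
      · exact h0 h'
      · exact h3 (h'.of_mul_left (hv 3) (qS_mem hx hy))
  rw [polar_eq] at h
  -- The pairing with `w` equals 1 and its two hyperbolic terms are non-units, so the contribution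
  -- of the plane is a unit.
  have hsum : IsUnitIn O ((v 0 * w 3 + v 3 * w 0) + -bS m (w 1) (w 2) (v 1) (v 2)) := by
    convert isUnitIn_one (O := O) using 1
    rw [← h]; simp only [bS]; ring
  have hbm := bS_mem (m := m) (hw 1) (hw 2) hd.2.2.1 hd.2.2.2
  rcases hO _ (O.add_mem (O.mul_mem (hv 0) (hw 3)) (O.mul_mem (hv 3) (hw 0))) _
    (O.neg_mem hbm) hsum with h' | h'
  · rcases hO _ (O.mul_mem (hv 0) (hw 3)) _ (O.mul_mem (hv 3) (hw 0)) h' with h' | h'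
    · exact absurd (h'.of_mul_left (hv 0) (hw 3)) h0
    · exact absurd (h'.of_mul_left (hv 3) (hw 0)) h3
  · exact key _ (hw 1) _ (hw 2) (by simpa using h'.neg)

/-- An isometry preserving `O⁴` can be moved to one that fixes `e` and `f`. -/
theorem exists_elemGroup_fix (hO : IsLocalIn O) {g : SOV F m}
    (hg : g ∈ stabilizer (quad F m) (lattice O)) :
    ∃ k ∈ elemGroup O m, (tau k * g).1 ![1, 0, 0, 0] = ![1, 0, 0, 0] ∧
      (tau k * g).1 ![0, 0, 0, 1] = ![0, 0, 0, 1] := by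
  have me : (![1, 0, 0, 0] : Fin 4 → F) ∈ lattice O :=
    vec4_mem_lattice O.one_mem O.zero_mem O.zero_mem O.zero_mem
  have mf : (![0, 0, 0, 1] : Fin 4 → F) ∈ lattice O :=
    vec4_mem_lattice O.zero_mem O.zero_mem O.zero_mem O.one_mem
  have pef : QuadraticMap.polar (quad F m) ![1, 0, 0, 0] ![0, 0, 0, 1] = 1 := by
    simp [polar_eq, bS]
  obtain ⟨k, hk, hk'⟩ := exists_elemGroup_of_primitive (m := m) hO ((hg _).2 me) ((hg _).2 mf)
    ((polar_tau g _ _).trans pef)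
  have he : (tau k * g).1 ![1, 0, 0, 0] = ![1, 0, 0, 0] := by
    rw [SOV_mul_apply, hk', g.2.1]
    simp [quad_eq, qS]
  -- The image of f is isotropic and pairs to 1 with e, so it has last coordinate 1 and first
  -- coordinate `qS m (f' 1) (f' 2)`. The corresponding `uG` sends such a vector to f and fixes e.
  set f' := (tau k * g).1 ![0, 0, 0, 1] with hf'
  have hf'm : f' ∈ lattice O := elemGroup_apply_mem hk ((hg _).2 mf)
  have h1 : f' 3 = 1 := by
    have := polar_tau (tau k * g) ![1, 0, 0, 0] ![0, 0, 0, 1]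
    rw [he, ← hf', pef, polar_eq] at this
    simpa [bS] using this
  have h2 : f' 0 = qS m (f' 1) (f' 2) := by
    have := (tau k * g).2.1 ![0, 0, 0, 1]
    rw [← hf', quad_eq, quad_eq, h1] at this
    have h4 : qS m (0 : F) 0 = 0 := by simp [qS]
    simp only [mul_one, Matrix.cons_val, h4] at this
    linear_combination this
  refine ⟨uG m (f' 1) (f' 2) * k, mul_mem (uG_mem_elemGroup (hf'm 1) (hf'm 2)) hk, ?_, ?_⟩
  · rw [map_mul, mul_assoc, SOV_mul_apply, he, tau_uG]
    apply vec4_ext <;> simp [bS]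
  · rw [map_mul, mul_assoc, SOV_mul_apply, ← hf', tau_uG, h1, h2]
    apply vec4_ext <;> simp [bS, qS]
    ring

end Local
end QuadSpace

/-! ### Rotations of the plane ⟨e, f⟩^⊥, Hilbert 90 and generation by unipotents -/

namespace QuadSpace
open CliffordAlgebra

section Rotations
variable {F : Type*} [Field F] [CharZero F] {m : ℕ}

/-- `g` is multiplication by `x + y ω` on the plane `⟨e, f⟩^⊥`, and fixes `e` and `f`. -/
def IsRotation (x y : F) (g : SOV F m) : Prop :=
  ∀ v, g.1 v = ![v 0, x * v 1 - nS m * y * v 2, y * v 1 + (x + tS m * y) * v 2, v 3]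

theorem det_toMatrix_eq_one (g : SOV F m) :
    (LinearMap.toMatrix' (g.1 : (Fin 4 → F) →ₗ[F] (Fin 4 → F))).det = 1 := by
  rw [LinearMap.det_toMatrix', ← LinearEquiv.coe_det, g.2.2, Units.val_one]

/-- Fixing e and f forces the plane orthogonal to them to be preserved. The image of 1 has norm one,
and its pairing with the image of ω together with determinant 1 determines the latter. Only
multiplication by a norm-one element is left, the determinant excluding reflections. -/
theorem exists_isRotation {g : SOV F m} (he : g.1 ![1, 0, 0, 0] = ![1, 0, 0, 0])
    (hf : g.1 ![0, 0, 0, 1] = ![0, 0, 0, 1]) :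
    ∃ x y : F, qS m x y = 1 ∧ IsRotation x y g := by
  have hp : ∀ v, v 0 = 0 → v 3 = 0 → g.1 v 0 = 0 ∧ g.1 v 3 = 0 := by
    intro v h0 h3
    have h1 := polar_tau g v ![1, 0, 0, 0]
    have h2 := polar_tau g v ![0, 0, 0, 1]
    rw [he, polar_eq, polar_eq] at h1
    rw [hf, polar_eq, polar_eq] at h2
    constructor
    · simpa [bS, h0, h3] using h2
    · simpa [bS, h0, h3] using h1
  obtain ⟨a0, a3⟩ := hp ![0, 1, 0, 0] rfl rfl
  obtain ⟨b0, b3⟩ := hp ![0, 0, 1, 0] rfl rfl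
  set p := g.1 ![0, 1, 0, 0] with hpdef
  set r := g.1 ![0, 0, 1, 0] with hrdef
  have hv : ∀ v : Fin 4 → F, g.1 v =
      v 0 • ![1, 0, 0, 0] + v 1 • p + v 2 • r + v 3 • ![0, 0, 0, 1] := by
    intro v
    have : v = v 0 • ![1, 0, 0, 0] + v 1 • ![0, 1, 0, 0] + v 2 • ![0, 0, 1, 0] +
        v 3 • ![0, 0, 0, 1] := by apply vec4_ext <;> simp
    conv_lhs => rw [this]
    simp only [map_add, map_smul, he, hf, ← hpdef, ← hrdef]
  have hN : qS m (p 1) (p 2) = 1 := by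
    have := g.2.1 ![0, 1, 0, 0]
    rw [← hpdef, quad_eq, quad_eq, a0, a3] at this
    simp [qS] at this ⊢
    linear_combination -this
  have hB : bS m (p 1) (p 2) (r 1) (r 2) = tS m := by
    have := polar_tau g ![0, 1, 0, 0] ![0, 0, 1, 0]
    rw [← hpdef, ← hrdef, polar_eq, polar_eq, a0, a3, b0, b3] at this
    simp [bS] at this ⊢
    linear_combination -this
  have hdet : p 1 * r 2 - p 2 * r 1 = 1 := by
    have h := det_toMatrix_eq_one g
    have hM : LinearMap.toMatrix' (g.1 : (Fin 4 → F) →ₗ[F] (Fin 4 → F)) =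
        !![1, 0, 0, 0; 0, p 1, r 1, 0; 0, p 2, r 2, 0; 0, 0, 0, 1] := by
      ext i j
      rw [LinearMap.toMatrix'_apply, LinearEquiv.coe_coe, hv]
      fin_cases i <;> fin_cases j <;> simp [a0, a3, b0, b3]
    rw [hM] at h
    simp [Matrix.det_succ_row_zero, Fin.sum_univ_succ, Fin.succAbove] at h
    linear_combination h
  have hN' : p 1 ^ 2 + tS m * p 1 * p 2 + nS m * p 2 ^ 2 = 1 := hN
  have hB' : p 1 * (2 * r 1 + tS m * r 2) + p 2 * (tS m * r 1 + 2 * nS m * r 2) = tS m := hB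
  have h2 : (2 : F) ≠ 0 := two_ne_zero
  have hr1 : r 1 = -(nS m * p 2) := by
    apply mul_left_cancel₀ h2
    linear_combination -2 * r 1 * hN' + p 1 * hB' - (tS m * p 1 + 2 * nS m * p 2) * hdet
  have hr2 : r 2 = p 1 + tS m * p 2 := by
    apply mul_left_cancel₀ h2
    linear_combination -2 * r 2 * hN' + p 2 * hB' + (2 * p 1 + tS m * p 2) * hdet
  refine ⟨p 1, p 2, hN, fun v => ?_⟩
  rw [hv]
  apply vec4_ext <;> simp only [Pi.add_apply, Pi.smul_apply, smul_eq_mul, a0, a3, b0, b3, hr1, hr2,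
    Matrix.cons_val] <;> ring

theorem IsRotation.unique {x y : F} {g h : SOV F m} (hg : IsRotation x y g)
    (hh : IsRotation x y h) : g = h :=
  SOV_ext _ fun v => by rw [hg, hh]

theorem isRotation_tau_rotG {x y : F} (h : qS m x y ≠ 0) :
    IsRotation ((x ^ 2 - nS m * y ^ 2) / qS m x y) ((2 * x * y + tS m * y ^ 2) / qS m x y)
      (tau (rotG m x y h)) := by
  intro v
  rw [tau_rotG]
  apply vec4_ext <;> simp <;> field_simp

theorem IsRotation.eq_tau_rotG {x y a b : F} {g : SOV F m} (hg : IsRotation x y g)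
    (h : qS m a b ≠ 0) (hx : a ^ 2 - nS m * b ^ 2 = x * qS m a b)
    (hy : 2 * a * b + tS m * b ^ 2 = y * qS m a b) : g = tau (rotG m a b h) := by
  refine hg.unique ?_
  have := isRotation_tau_rotG h
  rwa [hx, hy, mul_div_cancel_right₀ _ h, mul_div_cancel_right₀ _ h] at this

/-- Hilbert 90: a norm-one u equals z/z̄ with z = 1 + u, of norm 2 + Tr u. This norm vanishes only
for u = −1, where z = 2ω − t serves because z̄ = −z. -/
theorem exists_rotG (hm : Squarefree m) {x y : F} (hN : qS m x y = 1) {g : SOV F m}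
    (hg : IsRotation x y g) : ∃ (a b : F) (h : qS m a b ≠ 0), g = tau (rotG m a b h) := by
  have hN' : x ^ 2 + tS m * x * y + nS m * y ^ 2 = 1 := hN
  have hD := disc_ne_zero (F := F) hm
  by_cases h : 2 + 2 * x + tS m * y = 0
  · have hy : y = 0 := by
      have h1 : (4 * nS m - tS m ^ 2 : F) * y ^ 2 = 0 := by
        linear_combination 4 * hN' - (2 * x + tS m * y - 2) * h
      exact pow_eq_zero_iff two_ne_zero |>.mp ((mul_eq_zero.mp h1).resolve_left hD)
    have hx : x = -1 := by
      rw [hy] at h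
      have h2 : (2 : F) ≠ 0 := two_ne_zero
      apply mul_left_cancel₀ h2
      linear_combination h
    have h0 : qS m (-tS m : F) 2 = 4 * nS m - tS m ^ 2 := by simp only [qS]; ring
    refine ⟨-tS m, 2, by rwa [h0], hg.eq_tau_rotG _ ?_ ?_⟩
    · rw [h0, hx]; ring
    · rw [h0, hy]; ring
  · have h0 : qS m (1 + x) y = 2 + 2 * x + tS m * y := by
      simp only [qS]; linear_combination hN'
    refine ⟨1 + x, y, by rwa [h0], hg.eq_tau_rotG _ ?_ ?_⟩
    · rw [h0]; linear_combination -hN'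
    · rw [h0]; ring

theorem top_stabilizer (g : SOV F m) :
    g ∈ stabilizer (quad F m) (lattice (⊤ : Subring F)) :=
  fun _ => ⟨fun _ _ => trivial, fun _ _ => trivial⟩

theorem exists_tau_eq_mul_rotG (hm : Squarefree m) (g : SOV F m) :
    ∃ k ∈ elemGroup (⊤ : Subring F) m, ∃ (a b : F) (h : qS m a b ≠ 0),
      g = tau (k * rotG m a b h) := by
  obtain ⟨k, hk, he, hf⟩ := exists_elemGroup_fix isLocalIn_top (top_stabilizer g)
  obtain ⟨x, y, hN, hr⟩ := exists_isRotation he hf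
  obtain ⟨a, b, h, h'⟩ := exists_rotG hm hN hr
  refine ⟨k⁻¹, inv_mem hk, a, b, h, ?_⟩
  rw [map_mul, ← h', map_inv, inv_mul_cancel_left]

theorem tau_surjective (hm : Squarefree m) (g : SOV F m) : ∃ α : GV F m, tau α = g := by
  obtain ⟨k, _, a, b, h, h'⟩ := exists_tau_eq_mul_rotG hm g
  exact ⟨_, h'.symm⟩

/-- This product is a Weyl element: it exchanges the lines of e and f and acts on the plane as the
reflection in `(x, y)`. -/
theorem tau_weyl {x y : F} (h : qS m x y ≠ 0) (v : Fin 4 → F) :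
    (tau (uG m x y * lG m (-x / qS m x y) (-y / qS m x y) * uG m x y)).1 v =
      ![qS m x y * v 3, v 1 - bS m x y (v 1) (v 2) / qS m x y * x,
        v 2 - bS m x y (v 1) (v 2) / qS m x y * y, v 0 / qS m x y] := by
  obtain ⟨a, b, r, d, rfl⟩ := exists_eq_vec4 v
  have h1 : qS m (-x / qS m x y) (-y / qS m x y) = 1 / qS m x y := by
    have : ∀ c : F, qS m (-x / c) (-y / c) = qS m x y / c ^ 2 := by
      intro c; simp only [qS]; ring
    rw [this]; field_simp
  have h2 : bS m x y x y = 2 * qS m x y := by simp only [qS, bS]; ring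
  have h3 : ∀ c b' r' d' : F, bS m (-x / c) (-y / c) (b' - d' * x) (r' - d' * y) =
      -(bS m x y b' r' - d' * bS m x y x y) / c := by
    intro c b' r' d'; simp only [bS]; ring
  have h4 : ∀ b' r' d' e' : F, bS m x y (b' - d' * x - e' * (-x / qS m x y))
      (r' - d' * y - e' * (-y / qS m x y)) =
      bS m x y b' r' - d' * bS m x y x y + e' / qS m x y * bS m x y x y := by
    intro b' r' d' e'; simp only [bS]; ring
  simp only [map_mul, SOV_mul_apply, tau_uG, tau_lG, Matrix.cons_val, h1, h3, h4, h2]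
  generalize qS m x y = N at *
  generalize bS m x y b r = β at *
  apply vec4_ext <;> simp only [Matrix.cons_val] <;> field_simp <;> ring

/-- A rotation is a product of two plane reflections, each realised by a Weyl element. Together the
two Weyl elements scale e and f by `qS m x y` and its inverse, which `deltaG` undoes. -/
theorem tau_rotG_eq {x y : F} (h : qS m x y ≠ 0) : tau (rotG m x y h) =
    tau (deltaG m (qS m x y) h *
      (uG m x y * lG m (-x / qS m x y) (-y / qS m x y) * uG m x y *
        (uG m 1 0 * lG m (-1 / qS m 1 0) (-0 / qS m 1 0) * uG m 1 0))) := by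
  refine SOV_ext _ fun v => ?_
  have h1 : qS m (1 : F) 0 = 1 := by simp [qS]
  rw [map_mul, map_mul, SOV_mul_apply, SOV_mul_apply, tau_weyl h,
    tau_weyl (x := 1) (y := 0) (by rw [h1]; exact one_ne_zero), tau_deltaG, tau_rotG, h1]
  apply vec4_ext <;> simp only [Matrix.cons_val] <;> field_simp <;> simp only [qS, bS] <;> ring

/-- The group generated by the `1 + e x` and the `1 + f x`. -/
noncomputable def unipGroup (F : Type*) [Field F] [CharZero F] (m : ℕ) : Subgroup (GV F m) :=
  Subgroup.closure (Set.range (fun x : F × F => uG m x.1 x.2) ∪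
    Set.range (fun x : F × F => lG m x.1 x.2))

theorem uG_mem_unipGroup (x y : F) : uG m x y ∈ unipGroup F m :=
  Subgroup.subset_closure (Or.inl ⟨(x, y), rfl⟩)

theorem lG_mem_unipGroup (x y : F) : lG m x y ∈ unipGroup F m :=
  Subgroup.subset_closure (Or.inr ⟨(x, y), rfl⟩)

/-- The torus normalises each unipotent group. Working after τ reduces such relations to
coordinates, and the scalar ambiguity is restored only at the end. -/
theorem tau_deltaG_mul_uG (c : F) (hc : c ≠ 0) (x y : F) :
    tau (deltaG m c hc * uG m x y) = tau (uG m (c⁻¹ * x) (c⁻¹ * y) * deltaG m c hc) := by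
  refine SOV_ext _ fun v => ?_
  obtain ⟨a, b, r, d, rfl⟩ := exists_eq_vec4 v
  simp only [map_mul, SOV_mul_apply, tau_deltaG, tau_uG]
  apply vec4_ext <;> simp [bS, qS] <;> field_simp

theorem tau_deltaG_mul_lG (c : F) (hc : c ≠ 0) (x y : F) :
    tau (deltaG m c hc * lG m x y) = tau (lG m (c * x) (c * y) * deltaG m c hc) := by
  refine SOV_ext _ fun v => ?_
  obtain ⟨a, b, r, d, rfl⟩ := exists_eq_vec4 v
  simp only [map_mul, SOV_mul_apply, tau_deltaG, tau_lG]
  apply vec4_ext <;> simp [bS, qS] <;> field_simp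

theorem tau_deltaG_mul_deltaG (c d : F) (hc : c ≠ 0) (hd : d ≠ 0) :
    tau (deltaG m c hc * deltaG m d hd) = tau (deltaG m (c * d) (mul_ne_zero hc hd)) := by
  refine SOV_ext _ fun v => ?_
  simp only [map_mul, SOV_mul_apply, tau_deltaG]
  apply vec4_ext <;> simp <;> field_simp

theorem exists_tau_deltaG_mul (c : F) (hc : c ≠ 0) {w : GV F m} (hw : w ∈ unipGroup F m) :
    ∃ w' ∈ unipGroup F m, tau (deltaG m c hc * w) = tau (w' * deltaG m c hc) := by
  induction hw using Subgroup.closure_induction with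
  | mem w hw =>
    rcases hw with ⟨x, rfl⟩ | ⟨x, rfl⟩
    · exact ⟨_, uG_mem_unipGroup _ _, tau_deltaG_mul_uG c hc x.1 x.2⟩
    · exact ⟨_, lG_mem_unipGroup _ _, tau_deltaG_mul_lG c hc x.1 x.2⟩
  | one => exact ⟨1, one_mem _, by rw [mul_one, one_mul]⟩
  | mul a b _ _ ha hb =>
    obtain ⟨a', ha', h1⟩ := ha
    obtain ⟨b', hb', h2⟩ := hb
    refine ⟨a' * b', mul_mem ha' hb', ?_⟩
    simp only [map_mul] at *
    rw [← mul_assoc, h1, mul_assoc, h2, mul_assoc]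
  | inv a _ ha =>
    obtain ⟨a', ha', h1⟩ := ha
    refine ⟨a'⁻¹, inv_mem ha', ?_⟩
    simp only [map_mul, map_inv] at *
    rw [eq_inv_mul_iff_mul_eq, ← mul_assoc, ← h1, mul_inv_cancel_right]

/-- The set `τ(w δ)` with `w` unipotently generated. -/
def IsBruhat (g : SOV F m) : Prop :=
  ∃ w ∈ unipGroup F m, ∃ (d : F) (hd : d ≠ 0), g = tau (w * deltaG m d hd)

theorem IsBruhat.unip_mul {g : SOV F m} (hg : IsBruhat g) {w : GV F m}
    (hw : w ∈ unipGroup F m) : IsBruhat (tau w * g) := by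
  obtain ⟨w', hw', d, hd, rfl⟩ := hg
  exact ⟨w * w', mul_mem hw hw', d, hd, by rw [← map_mul, mul_assoc]⟩

theorem IsBruhat.delta_mul {g : SOV F m} (hg : IsBruhat g) (c : F) (hc : c ≠ 0) :
    IsBruhat (tau (deltaG m c hc) * g) := by
  obtain ⟨w, hw, d, hd, rfl⟩ := hg
  obtain ⟨w', hw', h⟩ := exists_tau_deltaG_mul c hc hw
  refine ⟨w', hw', c * d, mul_ne_zero hc hd, ?_⟩
  rw [← map_mul, ← mul_assoc, map_mul, h, ← map_mul, mul_assoc, map_mul, tau_deltaG_mul_deltaG,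
    ← map_mul]

theorem isBruhat_one : IsBruhat (1 : SOV F m) := by
  refine ⟨1, one_mem _, 1, one_ne_zero, SOV_ext _ fun v => ?_⟩
  rw [one_mul, tau_deltaG]
  apply vec4_ext <;> simp

/-- The set of all τ(wδ) contains 1 and is stable under left multiplication by unipotents and by
torus elements, since the torus normalises the unipotents. These generate everything, because the
remaining rotation is itself a torus element times a product of unipotents. -/
theorem isBruhat (hm : Squarefree m) (g : SOV F m) : IsBruhat g := by
  obtain ⟨k, hk, a, b, h, rfl⟩ := exists_tau_eq_mul_rotG hm g
  have hr : IsBruhat (tau (rotG m a b h)) := by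
    rw [tau_rotG_eq, map_mul]
    refine IsBruhat.delta_mul ?_ _ _
    rw [← mul_one (tau _)]
    refine isBruhat_one.unip_mul ?_
    exact mul_mem (mul_mem (mul_mem (uG_mem_unipGroup _ _) (lG_mem_unipGroup _ _))
      (uG_mem_unipGroup _ _)) (mul_mem (mul_mem (uG_mem_unipGroup _ _) (lG_mem_unipGroup _ _))
      (uG_mem_unipGroup _ _))
  rw [map_mul]
  induction hk using Subgroup.closure_induction_left with
  | one => rwa [map_one, one_mul]
  | mul_left x hx y _ ih =>
    rw [map_mul, mul_assoc]
    rcases hx with (⟨x, _, y, _, rfl⟩ | ⟨x, _, y, _, rfl⟩) | ⟨c, hc, rfl⟩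
    · exact ih.unip_mul (uG_mem_unipGroup _ _)
    · exact ih.unip_mul (lG_mem_unipGroup _ _)
    · exact ih.delta_mul _ _
  | inv_mul_cancel x hx y _ ih =>
    rw [map_mul, mul_assoc]
    rcases hx with (⟨x, _, y, _, rfl⟩ | ⟨x, _, y, _, rfl⟩) | ⟨c, hc, rfl⟩
    · exact ih.unip_mul (inv_mem (uG_mem_unipGroup _ _))
    · exact ih.unip_mul (inv_mem (lG_mem_unipGroup _ _))
    · rw [map_inv, tau_deltaG_inv]
      exact ih.delta_mul _ _

theorem exists_eq_scalar_mul_unip_mul_delta (hm : Squarefree m) (α : GV F m) :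
    ∃ (s : F) (hs : s ≠ 0), ∃ w ∈ unipGroup F m, ∃ (d : F) (hd : d ≠ 0),
      α = scalarG _ s hs * (w * deltaG m d hd) := by
  obtain ⟨w, hw, d, hd, h⟩ := isBruhat hm (tau α)
  obtain ⟨s, hs, h'⟩ := exists_scalarG_mul_of_tau_eq hm h
  exact ⟨s, hs, w, hw, d, hd, h'⟩

end Rotations
end QuadSpace

/-! ### Isometries acting trivially on the discriminant module -/

namespace QuadSpace
open CliffordAlgebra

section DiscKernel
variable {F : Type*} [Field F] [CharZero F] {O : Subring F} {m : ℕ}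

/-- An isometry acting trivially on the discriminant module comes from an element of unit norm. -/
theorem exists_unitG_of_mem_discKernel (hm : Squarefree m) (hO : IsLocalIn O) {β : GV F m}
    (hβ : tau β ∈ discKernel O m) :
    ∃ (s : F) (hs : s ≠ 0), ∃ j ∈ unitG O m, β = scalarG _ s hs * j := by
  obtain ⟨k, hk, he, hf⟩ := exists_elemGroup_fix hO hβ.1
  obtain ⟨x, y, hN, hr⟩ := exists_isRotation he hf
  have hρ : tau k * tau β ∈ discKernel O m := mul_mem (elemGroup_le_comap_discKernel hk) hβ
  have hD := disc_ne_zero (F := F) hm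
  have hN' : x ^ 2 + tS m * x * y + nS m * y ^ 2 = 1 := hN
  -- It remains to write the rotation u = x + yω as z/z̄ with z = a + bω of unit norm, since this
  -- norm is the ν of `rotG`.
  suffices H : ∃ (a b : F) (hab : IsUnitIn O (qS m a b)),
      a ^ 2 - nS m * b ^ 2 = x * qS m a b ∧ 2 * a * b + tS m * b ^ 2 = y * qS m a b by
    obtain ⟨a, b, hu, h1, h2⟩ := H
    have h3 := hr.eq_tau_rotG hu.1 h1 h2
    have h4 : rotG m a b hu.1 ∈ unitG O m :=
      mem_unitG_iff.mpr ⟨by rw [← h3]; exact hρ.1, _, hu, hasNorm_rotG m a b hu.1⟩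
    obtain ⟨s, hs, h5⟩ := exists_scalarG_mul_of_tau_eq hm (α := β) (β := k⁻¹ * rotG m a b hu.1)
      (by rw [map_mul, ← h3, map_inv, inv_mul_cancel_left])
    exact ⟨s, hs, _, mul_mem (inv_mem (elemGroup_le_unitG hk)) h4, h5⟩
  set D : F := 4 * nS m - tS m ^ 2 with hDdef
  -- This vector is 1/δ for δ = 2ω − t, where δ² = −D. It lies in the dual lattice, so trivial
  -- action on the discriminant module makes h = (u − 1)/δ = h₀ + h₁ω integral.
  have hdual : IsDual O m ![0, tS m / D, -2 / D, 0] := by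
    refine ⟨O.zero_mem, O.zero_mem, ?_, ?_⟩
    · convert O.zero_mem using 1
      simp only [Matrix.cons_val]; ring
    · convert O.neg_mem O.one_mem using 1
      simp only [Matrix.cons_val]; field_simp; rw [hDdef]; ring
  have hη := hρ.2 _ hdual
  rw [hr] at hη
  obtain ⟨h₀, hh₀⟩ : ∃ h, h = ((x - 1) * tS m + 2 * nS m * y) / D := ⟨_, rfl⟩
  obtain ⟨h₁, hh₁⟩ : ∃ h, h = -(tS m * y + 2 * (x - 1)) / D := ⟨_, rfl⟩
  have m0 : h₀ ∈ O := by
    convert hη 1 using 1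
    rw [hh₀]; simp only [Pi.sub_apply, Matrix.cons_val]; field_simp; ring
  have m1 : h₁ ∈ O := by
    convert hη 2 using 1
    rw [hh₁]; simp only [Pi.sub_apply, Matrix.cons_val]; field_simp; ring
  have hx : x = 1 - (tS m * h₀ + 2 * nS m * h₁) := by
    rw [hh₀, hh₁]; field_simp; rw [hDdef]; ring
  have hy : y = 2 * h₀ + tS m * h₁ := by
    rw [hh₀, hh₁]; field_simp; rw [hDdef]; ring
  -- For u = 1 + δh the condition N(u) = 1 reads N(h) = h₁.
  have hq : h₀ ^ 2 + tS m * h₀ * h₁ + nS m * h₁ ^ 2 = h₁ := by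
    rw [hx, hy] at hN'
    apply mul_left_cancel₀ hD
    rw [hDdef]
    linear_combination hN'
  -- If h₁ is a unit, take z = h: from h − h̄ = h₁δ and N(h) = h₁ one gets h/h̄ = 1 + δh = u.
  by_cases hu : IsUnitIn O h₁
  · refine ⟨h₀, h₁, by rw [qS, hq]; exact hu, ?_, ?_⟩
    · rw [qS, hq, hx]; linear_combination hq
    · rw [qS, hq, hy]; ring
  -- The relation N(h) = h₁ also reads h₀² = h₁(1 − t h₀ − n h₁), so a unit h₀ would make h₁ a unit.
  · have hu0 : ¬ IsUnitIn O h₀ := by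
      intro h
      refine hu (IsUnitIn.of_mul_left (b := 1 - tS m * h₀ - nS m * h₁) m1 ?_ ?_)
      · exact O.sub_mem (O.sub_mem O.one_mem (O.mul_mem (intCast_mem O _) m0))
          (O.mul_mem (intCast_mem O _) m1)
      · convert h.mul h using 1
        linear_combination -hq
    have e1 : qS m (1 - tS m * h₀ - nS m * h₁) h₀ = 1 - tS m * h₀ - nS m * h₁ := by
      rw [qS]; linear_combination nS m * hq
    have m2 := O.mul_mem m0 (intCast_mem O (tS m))
    have m3 := O.mul_mem m1 (intCast_mem O (nS m))
    have m4 : 1 - tS m * h₀ - nS m * h₁ ∈ O := by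
      convert O.sub_mem (O.sub_mem O.one_mem m2) m3 using 1; ring
    -- For h₁ ≠ 0 this z is (h₀/h₁)·h, which defines the same rotation. Its norm is 1 − t h₀ − n h₁,
    -- a unit because h₀ and h₁ are non-units.
    refine ⟨1 - tS m * h₀ - nS m * h₁, h₀, ?_, ?_, ?_⟩
    · rw [e1]
      rcases hO _ m4 _ (O.add_mem m2 m3) (by convert isUnitIn_one (O := O) using 1; ring)
        with h | h
      · exact h
      · rcases hO _ m2 _ m3 h with h | h
        · exact absurd (h.of_mul_left m0 (intCast_mem O _)) hu0
        · exact absurd (h.of_mul_left m1 (intCast_mem O _)) hu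
    · rw [e1, hx]; linear_combination (-nS m) * hq
    · rw [e1, hy]; linear_combination (tS m) * hq

/-- For z = a + bω one has z²/N(z) − 1 = bδz/N(z) with δ = 2ω − t, and δ carries the dual lattice of
the plane into the lattice. -/
theorem rotG_sub_mem {a b : F} (ha : a ∈ O) (hb : b ∈ O) (h : IsUnitIn O (qS m a b))
    {v : Fin 4 → F} (hv : IsDual O m v) : (tau (rotG m a b h.1)).1 v - v ∈ lattice O := by
  have h0 := h.1
  have key : (tau (rotG m a b h.1)).1 v - v = ![0,
      (b * (-a * (tS m * v 1 + 2 * nS m * v 2) - nS m * b * (2 * v 1 + tS m * v 2))) / qS m a b,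
      (b * (-b * (tS m * v 1 + 2 * nS m * v 2) + (a + tS m * b) * (2 * v 1 + tS m * v 2))) /
        qS m a b, 0] := by
    rw [tau_rotG]
    apply vec4_ext <;> simp only [Pi.sub_apply, Matrix.cons_val]
    · ring
    · field_simp; simp only [qS]; ring
    · field_simp; simp only [qS]; ring
    · ring
  rw [key]
  have ht := intCast_mem O (tS m)
  have hn := intCast_mem O (nS m)
  exact vec4_mem_lattice O.zero_mem
    (div_mem_of_isUnitIn (O.mul_mem hb (O.sub_mem (O.mul_mem (O.neg_mem ha) hv.2.2.2)
      (O.mul_mem (O.mul_mem hn hb) hv.2.2.1))) h)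
    (div_mem_of_isUnitIn (O.mul_mem hb (O.add_mem (O.mul_mem (O.neg_mem hb) hv.2.2.2)
      (O.mul_mem (O.add_mem ha (O.mul_mem ht hb)) hv.2.2.1))) h) O.zero_mem

end DiscKernel

/-! ### The p-adic case: unit norm implies trivial discriminant action -/

section Padic
variable {p : Nat.Primes} {m : ℕ}

theorem mem_Zp {x : ℚ_[p]} : x ∈ Zp p ↔ ‖x‖ ≤ 1 := Iff.rfl

theorem isUnitIn_Zp {x : ℚ_[p]} : IsUnitIn (Zp p) x ↔ ‖x‖ = 1 := by
  constructor
  · rintro ⟨h0, h1, h2⟩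
    rw [mem_Zp] at h1 h2
    rw [norm_inv] at h2
    exact le_antisymm h1 ((inv_le_one₀ (norm_pos_iff.mpr h0)).mp h2)
  · intro h
    refine ⟨norm_ne_zero_iff.mp (by rw [h]; exact one_ne_zero), h.le, ?_⟩
    rw [mem_Zp, norm_inv, h, inv_one]

theorem isLocalIn_Zp : IsLocalIn (Zp p) := by
  intro a ha b hb h
  rw [isUnitIn_Zp] at h ⊢
  rw [isUnitIn_Zp]
  rw [mem_Zp] at ha hb
  by_contra! hcon
  have := Padic.nonarchimedean a b
  rw [h] at this
  rcases le_max_iff.mp this with h' | h'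
  · exact hcon.1 (le_antisymm ha h')
  · exact hcon.2 (le_antisymm hb h')

theorem mem_Zp_of_sq_mem {x : ℚ_[p]} (h : x ^ 2 ∈ Zp p) : x ∈ Zp p := by
  rw [mem_Zp, norm_pow] at h
  exact (pow_le_one_iff_of_nonneg (norm_nonneg _) two_ne_zero).mp h

/-- If |b| > 1 then p divides b⁻¹, and c = (c b²)·b⁻² would be divisible by p². -/
theorem mem_Zp_of_squarefree_mul_sq {c : ℕ} (hc : Squarefree c) {b : ℚ_[p]}
    (h : (c : ℚ_[p]) * b ^ 2 ∈ Zp p) : b ∈ Zp p := by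
  by_contra hb
  rw [mem_Zp, not_le] at hb
  have h0 : b ≠ 0 := norm_pos_iff.mp (zero_lt_one.trans hb)
  have h1 : ‖b⁻¹‖ < 1 := by rw [norm_inv]; exact inv_lt_one_of_one_lt₀ hb
  have h2 : ‖b⁻¹‖ ≤ (p : ℝ) ^ (-1 : ℤ) := by
    rw [Padic.norm_le_pow_iff_norm_lt_pow_add_one]
    simpa using h1
  rw [zpow_neg_one] at h2
  have h3 : ‖((c : ℤ) : ℚ_[p])‖ ≤ (p : ℝ) ^ (-(2 : ℕ) : ℤ) := by
    have e : ((c : ℤ) : ℚ_[p]) = (c * b ^ 2) * (b⁻¹) ^ 2 := by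
      push_cast
      field_simp
    rw [e, norm_mul, norm_pow b⁻¹, zpow_neg, zpow_natCast, ← inv_pow]
    calc _ ≤ 1 * ((p : ℝ)⁻¹) ^ 2 := by
          gcongr
          exact h
      _ = _ := one_mul _
  rw [Padic.norm_int_le_pow_iff_dvd] at h3
  have h4 : (p : ℕ) ^ 2 ∣ c := by exact_mod_cast h3
  rw [pow_two] at h4
  exact p.2.not_isUnit (hc _ h4)

/-- The hypotheses say that N(z) and the coordinates of z² are integral, for z = a + bω. Combining
them isolates m b² when m ≡ 3 mod 4, and 2a² followed by m b² otherwise. As m and 2 are square-free,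
integrality of the coordinates follows. -/
theorem mem_Zp_of_rotation (hm : Squarefree m) {a b : ℚ_[p]} (h : qS m a b ∈ Zp p)
    (h1 : a ^ 2 - nS m * b ^ 2 ∈ Zp p) (h2 : 2 * a * b + tS m * b ^ 2 ∈ Zp p) :
    a ∈ Zp p ∧ b ∈ Zp p := by
  by_cases h3 : m % 4 = 3
  · have ht : tS m = 1 := if_pos h3
    have hn : 4 * nS m = (m : ℤ) + 1 := by
      unfold nS; rw [if_pos h3]; omega
    have hn' : 4 * (nS m : ℚ_[p]) = m + 1 := by exact_mod_cast congrArg (Int.cast : ℤ → ℚ_[p]) hn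
    have hb : b ∈ Zp p := by
      refine mem_Zp_of_squarefree_mul_sq hm ?_
      have h5 := (Zp p).sub_mem ((Zp p).sub_mem ((Zp p).add_mem h h) ((Zp p).add_mem h1 h1)) h2
      convert h5 using 1
      simp only [qS, ht, Int.cast_one]
      linear_combination (-b ^ 2) * hn'
    refine ⟨mem_Zp_of_sq_mem ?_, hb⟩
    convert (Zp p).add_mem h1 ((Zp p).mul_mem (intCast_mem _ (nS m)) ((Zp p).pow_mem hb 2)) using 1
    ring
  · have ht : tS m = 0 := if_neg h3
    have hn : nS m = m := if_neg h3
    simp only [qS, ht, hn, Int.cast_zero, Int.cast_natCast, zero_mul, add_zero] at h h1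
    have ha : a ∈ Zp p := by
      refine mem_Zp_of_squarefree_mul_sq (c := 2) Nat.prime_two.squarefree ?_
      convert (Zp p).add_mem h h1 using 1
      push_cast; ring
    refine ⟨ha, mem_Zp_of_squarefree_mul_sq hm ?_⟩
    convert (Zp p).sub_mem h ((Zp p).pow_mem ha 2) using 1
    ring

/-- An element of unit norm that preserves the lattice acts trivially on the discriminant
module. -/
theorem tau_mem_discKernel_of_mem_unitG (hm : Squarefree m) {j : GV ℚ_[p] m}
    (hj : j ∈ unitG (Zp p) m) : tau j ∈ discKernel (Zp p) m := by
  obtain ⟨k, hk, he, hf⟩ := exists_elemGroup_fix isLocalIn_Zp hj.1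
  obtain ⟨x, y, hN, hr⟩ := exists_isRotation he hf
  have hkj : k * j ∈ unitG (Zp p) m := mul_mem (elemGroup_le_unitG hk) hj
  rw [← map_mul] at hr
  obtain ⟨a, b, h0, h1⟩ := exists_rotG hm hN hr
  obtain ⟨s, hs, h2⟩ := exists_scalarG_mul_of_tau_eq hm h1
  obtain ⟨hst, c, hc, hcn⟩ := mem_unitG_iff.mp hkj
  -- Up to the scalar s the element is `rotG` of z = a + bω, so its unit norm is N(sz). Replacing z
  -- by sz does not change the rotation.
  have hcs : c = qS m (s * a) (s * b) := by
    rw [h2] at hcn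
    rw [hcn.unique ((hasNorm_scalarG s hs).mul (hasNorm_rotG m a b h0))]
    simp only [qS]; ring
  have hu : IsUnitIn (Zp p) (qS m (s * a) (s * b)) := hcs ▸ hc
  have h3 := isRotation_tau_rotG hu.1
  have h4 : tau (k * j) = tau (rotG m (s * a) (s * b) hu.1) := by
    rw [h1]
    have hq : qS m (s * a) (s * b) = s ^ 2 * qS m a b := by simp only [qS]; ring
    refine (isRotation_tau_rotG h0).eq_tau_rotG _ ?_ ?_
    · rw [hq]; field_simp
    · rw [hq]; field_simp
  -- The image of 1 under the rotation is z²/N(z), for the rescaled z. Its integrality, with N(z) a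
  -- unit, makes the coordinates of z² integral.
  have h5 : ![0, 1, 0, 0] ∈ lattice (Zp p) := vec4_mem_lattice (Zp p).zero_mem (Zp p).one_mem
    (Zp p).zero_mem (Zp p).zero_mem
  have h6 := (hst _).2 h5
  rw [h4, h3] at h6
  have h7 := (Zp p).mul_mem (h6 1) hu.2.1
  have h8 := (Zp p).mul_mem (h6 2) hu.2.1
  have h0' := hu.1
  simp only [Matrix.cons_val, mul_one, mul_zero, sub_zero, add_zero,
    div_mul_cancel₀ _ h0'] at h7 h8
  obtain ⟨ha, hb⟩ := mem_Zp_of_rotation hm hu.2.1 h7 h8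
  have h9 : tau (k * j) ∈ discKernel (Zp p) m :=
    ⟨hst, fun v hv => by rw [h4]; exact rotG_sub_mem ha hb hu hv⟩
  rw [map_mul] at h9
  exact ((discKernel (Zp p) m).mul_mem_cancel_left (x := tau k)
    (elemGroup_le_comap_discKernel hk)).mp h9

end Padic
end QuadSpace

/-! ### Extension of scalars from ℚ for SO(V₀) and G⁺(V₀) -/

namespace QuadSpace
open CliffordAlgebra

section CastGroups
variable (F : Type*) [Field F] [CharZero F] {m : ℕ}

theorem castV_vec4 (a b c d : ℚ) : castV F ![a, b, c, d] = ![(a : F), b, c, d] :=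
  vec4_ext rfl rfl rfl rfl

theorem castV_span (v : Fin 4 → F) : v = v 0 • castV F ![1, 0, 0, 0] + v 1 • castV F ![0, 1, 0, 0] +
    v 2 • castV F ![0, 0, 1, 0] + v 3 • castV F ![0, 0, 0, 1] := by
  simp only [castV_vec4]
  apply vec4_ext <;> simp

theorem eq_of_eq_castV {N : Type*} [AddCommGroup N] [Module F N] {f g : (Fin 4 → F) →ₗ[F] N}
    (h : ∀ x, f (castV F x) = g (castV F x)) : f = g := by
  ext1 i
  refine LinearMap.ext_ring ?_
  have : Pi.single i (1 : F) = castV F (Pi.single i 1) := by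
    ext j
    simp only [castV, Pi.single_apply, LinearMap.coe_mk, AddHom.coe_mk]
    split_ifs <;> simp
  simp only [LinearMap.comp_apply, LinearMap.single_apply]
  rw [this, h]

theorem clifCastV_ι (x : Fin 4 → ℚ) : clifCastV F m (ι (quad ℚ m) x) = ι (quad F m) (castV F x) :=
  CliffordAlgebra.lift_ι_apply (Q := quad ℚ m) (((ι (quad F m)).restrictScalars ℚ) ∘ₗ castV F) _ x

theorem clifCastV_algebraMap (r : ℚ) :
    clifCastV F m (algebraMap ℚ _ r) = algebraMap F _ (r : F) := by
  rw [AlgHom.commutes, IsScalarTower.algebraMap_apply ℚ F (CliffordAlgebra (quad F m))]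
  rfl

theorem involute_clifCastV (x : CliffordAlgebra (quad ℚ m)) :
    involute (clifCastV F m x) = clifCastV F m (involute x) := by
  induction x using CliffordAlgebra.induction with
  | algebraMap r => rw [clifCastV_algebraMap, AlgHom.commutes, AlgHom.commutes, clifCastV_algebraMap]
  | ι v => rw [clifCastV_ι, involute_ι, involute_ι, map_neg, clifCastV_ι]
  | mul a b ha hb => simp only [map_mul, ha, hb]
  | add a b ha hb => simp only [map_add, ha, hb]

theorem reverse_clifCastV (x : CliffordAlgebra (quad ℚ m)) :
    reverse (clifCastV F m x) = clifCastV F m (reverse x) := by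
  induction x using CliffordAlgebra.induction with
  | algebraMap r => rw [clifCastV_algebraMap, reverse.commutes, reverse.commutes,
      clifCastV_algebraMap]
  | ι v => rw [clifCastV_ι, reverse_ι, reverse_ι, clifCastV_ι]
  | mul a b ha hb => simp only [map_mul, reverse.map_mul, ha, hb]
  | add a b ha hb => simp only [map_add, ha, hb]

theorem clifCastV_conj (α : GV ℚ m) (x : Fin 4 → ℚ) :
    clifCastV F m (α.1 : CliffordAlgebra (quad ℚ m)) * ι (quad F m) (castV F x) *
      clifCastV F m ((α.1⁻¹ : (CliffordAlgebra (quad ℚ m))ˣ) : CliffordAlgebra (quad ℚ m)) =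
      ι (quad F m) (castV F ((tau α).1 x)) := by
  rw [← clifCastV_ι, ← clifCastV_ι, ι_tau, map_mul, map_mul]

theorem clifCastV_conj_mem (α : GV ℚ m) (v : Fin 4 → F) :
    clifCastV F m (α.1 : CliffordAlgebra (quad ℚ m)) * ι (quad F m) v *
      clifCastV F m ((α.1⁻¹ : (CliffordAlgebra (quad ℚ m))ˣ) : CliffordAlgebra (quad ℚ m)) ∈
      LinearMap.range (ι (quad F m)) := by
  rw [castV_span F v]
  simp only [map_add, map_smul, mul_add, add_mul, mul_smul_comm, smul_mul_assoc, clifCastV_conj]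
  simp only [← map_smul, ← map_add]
  exact ⟨_, rfl⟩

/-- The inclusion `G⁺(V₀) → G⁺(V₀ ⊗ F)`. -/
noncomputable def castG : GV ℚ m →* GV F m where
  toFun α := evenCliffordGroup.mk' (clifCastV F m (α.1 : CliffordAlgebra (quad ℚ m)))
    (clifCastV F m ((α.1⁻¹ : (CliffordAlgebra (quad ℚ m))ˣ) : CliffordAlgebra (quad ℚ m)))
    (by rw [← map_mul, Units.mul_inv, map_one]) (by rw [← map_mul, Units.inv_mul, map_one])
    (by rw [involute_clifCastV]; exact congrArg _ α.2.1) (clifCastV_conj_mem F α)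
    (by simpa using clifCastV_conj_mem F α⁻¹)
  map_one' := Subtype.ext (Units.ext (map_one _))
  map_mul' a b := Subtype.ext (Units.ext (map_mul (clifCastV F m)
    (a.1 : CliffordAlgebra (quad ℚ m)) (b.1 : CliffordAlgebra (quad ℚ m))))

theorem coe_castG (α : GV ℚ m) : (castG F α).1 = unitCastV F α := Units.ext rfl

theorem coe_coe_castG (α : GV ℚ m) : ((castG F α).1 : CliffordAlgebra (quad F m)) =
    clifCastV F m (α.1 : CliffordAlgebra (quad ℚ m)) := rfl

variable {F}

theorem isCastV_tau_castG (α : GV ℚ m) : IsCastV (tau α) (tau (castG F α)) :=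
  fun x => tau_apply_of_eq (clifCastV_conj F α x)

theorem IsCastV.unique {h : SOV ℚ m} {g g' : SOV F m} (hg : IsCastV h g) (hg' : IsCastV h g') :
    g = g' :=
  SOV_ext _ fun v => LinearMap.congr_fun (eq_of_eq_castV F
    (f := (g.1 : (Fin 4 → F) →ₗ[F] (Fin 4 → F))) (g := (g'.1 : (Fin 4 → F) →ₗ[F] (Fin 4 → F)))
    fun x => (hg x).trans (hg' x).symm) v

theorem IsCastV.mul {h h' : SOV ℚ m} {g g' : SOV F m} (hg : IsCastV h g) (hg' : IsCastV h' g') :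
    IsCastV (h * h') (g * g') := fun x => by
  rw [SOV_mul_apply, hg', hg, SOV_mul_apply]

theorem IsCastV.inv {h : SOV ℚ m} {g : SOV F m} (hg : IsCastV h g) : IsCastV h⁻¹ g⁻¹ := fun x => by
  rw [SOV_inv_apply_eq, hg, SOV_apply_inv_apply]

theorem hasNorm_castG {α : GV ℚ m} {c : ℚ} (h : HasNorm α c) : HasNorm (castG F α) (c : F) := by
  rw [HasNorm, coe_coe_castG, reverse_clifCastV, ← map_mul, h, clifCastV_algebraMap]

theorem castG_uG (x y : ℚ) : castG F (uG m x y) = uG m (x : F) y := by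
  refine Subtype.ext (Units.ext ?_)
  change clifCastV F m (1 + ι _ _ * ι _ _) = 1 + ι _ _ * ι _ _
  rw [map_add, map_mul, clifCastV_ι, clifCastV_ι, map_one, castV_vec4, castV_vec4]
  simp

theorem castG_lG (x y : ℚ) : castG F (lG m x y) = lG m (x : F) y := by
  refine Subtype.ext (Units.ext ?_)
  change clifCastV F m (1 + ι _ _ * ι _ _) = 1 + ι _ _ * ι _ _
  rw [map_add, map_mul, clifCastV_ι, clifCastV_ι, map_one, castV_vec4, castV_vec4]
  simp

theorem castG_deltaG (c : ℚ) (hc : c ≠ 0) (hc' : (c : F) ≠ 0) :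
    castG F (deltaG m c hc) = deltaG m (c : F) hc' := by
  refine Subtype.ext (Units.ext ?_)
  change clifCastV F m (ι _ _ * ι _ _) = ι _ _ * ι _ _
  rw [map_mul, clifCastV_ι, clifCastV_ι, castV_vec4, castV_vec4]
  simp

theorem castG_scalarG (c : ℚ) (hc : c ≠ 0) (hc' : (c : F) ≠ 0) :
    castG F (scalarG (quad ℚ m) c hc) = scalarG (quad F m) (c : F) hc' :=
  Subtype.ext (Units.ext (clifCastV_algebraMap F c))

theorem HasNorm.inv (hm : Squarefree m) {α : GV F m} {c : F} (h : HasNorm α c) :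
    HasNorm α⁻¹ c⁻¹ := by
  obtain ⟨d, hd, h'⟩ := exists_hasNorm hm α⁻¹
  have h1 := (h.mul h')
  rw [mul_inv_cancel] at h1
  have h2 : c * d = 1 := h1.unique hasNorm_one
  rwa [← eq_inv_of_mul_eq_one_right h2]

end CastGroups

/-! ### Integral Eichler elements and unit scalars -/

section Integrality
variable {F : Type*} [Field F] [CharZero F] {O : Subring F} {m : ℕ}

theorem smul_mem_lattice {c : F} (hc : c ∈ O) {v : Fin 4 → F} (hv : v ∈ lattice O) :
    c • v ∈ lattice O := fun i => O.mul_mem hc (hv i)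

theorem polar_mem {v w : Fin 4 → F} (hv : v ∈ lattice O) (hw : w ∈ lattice O) :
    QuadraticMap.polar (quad F m) v w ∈ O := by
  rw [polar_eq]
  have hd := isDual_of_mem (m := m) hw
  exact O.sub_mem (O.add_mem (O.mul_mem (hv 0) (hw 3)) (O.mul_mem (hv 3) (hw 0)))
    (bS_mem (hv 1) (hv 2) hd.2.2.1 hd.2.2.2)

theorem quad_mem {v : Fin 4 → F} (hv : v ∈ lattice O) : quad F m v ∈ O := by
  rw [quad_eq]
  exact O.sub_mem (O.mul_mem (hv 0) (hv 3)) (qS_mem (hv 1) (hv 2))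

theorem eichlerMap_mem {e x v : Fin 4 → F} (he : e ∈ lattice O) (hx : x ∈ lattice O)
    (hv : v ∈ lattice O) : eichlerMap (quad F m) e x v ∈ lattice O :=
  sub_mem (sub_mem (add_mem hv (smul_mem_lattice (polar_mem hv hx) he))
    (smul_mem_lattice (polar_mem hv he) hx))
    (smul_mem_lattice (O.mul_mem (polar_mem hv he) (quad_mem hx)) he)

theorem eichlerG_mem_unitG {e x : Fin 4 → F} (he : e ∈ lattice O) (hx : x ∈ lattice O)
    (h0 : quad F m e = 0) (h1 : QuadraticMap.polar (quad F m) e x = 0) :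
    eichlerG e x h0 h1 ∈ unitG O m := by
  refine mem_unitG_iff.mpr ⟨mem_stabilizer_of (fun v hv => ?_) (fun v hv => ?_), 1, isUnitIn_one,
    hasNorm_eichlerG e x h0 h1⟩
  · rw [tau_eichlerG]; exact eichlerMap_mem he hx hv
  · have h2 : QuadraticMap.polar (quad F m) e (-x) = 0 := by
      rw [QuadraticMap.polar_neg_right, h1, neg_zero]
    have : (eichlerG e x h0 h1)⁻¹ = eichlerG e (-x) h0 h2 := by
      refine inv_eq_of_mul_eq_one_right ?_
      rw [eichlerG_mul e x (-x) h0 h1 h2 (by simp)]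
      exact Subtype.ext (Units.ext (by change 1 + ι _ _ * ι _ _ = 1; simp))
    rw [← map_inv, this, tau_eichlerG]
    exact eichlerMap_mem he (neg_mem hx) hv

theorem eichlerG_mem_unitG_of_smul {e x : Fin 4 → F} {c : F} (hc : c ≠ 0) (he : c • e ∈ lattice O)
    (hx : c⁻¹ • x ∈ lattice O) (h0 : quad F m e = 0)
    (h1 : QuadraticMap.polar (quad F m) e x = 0) : eichlerG e x h0 h1 ∈ unitG O m := by
  rw [eichlerG_smul e x h0 h1 c hc (by rw [QuadraticMap.map_smul, h0, smul_zero]) (by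
    rw [QuadraticMap.polar_smul_left, QuadraticMap.polar_smul_right, h1, smul_zero, smul_zero])]
  exact eichlerG_mem_unitG he hx _ _

theorem scalarG_mem_unitG {c : F} (hc : IsUnitIn O c) : scalarG (quad F m) c hc.1 ∈ unitG O m :=
  mem_unitG_iff.mpr ⟨by rw [tau_scalarG]; exact one_mem _, _, hc.mul hc, hasNorm_scalarG c hc.1⟩

end Integrality

/-! ### Approximation at a prime and class number one -/

section Approximation
variable {m : ℕ} {p : Nat.Primes}

theorem pnorm_lt_one (p : Nat.Primes) : ‖((p : ℕ) : ℚ_[p])‖ < 1 := Padic.norm_p_lt_one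

theorem exists_denominator (v : Fin 4 → ℚ_[p]) :
    ∃ k : ℕ, ∀ K ≥ k, ((p : ℕ) : ℚ_[p]) ^ K • v ∈ lattice (Zp p) := by
  have h : ∀ x : ℚ_[p], ∃ k : ℕ, ∀ K ≥ k, ((p : ℕ) : ℚ_[p]) ^ K * x ∈ Zp p := by
    intro x
    obtain ⟨k, hk⟩ := exists_pow_lt_of_lt_one (x := (‖x‖ + 1)⁻¹) (by positivity) (pnorm_lt_one p)
    refine ⟨k, fun K hK => ?_⟩
    rw [mem_Zp, norm_mul, norm_pow]
    have h1 : ‖((p : ℕ) : ℚ_[p])‖ ^ K ≤ (‖x‖ + 1)⁻¹ :=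
      (pow_le_pow_of_le_one (norm_nonneg _) (pnorm_lt_one p).le hK).trans hk.le
    calc _ ≤ (‖x‖ + 1)⁻¹ * (‖x‖ + 1) := by gcongr; linarith
      _ = 1 := inv_mul_cancel₀ (by positivity)
  choose k hk using fun i => h (v i)
  refine ⟨k 0 + k 1 + k 2 + k 3, fun K hK i => hk i K ?_⟩
  fin_cases i <;> simp <;> omega

/-- Conjugates of small elementary transformations are integral. -/
theorem exists_conj_small (γ : GV ℚ_[p] m) : ∃ c : ℚ_[p], c ≠ 0 ∧ ∀ x y, x / c ∈ Zp p →
    y / c ∈ Zp p → γ * uG m x y * γ⁻¹ ∈ unitG (Zp p) m ∧ γ * lG m x y * γ⁻¹ ∈ unitG (Zp p) m := by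
  choose k hk using fun v : Fin 4 → ℚ_[p] => exists_denominator ((tau γ).1 v)
  -- A single c = p^K clears the denominators of the images of all four basis vectors. Smallness is
  -- measured by c²: one factor c clears the image of (0, x, y, 0), the other compensates the c
  -- moved onto the isotropic vector.
  obtain ⟨K, hK⟩ : ∃ K, K = k ![1, 0, 0, 0] + k ![0, 1, 0, 0] + k ![0, 0, 1, 0] +
    k ![0, 0, 0, 1] := ⟨_, rfl⟩
  set c : ℚ_[p] := ((p : ℕ) : ℚ_[p]) ^ K with hc
  have hp0 : ((p : ℕ) : ℚ_[p]) ≠ 0 := by exact_mod_cast p.2.ne_zero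
  have hc0 : c ≠ 0 := pow_ne_zero _ hp0
  refine ⟨c * c, mul_ne_zero hc0 hc0, fun x y hx hy => ?_⟩
  have hxy : c⁻¹ • (tau γ).1 ![0, x, y, 0] ∈ lattice (Zp p) := by
    have : ![0, x, y, 0] = x • (![0, 1, 0, 0] : Fin 4 → ℚ_[p]) + y • ![0, 0, 1, 0] := by
      apply vec4_ext <;> simp
    have h1 : c⁻¹ • (tau γ).1 ![0, x, y, 0] = (x / (c * c)) • (c • (tau γ).1 ![0, 1, 0, 0]) +
        (y / (c * c)) • (c • (tau γ).1 ![0, 0, 1, 0]) := by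
      rw [this, map_add, map_smul, map_smul, smul_add, smul_smul, smul_smul, smul_smul, smul_smul]
      congr 2 <;> field_simp
    rw [h1]
    exact add_mem (smul_mem_lattice hx (hk _ K (by omega)))
      (smul_mem_lattice hy (hk _ K (by omega)))
  constructor
  · rw [uG, conj_eichlerG]
    exact eichlerG_mem_unitG_of_smul hc0 (hk _ K (by omega)) hxy _ _
  · rw [lG, conj_eichlerG]
    exact eichlerG_mem_unitG_of_smul hc0 (hk _ K (by omega)) hxy _ _

theorem norm_prime_zpow_eq_one {q : Nat.Primes} (hqp : q ≠ p) (k : ℤ) :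
    ‖((((p : ℕ) : ℚ) ^ k : ℚ) : ℚ_[q])‖ = 1 := by
  have h : ‖((p : ℕ) : ℚ_[q])‖ = 1 := by
    rw [Padic.norm_natCast_eq_one_iff, Nat.coprime_primes q.2 p.2]
    exact fun h => hqp (Subtype.ext h)
  rw [Rat.cast_zpow, Rat.cast_natCast, norm_zpow, h, one_zpow]

theorem exists_nat_norm_sub_lt (p : ℕ) [Fact p.Prime] {y : ℚ_[p]} (hy : ‖y‖ ≤ 1) {ε : ℝ}
    (hε : 0 < ε) : ∃ n : ℕ, ‖y - n‖ < ε := by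
  have h : ∀ z : ℤ_[p], ∃ n : ℕ, ‖(z : ℚ_[p]) - n‖ < ε := by
    intro z
    obtain ⟨n, hn⟩ := PadicInt.denseRange_natCast.exists_dist_lt z hε
    refine ⟨n, ?_⟩
    rw [dist_eq_norm, PadicInt.norm_def] at hn
    simpa using hn
  exact h ⟨y, hy⟩

/-- The ring `ℤ[1/p]` is dense in `ℚ_p`. -/
theorem exists_rat_approx (x c : ℚ_[p]) (hc : c ≠ 0) :
    ∃ r : ℚ, (x - r) / c ∈ Zp p ∧ ∀ q : Nat.Primes, q ≠ p → (r : ℚ_[q]) ∈ Zp q := by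
  obtain ⟨k, hk⟩ := exists_denominator (p := p) ![x, 0, 0, 0]
  have hx : ‖((p : ℕ) : ℚ_[p]) ^ k * x‖ ≤ 1 := hk k le_rfl 0
  have hp0 : ((p : ℕ) : ℚ_[p]) ≠ 0 := by exact_mod_cast p.2.ne_zero
  have hp0' : ((p : ℕ) : ℚ) ≠ 0 := by exact_mod_cast p.2.ne_zero
  have hpk : 0 < ‖((p : ℕ) : ℚ_[p]) ^ k‖ := norm_pos_iff.mpr (pow_ne_zero _ hp0)
  have hc' : 0 < ‖c‖ := norm_pos_iff.mpr hc
  obtain ⟨n, hn'⟩ := exists_nat_norm_sub_lt p hx (mul_pos hpk hc')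
  -- The natural number n is close to the integral element p^k x; dividing by p^k again gives an
  -- approximation of x in ℤ[1/p].
  refine ⟨n * ((p : ℕ) : ℚ) ^ (-(k : ℤ)), ?_, fun q hq => ?_⟩
  · rw [mem_Zp, norm_div, div_le_one hc']
    have h2 : ((p : ℕ) : ℚ_[p]) ^ k * (x - ((n * ((p : ℕ) : ℚ) ^ (-(k : ℤ)) : ℚ) : ℚ_[p])) =
        ((p : ℕ) : ℚ_[p]) ^ k * x - n := by
      push_cast
      rw [zpow_neg, zpow_natCast]
      field_simp
    rw [← h2, norm_mul] at hn'
    exact (lt_of_mul_lt_mul_left hn' hpk.le).le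
  · rw [mem_Zp, Rat.cast_mul, norm_mul, norm_prime_zpow_eq_one hq, mul_one, Rat.cast_natCast]
    exact_mod_cast Padic.norm_int_le_one (p := q) (n : ℤ)

theorem exists_zpow_mul_unit {x : ℚ_[p]} (hx : x ≠ 0) :
    ∃ k : ℤ, ‖x / ((((p : ℕ) : ℚ) ^ k : ℚ) : ℚ_[p])‖ = 1 := by
  refine ⟨x.valuation, ?_⟩
  rw [norm_div, Rat.cast_zpow, Rat.cast_natCast, Padic.norm_p_zpow,
    Padic.norm_eq_zpow_neg_valuation hx, div_self]
  have : ((p : ℕ) : ℝ) ≠ 0 := by exact_mod_cast p.2.ne_zero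
  exact zpow_ne_zero _ this

/-- `g` agrees with a rational element up to `J_p`, which is integral away from `p`. -/
def IsApprox (g : GV ℚ_[p] m) : Prop :=
  ∃ γ : GV ℚ m, (castG ℚ_[p] γ)⁻¹ * g ∈ unitG (Zp p) m ∧
    ∀ q : Nat.Primes, q ≠ p → castG ℚ_[q] γ ∈ unitG (Zp q) m

/-- If γ approximates g and η approximates w, then (ηγ)⁻¹wg = γ⁻¹(η⁻¹w)γ · γ⁻¹g. The error η⁻¹w must
survive conjugation, so the hypothesis asks for an η adapted to each conjugator. -/
theorem IsApprox.left_mul {g : GV ℚ_[p] m} (hg : IsApprox g) {w : GV ℚ_[p] m}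
    (hw : ∀ γ : GV ℚ_[p] m, ∃ η : GV ℚ m, γ * ((castG ℚ_[p] η)⁻¹ * w) * γ⁻¹ ∈ unitG (Zp p) m ∧
      ∀ q : Nat.Primes, q ≠ p → castG ℚ_[q] η ∈ unitG (Zp q) m) : IsApprox (w * g) := by
  obtain ⟨γ, h1, h2⟩ := hg
  obtain ⟨η, h3, h4⟩ := hw (castG ℚ_[p] γ)⁻¹
  refine ⟨η * γ, ?_, fun q hq => by rw [map_mul]; exact mul_mem (h4 q hq) (h2 q hq)⟩
  convert mul_mem h3 h1 using 1
  rw [map_mul]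
  group

theorem isApprox_of_unip {w g : GV ℚ_[p] m} (hw : w ∈ unipGroup ℚ_[p] m) (hg : IsApprox g) :
    IsApprox (w * g) := by
  have hu : ∀ (x y : ℚ_[p]) (g : GV ℚ_[p] m), IsApprox g → IsApprox (uG m x y * g) := by
    intro x y g hg
    refine hg.left_mul fun γ => ?_
    obtain ⟨c, hc, h⟩ := exists_conj_small γ
    obtain ⟨r, hr, hr'⟩ := exists_rat_approx x c hc
    obtain ⟨s, hs, hs'⟩ := exists_rat_approx y c hc
    refine ⟨uG m r s, ?_, fun q hq => ?_⟩
    · rw [castG_uG, uG_inv, uG_mul]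
      rw [sub_eq_neg_add] at hr hs
      exact (h _ _ hr hs).1
    · rw [castG_uG]
      exact elemGroup_le_unitG (uG_mem_elemGroup (hr' q hq) (hs' q hq))
  have hl : ∀ (x y : ℚ_[p]) (g : GV ℚ_[p] m), IsApprox g → IsApprox (lG m x y * g) := by
    intro x y g hg
    refine hg.left_mul fun γ => ?_
    obtain ⟨c, hc, h⟩ := exists_conj_small γ
    obtain ⟨r, hr, hr'⟩ := exists_rat_approx x c hc
    obtain ⟨s, hs, hs'⟩ := exists_rat_approx y c hc
    refine ⟨lG m r s, ?_, fun q hq => ?_⟩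
    · rw [castG_lG, lG_inv, lG_mul]
      rw [sub_eq_neg_add] at hr hs
      exact (h _ _ hr hs).2
    · rw [castG_lG]
      exact elemGroup_le_unitG (lG_mem_elemGroup (hr' q hq) (hs' q hq))
  induction hw using Subgroup.closure_induction_left with
  | one => rwa [one_mul]
  | mul_left x hx y _ ih =>
    rw [mul_assoc]
    rcases hx with ⟨x, rfl⟩ | ⟨x, rfl⟩
    · exact hu _ _ _ ih
    · exact hl _ _ _ ih
  | inv_mul_cancel x hx y _ ih =>
    rw [mul_assoc]
    rcases hx with ⟨x, rfl⟩ | ⟨x, rfl⟩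
    · rw [uG_inv]; exact hu _ _ _ ih
    · rw [lG_inv]; exact hl _ _ _ ih

/-- Unipotent factors are treated by density of ℤ[1/p] in ℚ_p. The torus parameter and the scalar
are powers of p up to a unit of ℤ_p, and a power of p is a unit at every other prime. -/
theorem isApprox (hm : Squarefree m) (g : GV ℚ_[p] m) : IsApprox g := by
  obtain ⟨s, hs, w, hw, d, hd, rfl⟩ := exists_eq_scalar_mul_unip_mul_delta hm g
  have hp0 : ((p : ℕ) : ℚ) ≠ 0 := by exact_mod_cast p.2.ne_zero
  have hd' : IsApprox (deltaG m d hd) := by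
    obtain ⟨k, hk⟩ := exists_zpow_mul_unit hd
    set c : ℚ := ((p : ℕ) : ℚ) ^ k with hc
    have hc0 : c ≠ 0 := zpow_ne_zero _ hp0
    have hc' : ∀ q : Nat.Primes, (c : ℚ_[q]) ≠ 0 := fun q => Rat.cast_ne_zero.mpr hc0
    have hu : IsUnitIn (Zp p) ((c : ℚ_[p])⁻¹ * d) := by
      rw [isUnitIn_Zp, mul_comm, ← div_eq_mul_inv, hk]
    refine ⟨deltaG m c hc0, mem_unitG_iff.mpr ⟨?_, _, hu, ?_⟩, fun q hq => ?_⟩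
    · rw [castG_deltaG _ _ (hc' p), map_mul, map_inv, tau_deltaG_inv, ← map_mul,
        tau_deltaG_mul_deltaG]
      exact (deltaG_mem_discKernel hu).1
    · rw [castG_deltaG _ _ (hc' p)]
      exact ((hasNorm_deltaG m _ _).inv hm).mul (hasNorm_deltaG m d hd)
    · rw [castG_deltaG _ _ (hc' q)]
      exact elemGroup_le_unitG (deltaG_mem_elemGroup
        (isUnitIn_Zp.mpr (norm_prime_zpow_eq_one hq k)))
  refine (isApprox_of_unip hw hd').left_mul fun γ => ?_
  obtain ⟨k, hk⟩ := exists_zpow_mul_unit hs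
  set c : ℚ := ((p : ℕ) : ℚ) ^ k with hc
  have hc0 : c ≠ 0 := zpow_ne_zero _ hp0
  have hc' : ∀ q : Nat.Primes, (c : ℚ_[q]) ≠ 0 := fun q => Rat.cast_ne_zero.mpr hc0
  have hu : IsUnitIn (Zp p) (s / c) := isUnitIn_Zp.mpr hk
  refine ⟨scalarG _ c hc0, ?_, fun q hq => ?_⟩
  · have h1 : (scalarG (quad ℚ_[p] m) (c : ℚ_[p]) (hc' p))⁻¹ * scalarG _ s hs =
        scalarG _ (s / c) hu.1 := by
      rw [inv_mul_eq_iff_eq_mul]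
      refine Subtype.ext (Units.ext ?_)
      change algebraMap _ _ s = algebraMap _ _ _ * algebraMap _ _ _
      rw [← map_mul, mul_div_cancel₀ _ (hc' p)]
    rw [castG_scalarG _ _ (hc' p), h1, ← scalarG_mul_comm, mul_inv_cancel_right]
    exact scalarG_mem_unitG hu
  · rw [castG_scalarG _ _ (hc' q)]
    exact scalarG_mem_unitG (isUnitIn_Zp.mpr (norm_prime_zpow_eq_one hq k))

/-- The class number one property `G⁺(V₀)_𝔸 = G⁺(V₀) J`. -/
theorem exists_rational_approx (hm : Squarefree m) (S : Finset Nat.Primes)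
    (g : ∀ p : Nat.Primes, GV ℚ_[p] m) (hg : ∀ p ∉ S, g p ∈ unitG (Zp p) m) :
    ∃ α : GV ℚ m, ∀ p : Nat.Primes, (castG ℚ_[p] α)⁻¹ * g p ∈ unitG (Zp p) m := by
  induction S using Finset.induction_on generalizing g with
  | empty => exact ⟨1, fun p => by rw [map_one, inv_one, one_mul]; exact hg p (by simp)⟩
  -- An approximation γ at p is integral at all other primes, so γ⁻¹g lies in J_q for every q
  -- outside the smaller set.
  | insert p S _ ih =>
    obtain ⟨γ, h1, h2⟩ := isApprox hm (g p)
    obtain ⟨α, hα⟩ := ih (fun q => (castG ℚ_[q] γ)⁻¹ * g q) (fun q hq => by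
      by_cases hqp : q = p
      · subst hqp; exact h1
      · exact mul_mem (inv_mem (h2 q hqp)) (hg q (by simp [hqp, hq])))
    refine ⟨γ * α, fun q => ?_⟩
    rw [map_mul, mul_inv_rev, mul_assoc]
    exact hα q

end Approximation
end QuadSpace

/-! ### From local to global: Γ(L₀), Γ̂(L₀) and lifting to G⁺(V₀) -/

namespace QuadSpace
open CliffordAlgebra

section LocalGlobal
variable {m : ℕ}

theorem mem_ZZ_iff {r : ℚ} : r ∈ ZZ ↔ ∀ p : Nat.Primes, (r : ℚ_[p]) ∈ Zp p := by
  constructor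
  · rintro ⟨n, rfl⟩ p
    change ‖(((n : ℤ) : ℚ) : ℚ_[p])‖ ≤ 1
    rw [Rat.cast_intCast]
    exact Padic.norm_int_le_one n
  · intro h
    suffices hd : r.den = 1 from ⟨r.num, by
      change ((r.num : ℤ) : ℚ) = r
      conv_rhs => rw [← Rat.num_div_den r, hd]
      simp⟩
    by_contra hd
    obtain ⟨p, hp, hpd⟩ := Nat.exists_prime_and_dvd hd
    have h1 := h ⟨p, hp⟩
    haveI : Fact p.Prime := ⟨hp⟩
    change ‖(r : ℚ_[p])‖ ≤ 1 at h1
    have h2 : ‖(r.den : ℚ_[p])‖ < 1 := Padic.norm_natCast_lt_one_iff.mpr hpd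
    have h3 : ‖(r.num : ℚ_[p])‖ < 1 := by
      have e : (r.num : ℚ_[p]) = (r : ℚ_[p]) * r.den := by
        have := Rat.mul_den_eq_num r
        exact_mod_cast congrArg (Rat.cast : ℚ → ℚ_[p]) this.symm
      rw [e, norm_mul]
      calc _ ≤ 1 * ‖(r.den : ℚ_[p])‖ := by gcongr
        _ < 1 := by rwa [one_mul]
    rw [Padic.norm_intCast_lt_one_iff] at h3
    have h4 : p ∣ r.num.natAbs := Int.natCast_dvd.mp h3
    have := Nat.dvd_gcd h4 hpd
    rw [r.reduced.gcd_eq_one] at this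
    exact hp.one_lt.ne' (Nat.dvd_one.mp this)

theorem mem_lattice_ZZ_iff {x : Fin 4 → ℚ} :
    x ∈ lattice ZZ ↔ ∀ p : Nat.Primes, castV ℚ_[p] x ∈ lattice (Zp p) :=
  ⟨fun h p i => mem_ZZ_iff.mp (h i) p, fun h i => mem_ZZ_iff.mpr fun p => h p i⟩

theorem mem_Gam_of_local {h : SOV ℚ m}
    (H : ∀ p : Nat.Primes, ∃ g ∈ stabilizer (quad ℚ_[p] m) (lattice (Zp p)), IsCastV h g) :
    h ∈ Gam m := by
  intro x
  rw [mem_lattice_ZZ_iff, mem_lattice_ZZ_iff]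
  refine forall_congr' fun p => ?_
  obtain ⟨g, hg, hc⟩ := H p
  rw [← hc, hg]

theorem mem_GamHat_of_local (hm : Squarefree m) {h : Gam m}
    (H : ∀ p : Nat.Primes, ∃ g ∈ discKernel (Zp p) m, IsCastV h.1 g) : h ∈ GamHat m := by
  have hD := disc_ne_zero (F := ℚ) hm
  set D : ℚ := 4 * nS m - tS m ^ 2 with hDdef
  -- These are the columns of S₀⁻¹, a basis of the dual lattice. The equation h = 1 + A S₀ says that
  -- the columns of A are h d_j − d_j, so integrality of A is trivial action on the discriminant
  -- module.
  let d : Fin 4 → Fin 4 → ℚ := ![![0, 0, 0, 1], ![0, -2 * nS m / D, tS m / D, 0],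
    ![0, tS m / D, -2 / D, 0], ![1, 0, 0, 0]]
  have hdual : ∀ (p : Nat.Primes) j, IsDual (Zp p) m (castV ℚ_[p] (d j)) := by
    intro p j
    have hD' : (D : ℚ_[p]) ≠ 0 := Rat.cast_ne_zero.mpr hD
    have hDc : (D : ℚ_[p]) = 4 * nS m - tS m ^ 2 := by rw [hDdef]; push_cast; rfl
    have h1 := (Zp p).one_mem
    have h0 := (Zp p).zero_mem
    have hn := (Zp p).neg_mem h1
    fin_cases j
    · refine ⟨?_, ?_, ?_, ?_⟩ <;> simp [d, castV_vec4]
    · refine ⟨?_, ?_, ?_, ?_⟩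
      · simp [d, castV_vec4]
      · simp [d, castV_vec4]
      · convert hn using 1
        simp [d, castV_vec4]; field_simp; rw [hDc]; ring
      · convert h0 using 1
        simp [d, castV_vec4]; field_simp; ring
    · refine ⟨?_, ?_, ?_, ?_⟩
      · simp [d, castV_vec4]
      · simp [d, castV_vec4]
      · convert h0 using 1
        simp [d, castV_vec4]; field_simp; ring
      · convert hn using 1
        simp [d, castV_vec4]; field_simp; rw [hDc]; ring
    · refine ⟨?_, ?_, ?_, ?_⟩ <;> simp [d, castV_vec4]
  have hint : ∀ i j, ∃ n : ℤ, (n : ℚ) = h.1.1 (d j) i - d j i := by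
    intro i j
    refine (mem_lattice_ZZ_iff (x := h.1.1 (d j) - d j)).mpr (fun p => ?_) i
    obtain ⟨g, hg, hc⟩ := H p
    rw [map_sub, ← hc]
    exact hg.2 _ (hdual p j)
  choose A hA using hint
  refine ⟨Matrix.of A, ?_⟩
  ext i k
  have hsum : (Pi.single k 1 : Fin 4 → ℚ) = ∑ j, (matS0 m j k : ℚ) • d j := by
    simp only [Fin.sum_univ_four, d]
    fin_cases k <;> apply vec4_ext <;> simp [matS0, matS_eq] <;> field_simp <;> ring
  rw [LinearMap.toMatrix'_apply, Matrix.add_apply, Matrix.map_apply, Matrix.mul_apply]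
  have h1 : (1 : Matrix (Fin 4) (Fin 4) ℚ) i k = ∑ j, (matS0 m j k : ℚ) * d j i := by
    have := congrFun hsum i
    rw [Finset.sum_apply] at this
    simp only [Pi.smul_apply, smul_eq_mul] at this
    rw [← this, Matrix.one_apply, Pi.single_apply]
  rw [hsum, h1, map_sum, Finset.sum_apply, Int.cast_sum, ← Finset.sum_add_distrib]
  refine Finset.sum_congr rfl fun j _ => ?_
  rw [LinearEquiv.coe_coe, map_smul, Pi.smul_apply, smul_eq_mul, Int.cast_mul, Matrix.of_apply, hA]
  ring

/-- For h = 1 + A S₀ one has gv − v = A(S₀v), and S₀v is integral for v in the dual lattice. -/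
theorem mem_discKernel_of_mem_GamHat {h : Gam m} (hh : h ∈ GamHat m) {p : Nat.Primes}
    {g : SOV ℚ_[p] m} (hg : IsCastV h.1 g) : g ∈ discKernel (Zp p) m := by
  have key : ∀ h : Gam m, h ∈ GamHat m → ∀ g : SOV ℚ_[p] m, IsCastV h.1 g →
      ∀ v, IsDual (Zp p) m v → g.1 v - v ∈ lattice (Zp p) := by
    rintro h ⟨A, hA⟩ g hg v hv
    set T : Matrix (Fin 4) (Fin 4) ℚ_[p] := (A * matS0 m).map (Int.cast : ℤ → ℚ_[p]) with hT
    have h1 : (g.1 : (Fin 4 → ℚ_[p]) →ₗ[ℚ_[p]] (Fin 4 → ℚ_[p])) =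
        LinearMap.id + T.mulVecLin := by
      refine eq_of_eq_castV _ fun x => ?_
      change g.1 (castV _ x) = castV _ x + T.mulVec (castV _ x)
      have h2 : h.1.1 x = x + ((A * matS0 m).map (Int.cast : ℤ → ℚ)).mulVec x := by
        have := LinearMap.toMatrix'_mulVec
          (h.1.1 : (Fin 4 → ℚ) →ₗ[ℚ] (Fin 4 → ℚ)) x
        rw [hA, Matrix.add_mulVec, Matrix.one_mulVec] at this
        exact this.symm
      rw [hg, h2, map_add]
      congr 1
    have h3 : g.1 v - v = (A.map (Int.cast : ℤ → ℚ_[p])).mulVec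
        (((matS0 m).map (Int.cast : ℤ → ℚ_[p])).mulVec v) := by
      have h4 : g.1 v = v + T.mulVec v := LinearMap.congr_fun h1 v
      rw [h4, add_sub_cancel_left, Matrix.mulVec_mulVec, hT]
      exact congrArg (Matrix.mulVec · v) (map_mul (Int.castRingHom ℚ_[p]).mapMatrix A (matS0 m))
    have h5 : ((matS0 m).map (Int.cast : ℤ → ℚ_[p])).mulVec v =
        ![v 3, -(2 * v 1 + tS m * v 2), -(tS m * v 1 + 2 * nS m * v 2), v 0] := by
      apply vec4_ext <;> simp [Matrix.mulVec, dotProduct, Fin.sum_univ_four, matS0, matS_eq] <;>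
        ring
    rw [h3, h5]
    intro i
    have h6 : ∀ w ∈ lattice (Zp p), (A.map (Int.cast : ℤ → ℚ_[p])).mulVec w i ∈ Zp p := by
      intro w hw
      change ∑ j, (A i j : ℚ_[p]) * w j ∈ Zp p
      exact (Zp p).sum_mem fun j _ => (Zp p).mul_mem (intCast_mem _ _) (hw j)
    exact h6 _ (vec4_mem_lattice hv.2.1 ((Zp p).neg_mem hv.2.2.1) ((Zp p).neg_mem hv.2.2.2) hv.1)
  refine ⟨mem_stabilizer_of (fun v hv => mem_lattice_of_sub hv (key h hh g hg v (isDual_of_mem hv)))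
    (fun v hv => mem_lattice_of_sub hv (key h⁻¹ (inv_mem hh) g⁻¹ hg.inv v (isDual_of_mem hv))),
    key h hh g hg⟩

/-- All valuations of n are even, so no prime divides the square-free part of numerator times
denominator. The sign is invisible at finite primes, whence the absolute value. -/
theorem exists_rat_of_local_squares {n : ℚ} (hn : n ≠ 0)
    (h : ∀ p : Nat.Primes, ∃ s : ℚ_[p], s ≠ 0 ∧ ‖(n : ℚ_[p])‖ = ‖s‖ ^ 2) :
    ∃ t : ℚ, t ≠ 0 ∧ |n| = t ^ 2 := by
  have hpos : 0 < n.num.natAbs * n.den :=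
    Nat.mul_pos (Int.natAbs_pos.mpr (Rat.num_ne_zero.mpr hn)) n.den_pos
  obtain ⟨a, b, ha, hb, hab, hsq⟩ := Nat.sq_mul_squarefree_of_pos hpos
  have hden : (n.den : ℚ) ≠ 0 := by exact_mod_cast n.den_nz
  have habs : |n| * n.den ^ 2 = (b : ℚ) ^ 2 * a := by
    have h1 : ((n.num.natAbs * n.den : ℕ) : ℚ) = |n| * n.den ^ 2 := by
      have h2 : |n| = (n.num.natAbs : ℚ) / n.den := by
        conv_lhs => rw [← Rat.num_div_den n, abs_div]
        rw [Nat.cast_natAbs, Int.cast_abs, Nat.abs_cast]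
      rw [h2]; push_cast; field_simp
    rw [← h1, ← hab]; push_cast; rfl
  have ha1 : a = 1 := by
    by_contra ha1
    obtain ⟨p, hpa⟩ : ∃ p : Nat.Primes, (p : ℕ) ∣ a := by
      obtain ⟨p, hp, hpa⟩ := Nat.exists_prime_and_dvd ha1
      exact ⟨⟨p, hp⟩, hpa⟩
    obtain ⟨s, hs, hns⟩ := h p
    have hb0 : (b : ℚ_[p]) ≠ 0 := by exact_mod_cast hb.ne'
    set s' : ℚ_[p] := s * n.den / b with hs'
    have hden' : (n.den : ℚ_[p]) ≠ 0 := by exact_mod_cast n.den_nz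
    have hs0 : s' ≠ 0 := div_ne_zero (mul_ne_zero hs hden') hb0
    have hna : ‖(a : ℚ_[p])‖ = ‖s'‖ ^ 2 := by
      have h3 : ‖((|n| : ℚ) : ℚ_[p])‖ =
          ‖(n : ℚ_[p])‖ := by
        rcases abs_choice n with h | h <;> rw [h]
        rw [Rat.cast_neg, norm_neg]
      have h4 := congrArg (fun r : ℚ => ‖(r : ℚ_[p])‖) habs
      simp only [Rat.cast_mul, Rat.cast_pow, Rat.cast_natCast, norm_mul, norm_pow, h3, hns] at h4
      have hb1 : ‖(b : ℚ_[p])‖ ≠ 0 := norm_ne_zero_iff.mpr hb0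
      rw [hs', norm_div, norm_mul]
      field_simp
      linarith
    have h5 : s'⁻¹ ∈ Zp p := by
      refine mem_Zp_of_squarefree_mul_sq hsq ?_
      have : ‖s'‖ ≠ 0 := norm_ne_zero_iff.mpr hs0
      rw [mem_Zp, norm_mul, hna, norm_pow, norm_inv, ← mul_pow, mul_inv_cancel₀ this, one_pow]
    rw [mem_Zp, norm_inv, inv_le_one₀ (norm_pos_iff.mpr hs0)] at h5
    have h6 : ‖(a : ℚ_[p])‖ < 1 := Padic.norm_natCast_lt_one_iff.mpr hpa
    rw [hna] at h6
    exact absurd (one_le_pow₀ h5 (n := 2)) (not_le.mpr h6)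
  have hb0 : (b : ℚ) ≠ 0 := by exact_mod_cast hb.ne'
  refine ⟨b / n.den, div_ne_zero hb0 hden, ?_⟩
  rw [ha1, Nat.cast_one, mul_one] at habs
  rw [div_pow, eq_div_iff (pow_ne_zero 2 hden), habs]

/-- Every element of `Γ̂(L₀)` lifts to an element of `G⁺(V₀)` that is in `J_p` for every `p`. -/
theorem exists_lift_of_mem_GamHat (hm : Squarefree m) {h : Gam m} (hh : h ∈ GamHat m) :
    ∃ β : GV ℚ m, tau β = h.1 ∧ ∀ p : Nat.Primes, castG ℚ_[p] β ∈ unitG (Zp p) m := by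
  obtain ⟨β, hβ⟩ := tau_surjective hm h.1
  -- Locally the lift is a scalar s times an element of J_p, so its norm n satisfies |n|_p = |s|_p².
  have hloc : ∀ p : Nat.Primes, ∃ (s : ℚ_[p]) (hs : s ≠ 0), ∃ j ∈ unitG (Zp p) m,
      castG ℚ_[p] β = scalarG _ s hs * j := fun p =>
    exists_unitG_of_mem_discKernel hm isLocalIn_Zp
      (mem_discKernel_of_mem_GamHat hh (hβ ▸ isCastV_tau_castG β))
  obtain ⟨n, hn, hβn⟩ := exists_hasNorm hm β
  have hnorm : ∀ (p : Nat.Primes) (s : ℚ_[p]) (hs : s ≠ 0), ∀ j ∈ unitG (Zp p) m,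
      castG ℚ_[p] β = scalarG _ s hs * j → ‖(n : ℚ_[p])‖ = ‖s‖ ^ 2 := by
    intro p s hs j hj h
    obtain ⟨_, c, hc, hcj⟩ := mem_unitG_iff.mp hj
    have h1 := hasNorm_castG (F := ℚ_[p]) hβn
    rw [h] at h1
    rw [h1.unique ((hasNorm_scalarG s hs).mul hcj), norm_mul, norm_mul, isUnitIn_Zp.mp hc, mul_one,
      pow_two]
  obtain ⟨t, ht, hnt⟩ := exists_rat_of_local_squares hn (fun p => by
    obtain ⟨s, hs, j, hj, h⟩ := hloc p
    exact ⟨s, hs, hnorm p s hs j hj h⟩)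
  -- As |t|_p = |s|_p for every p, the single scalar t⁻¹ turns all the local scalars into units at
  -- once.
  refine ⟨scalarG _ t⁻¹ (inv_ne_zero ht) * β, ?_, fun p => ?_⟩
  · rw [map_mul, tau_scalarG, one_mul, hβ]
  · obtain ⟨s, hs, j, hj, h⟩ := hloc p
    have ht' : ((t⁻¹ : ℚ) : ℚ_[p]) ≠ 0 := Rat.cast_ne_zero.mpr (inv_ne_zero ht)
    have h3 : ‖((|n| : ℚ) : ℚ_[p])‖ = ‖(n : ℚ_[p])‖ := by
      rcases abs_choice n with h | h <;> rw [h]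
      rw [Rat.cast_neg, norm_neg]
    have h4 : ‖(t : ℚ_[p])‖ = ‖s‖ := by
      rw [hnorm p s hs j hj h, hnt, Rat.cast_pow, norm_pow] at h3
      exact (pow_left_inj₀ (norm_nonneg _) (norm_nonneg _) two_ne_zero).mp h3
    have hu : IsUnitIn (Zp p) (((t⁻¹ : ℚ) : ℚ_[p]) * s) := by
      rw [isUnitIn_Zp, norm_mul, Rat.cast_inv, norm_inv, h4,
        inv_mul_cancel₀ (norm_ne_zero_iff.mpr hs)]
    have h5 : castG ℚ_[p] (scalarG _ t⁻¹ (inv_ne_zero ht) * β) = scalarG _ _ hu.1 * j := by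
      rw [map_mul, castG_scalarG _ _ ht', h, ← mul_assoc]
      congr 1
      exact Subtype.ext (Units.ext (map_mul (algebraMap _ _) _ _).symm)
    rw [h5]
    exact mul_mem (scalarG_mem_unitG hu) hj

end LocalGlobal
end QuadSpace

/-! ### The decomposition V₀ = W ⊕ Fξ and the stabiliser of ξ -/

namespace QuadSpace
open CliffordAlgebra

section Complement
variable {F : Type*} [Field F] [CharZero F] {m ℓ : ℕ}

theorem phi_xi_left (v : Fin 4 → F) : phi F m (xi F ℓ) v = phi F m v (xi F ℓ) := phi_symm F m _ _

theorem phi_xi_xi : phi F m (xi F ℓ) (xi F ℓ) = ℓ := by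
  change quad F m (xi F ℓ) = ℓ
  rw [quad_eq]
  simp [xi, qS]

theorem phi_coe_xi (w : W F m ℓ) : phi F m w (xi F ℓ) = 0 := w.2

/-- The decomposition `V₀ = W ⊕ F ξ`. -/
noncomputable def splitW (F : Type*) [Field F] [CharZero F] (m : ℕ) {ℓ : ℕ} (hℓ : (ℓ : F) ≠ 0) :
    (W F m ℓ × F) ≃ₗ[F] (Fin 4 → F) where
  toFun x := x.1 + x.2 • xi F ℓ
  map_add' x y := by
    rw [Prod.fst_add, Prod.snd_add, Submodule.coe_add, add_smul]; abel
  map_smul' c x := by simp [mul_smul]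
  invFun v := (⟨v - (phi F m v (xi F ℓ) / ℓ) • xi F ℓ, by
    change phi F m _ _ = 0
    rw [map_sub, map_smul, LinearMap.sub_apply, LinearMap.smul_apply, phi_xi_xi, smul_eq_mul,
      div_mul_cancel₀ _ hℓ, sub_self]⟩, phi F m v (xi F ℓ) / ℓ)
  left_inv x := by
    have h : phi F m (x.1 + x.2 • xi F ℓ) (xi F ℓ) / ℓ = x.2 := by
      rw [map_add, map_smul, LinearMap.add_apply, LinearMap.smul_apply, phi_coe_xi, phi_xi_xi,
        zero_add, smul_eq_mul, mul_div_cancel_right₀ _ hℓ]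
    refine Prod.ext (Subtype.ext ?_) h
    change x.1 + x.2 • xi F ℓ - (phi F m (x.1 + x.2 • xi F ℓ) (xi F ℓ) / ℓ) • xi F ℓ = _
    rw [h, add_sub_cancel_right]
  right_inv v := sub_add_cancel _ _

theorem splitW_apply (hℓ : (ℓ : F) ≠ 0) (w : W F m ℓ) (c : F) :
    splitW F m hℓ (w, c) = w + c • xi F ℓ := rfl

theorem exists_eq_add_smul_xi (m : ℕ) (hℓ : (ℓ : F) ≠ 0) (v : Fin 4 → F) :
    ∃ (w : W F m ℓ) (c : F), v = w + c • xi F ℓ :=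
  ⟨_, _, ((splitW F m hℓ).apply_symm_apply v).symm⟩

theorem quad_add_smul_xi (w : W F m ℓ) (c : F) :
    quad F m (w + c • xi F ℓ) = quadW F m ℓ w + c * c * ℓ := by
  change phi F m _ _ = phi F m w w + _
  simp only [map_add, map_smul, LinearMap.add_apply, LinearMap.smul_apply, phi_xi_left, phi_coe_xi,
    phi_xi_xi, smul_eq_mul]
  ring

/-- The extension by `ξ ↦ ξ` of an automorphism of `W`. -/
noncomputable def extendEquiv (hℓ : (ℓ : F) ≠ 0) (h : W F m ℓ ≃ₗ[F] W F m ℓ) :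
    (Fin 4 → F) ≃ₗ[F] (Fin 4 → F) :=
  (splitW F m hℓ).symm ≪≫ₗ (h.prodCongr (LinearEquiv.refl F F)) ≪≫ₗ splitW F m hℓ

theorem extendEquiv_apply (hℓ : (ℓ : F) ≠ 0) (h : W F m ℓ ≃ₗ[F] W F m ℓ) (w : W F m ℓ) (c : F) :
    extendEquiv hℓ h (w + c • xi F ℓ) = h w + c • xi F ℓ := by
  rw [← splitW_apply hℓ, extendEquiv, LinearEquiv.trans_apply, LinearEquiv.trans_apply,
    LinearEquiv.symm_apply_apply]
  rfl

theorem det_extendEquiv (hℓ : (ℓ : F) ≠ 0) (h : W F m ℓ ≃ₗ[F] W F m ℓ) :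
    LinearEquiv.det (extendEquiv hℓ h) = LinearEquiv.det h := by
  rw [extendEquiv, LinearEquiv.det_conj]
  refine Units.ext ?_
  rw [LinearEquiv.coe_det, LinearEquiv.coe_det]
  refine (LinearMap.det_prodMap (h : W F m ℓ →ₗ[F] W F m ℓ) LinearMap.id).trans ?_
  rw [LinearMap.det_id, mul_one]

theorem Extends.apply {h : SOW F m ℓ} {g : SOV F m} (H : Extends h g) (w : W F m ℓ) (c : F) :
    g.1 (w + c • xi F ℓ) = h.1 w + c • xi F ℓ := by
  rw [map_add, map_smul, H.1, H.2]

theorem exists_extends (hℓ : (ℓ : F) ≠ 0) (h : SOW F m ℓ) : ∃ g : SOV F m, Extends h g := by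
  refine ⟨⟨extendEquiv hℓ h.1, fun v => ?_, by rw [det_extendEquiv]; exact h.2.2⟩, ?_, fun w => ?_⟩
  · obtain ⟨w, c, rfl⟩ := exists_eq_add_smul_xi m hℓ v
    rw [extendEquiv_apply, quad_add_smul_xi, quad_add_smul_xi, h.2.1]
  · simpa using extendEquiv_apply hℓ h.1 0 1
  · simpa using extendEquiv_apply hℓ h.1 w 0

theorem Extends.unique (hℓ : (ℓ : F) ≠ 0) {h : SOW F m ℓ} {g g' : SOV F m} (H : Extends h g)
    (H' : Extends h g') : g = g' :=
  SOV_ext _ fun v => by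
    obtain ⟨w, c, rfl⟩ := exists_eq_add_smul_xi m hℓ v
    rw [H.apply, H'.apply]

theorem Extends.mul {h h' : SOW F m ℓ} {g g' : SOV F m} (H : Extends h g) (H' : Extends h' g') :
    Extends (h * h') (g * g') :=
  ⟨by rw [SOV_mul_apply, H'.1, H.1], fun w => by rw [SOV_mul_apply, H'.2, H.2]; rfl⟩

theorem Extends.inv {h : SOW F m ℓ} {g : SOV F m} (H : Extends h g) : Extends h⁻¹ g⁻¹ :=
  ⟨by rw [SOV_inv_apply_eq, H.1], fun w => by
    rw [SOV_inv_apply_eq, H.2]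
    exact congrArg _ (LinearEquiv.apply_symm_apply h.1 w).symm⟩

theorem phi_apply_apply (g : SOV F m) (x y : Fin 4 → F) :
    phi F m (g.1 x) (g.1 y) = phi F m x y := by
  have h := polar_tau g x y
  rw [polar_eq_two_phi, polar_eq_two_phi] at h
  exact mul_left_cancel₀ two_ne_zero h

theorem exists_extends_of_apply_xi (hℓ : (ℓ : F) ≠ 0) {g : SOV F m}
    (hg : g.1 (xi F ℓ) = xi F ℓ) : ∃ h : SOW F m ℓ, Extends h g := by
  have hg' : g⁻¹.1 (xi F ℓ) = xi F ℓ := by rw [SOV_inv_apply_eq, hg]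
  have key : ∀ g : SOV F m, g.1 (xi F ℓ) = xi F ℓ → ∀ w ∈ W F m ℓ, g.1 w ∈ W F m ℓ := by
    intro g hg w hw
    change phi F m _ _ = 0
    rw [← hg, phi_apply_apply]
    exact hw
  let h : W F m ℓ ≃ₗ[F] W F m ℓ := LinearEquiv.ofLinearMap
    ((g.1 : (Fin 4 → F) →ₗ[F] (Fin 4 → F)).restrict (key g hg))
    ((g⁻¹.1 : (Fin 4 → F) →ₗ[F] (Fin 4 → F)).restrict (key g⁻¹ hg'))
    (LinearMap.ext fun w => Subtype.ext (SOV_apply_inv_apply m g w))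
    (LinearMap.ext fun w => Subtype.ext (SOV_inv_apply_apply m g w))
  have hext : extendEquiv hℓ h = g.1 := by
    ext1 v
    obtain ⟨w, c, rfl⟩ := exists_eq_add_smul_xi m hℓ v
    rw [extendEquiv_apply, map_add, map_smul, hg]
    rfl
  exact ⟨⟨h, fun w => g.2.1 w, by rw [← det_extendEquiv hℓ, hext]; exact g.2.2⟩, hg, fun _ => rfl⟩

end Complement
end QuadSpace

/-! ### The Clifford algebra of W inside that of V₀ -/

namespace QuadSpace
open CliffordAlgebra

section ComplementClifford
variable {F : Type*} [Field F] [CharZero F] {m ℓ : ℕ}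

theorem clifIncl_ι (w : W F m ℓ) :
    clifIncl F m ℓ (ι (quadW F m ℓ) w) = ι (quad F m) (w : Fin 4 → F) :=
  CliffordAlgebra.map_apply_ι (inclW F m ℓ) w

theorem involute_clifIncl (x : CliffordAlgebra (quadW F m ℓ)) :
    involute (clifIncl F m ℓ x) = clifIncl F m ℓ (involute x) := by
  induction x using CliffordAlgebra.induction with
  | algebraMap r => simp only [AlgHom.commutes]
  | ι v => rw [clifIncl_ι, involute_ι, involute_ι, map_neg, clifIncl_ι]
  | mul a b ha hb => simp only [map_mul, ha, hb]
  | add a b ha hb => simp only [map_add, ha, hb]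

theorem clifIncl_conj_coe (ε : GW F m ℓ) (w : W F m ℓ) :
    clifIncl F m ℓ (ε.1 : CliffordAlgebra (quadW F m ℓ)) * ι (quad F m) (w : Fin 4 → F) *
      clifIncl F m ℓ ((ε.1⁻¹ : (CliffordAlgebra (quadW F m ℓ))ˣ) :
        CliffordAlgebra (quadW F m ℓ)) = ι (quad F m) ((tau ε).1 w : W F m ℓ) := by
  rw [← clifIncl_ι, ← clifIncl_ι, ι_tau, map_mul, map_mul]

theorem clifIncl_conj_xi (ε : GW F m ℓ) :
    clifIncl F m ℓ (ε.1 : CliffordAlgebra (quadW F m ℓ)) * ι (quad F m) (xi F ℓ) *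
      clifIncl F m ℓ ((ε.1⁻¹ : (CliffordAlgebra (quadW F m ℓ))ˣ) :
        CliffordAlgebra (quadW F m ℓ)) = ι (quad F m) (xi F ℓ) := by
  have h := ι_xi_mul m ℓ (ε.1 : CliffordAlgebra (quadW F m ℓ))
  rw [ε.2.1] at h
  rw [← h, mul_assoc, ← map_mul, Units.mul_inv, map_one, mul_one]

theorem clifIncl_conj_mem (hℓ : (ℓ : F) ≠ 0) (ε : GW F m ℓ) (v : Fin 4 → F) :
    clifIncl F m ℓ (ε.1 : CliffordAlgebra (quadW F m ℓ)) * ι (quad F m) v *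
      clifIncl F m ℓ ((ε.1⁻¹ : (CliffordAlgebra (quadW F m ℓ))ˣ) :
        CliffordAlgebra (quadW F m ℓ)) ∈ LinearMap.range (ι (quad F m)) := by
  obtain ⟨w, c, rfl⟩ := exists_eq_add_smul_xi m hℓ v
  rw [map_add, map_smul, mul_add, add_mul, mul_smul_comm, smul_mul_assoc, clifIncl_conj_coe,
    clifIncl_conj_xi, ← map_smul, ← map_add]
  exact ⟨_, rfl⟩

/-- The inclusion `G⁺(W) → G⁺(V₀)`. -/
noncomputable def inclG (F : Type*) [Field F] [CharZero F] (m : ℕ) {ℓ : ℕ} (hℓ : (ℓ : F) ≠ 0) :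
    GW F m ℓ →* GV F m where
  toFun ε := evenCliffordGroup.mk' (clifIncl F m ℓ (ε.1 : CliffordAlgebra (quadW F m ℓ)))
    (clifIncl F m ℓ ((ε.1⁻¹ : (CliffordAlgebra (quadW F m ℓ))ˣ) :
      CliffordAlgebra (quadW F m ℓ)))
    (by rw [← map_mul, Units.mul_inv, map_one]) (by rw [← map_mul, Units.inv_mul, map_one])
    (by rw [involute_clifIncl]; exact congrArg _ ε.2.1) (clifIncl_conj_mem hℓ ε)
    (by simpa using clifIncl_conj_mem hℓ ε⁻¹)
  map_one' := Subtype.ext (Units.ext (map_one _))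
  map_mul' a b := Subtype.ext (Units.ext (map_mul (clifIncl F m ℓ)
    (a.1 : CliffordAlgebra (quadW F m ℓ)) (b.1 : CliffordAlgebra (quadW F m ℓ))))

variable (hℓ : (ℓ : F) ≠ 0)

theorem coe_inclG (ε : GW F m ℓ) : (inclG F m hℓ ε).1 =
    Units.map (clifIncl F m ℓ : CliffordAlgebra (quadW F m ℓ) →* CliffordAlgebra (quad F m)) ε.1 :=
  Units.ext rfl

theorem extends_tau_inclG (ε : GW F m ℓ) : Extends (tau ε) (tau (inclG F m hℓ ε)) :=
  ⟨tau_apply_of_eq (clifIncl_conj_xi ε), fun w => tau_apply_of_eq (clifIncl_conj_coe ε w)⟩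

theorem mem_levelG_iff {O : Subring F} {ε : GW F m ℓ} :
    ε ∈ levelG m ℓ O ↔ inclG F m hℓ ε ∈ unitG O m := by
  constructor
  · rintro ⟨e, he, h⟩
    have : e = inclG F m hℓ ε := Subtype.ext (h.trans (coe_inclG hℓ ε).symm)
    exact this ▸ he
  · exact fun h => ⟨_, h, coe_inclG hℓ ε⟩

/-- The action of `w + c ξ` on `A(W) ⊕ ξ A(W)`. -/
noncomputable def cliffordAction (x : W F m ℓ × F) :
    Module.End F (CliffordAlgebra (quadW F m ℓ) × CliffordAlgebra (quadW F m ℓ)) :=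
  LinearMap.prod
    (LinearMap.coprod (LinearMap.mulLeft F (ι (quadW F m ℓ) x.1)) ((x.2 * ℓ) • LinearMap.id))
    (LinearMap.coprod (x.2 • LinearMap.id) (-LinearMap.mulLeft F (ι (quadW F m ℓ) x.1)))

theorem cliffordAction_apply (w : W F m ℓ) (c : F) (a b : CliffordAlgebra (quadW F m ℓ)) :
    cliffordAction (w, c) (a, b) =
      (ι (quadW F m ℓ) w * a + (c * ℓ) • b, c • a - ι (quadW F m ℓ) w * b) := by
  rw [sub_eq_add_neg]; rfl

/-- The action of `w + c ξ` on `A(W) ⊕ ξ A(W)` depends linearly on `(w, c)`. -/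
noncomputable def cliffordActionLinear : (W F m ℓ × F) →ₗ[F]
    Module.End F (CliffordAlgebra (quadW F m ℓ) × CliffordAlgebra (quadW F m ℓ)) where
  toFun := cliffordAction
  map_add' x y := LinearMap.ext fun ⟨a, b⟩ => by
    obtain ⟨w, c⟩ := x
    obtain ⟨w', c'⟩ := y
    rw [LinearMap.add_apply, Prod.mk_add_mk, cliffordAction_apply, cliffordAction_apply,
      cliffordAction_apply, map_add, add_mul, add_mul, add_mul, add_smul, add_smul,
      Prod.mk_add_mk]
    refine Prod.ext ?_ ?_ <;> dsimp only <;> abel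
  map_smul' r x := LinearMap.ext fun ⟨a, b⟩ => by
    obtain ⟨w, c⟩ := x
    rw [RingHom.id_apply, LinearMap.smul_apply, Prod.smul_mk, cliffordAction_apply,
      cliffordAction_apply, map_smul, smul_mul_assoc, smul_mul_assoc, smul_eq_mul, Prod.smul_mk,
      smul_add, smul_sub, smul_smul, smul_smul]
    simp only [smul_eq_mul, smul_mul_assoc]

/-- The pair (a, b) stands for a + ξb; the formulas for the action encode wξ = −ξw and ξ² = ℓ. That
the square is the quadratic form is what the universal property needs in order to give a
representation of A(V₀). -/
theorem cliffordAction_sq (w : W F m ℓ) (c : F) (a b : CliffordAlgebra (quadW F m ℓ)) :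
    cliffordAction (w, c) (cliffordAction (w, c) (a, b)) =
      ((quadW F m ℓ w + c * c * ℓ) • a, (quadW F m ℓ w + c * c * ℓ) • b) := by
  rw [cliffordAction_apply, cliffordAction_apply]
  simp only [mul_add, mul_sub, ← mul_assoc, ι_sq_scalar, ← Algebra.smul_def, mul_smul_comm,
    smul_add, smul_sub, smul_smul, add_smul]
  refine Prod.ext ?_ ?_ <;> dsimp only
  · rw [mul_right_comm c _ c]; abel
  · abel

/-- A representation of `A(V₀)` on `A(W) ⊕ ξ A(W)`. -/
noncomputable def cliffordRep : CliffordAlgebra (quad F m) →ₐ[F]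
    Module.End F (CliffordAlgebra (quadW F m ℓ) × CliffordAlgebra (quadW F m ℓ)) :=
  CliffordAlgebra.lift (quad F m)
    ⟨cliffordActionLinear ∘ₗ ((splitW F m hℓ).symm : (Fin 4 → F) →ₗ[F] (W F m ℓ × F)), fun v => by
      obtain ⟨⟨w, c⟩, rfl⟩ := (splitW F m hℓ).surjective v
      refine LinearMap.ext fun ⟨a, b⟩ => ?_
      rw [splitW_apply, quad_add_smul_xi, ← splitW_apply hℓ, LinearMap.comp_apply,
        LinearEquiv.coe_coe, LinearEquiv.symm_apply_apply]
      exact cliffordAction_sq w c a b⟩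

theorem cliffordRep_clifIncl (x a b : CliffordAlgebra (quadW F m ℓ)) :
    cliffordRep hℓ (clifIncl F m ℓ x) (a, b) = (x * a, involute x * b) := by
  induction x using CliffordAlgebra.induction generalizing a b with
  | algebraMap r =>
    rw [AlgHom.commutes, AlgHom.commutes, AlgHom.commutes, Module.algebraMap_end_apply,
      Prod.smul_mk, Algebra.smul_def, Algebra.smul_def]
  | ι w =>
    have h : (w : Fin 4 → F) = splitW F m hℓ (w, 0) := by rw [splitW_apply, zero_smul, add_zero]
    have h' : cliffordRep hℓ (ι (quad F m) (splitW F m hℓ (w, 0))) = cliffordAction (w, 0) := by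
      rw [cliffordRep, CliffordAlgebra.lift_ι_apply, LinearMap.comp_apply,
        LinearEquiv.coe_coe, LinearEquiv.symm_apply_apply]
      rfl
    rw [clifIncl_ι, h, h', cliffordAction_apply, involute_ι, zero_mul, zero_smul, add_zero, zero_smul,
      zero_sub, neg_mul]
  | mul x y hx hy => rw [map_mul, map_mul, Module.End.mul_apply, hy, hx, map_mul, mul_assoc, mul_assoc]
  | add x y hx hy =>
    rw [map_add, map_add, LinearMap.add_apply, hx, hy, map_add, Prod.mk_add_mk, add_mul, add_mul]

/-- The representation recovers x from its action on (1, 0). -/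
theorem clifIncl_injective (hℓ : (ℓ : F) ≠ 0) : Function.Injective (clifIncl F m ℓ) := by
  intro x y h
  have h1 := congrArg (fun z => (cliffordRep hℓ z (1, 0)).1) h
  simpa only [cliffordRep_clifIncl, mul_one] using h1

theorem exists_eq_clifIncl_add (hℓ : (ℓ : F) ≠ 0) (x : CliffordAlgebra (quad F m)) :
    ∃ a b, x = clifIncl F m ℓ a + ι (quad F m) (xi F ℓ) * clifIncl F m ℓ b := by
  induction x using CliffordAlgebra.left_induction with
  | algebraMap r => exact ⟨algebraMap F _ r, 0, by simp⟩
  | add x y hx hy =>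
    obtain ⟨a, b, rfl⟩ := hx
    obtain ⟨a', b', rfl⟩ := hy
    exact ⟨a + a', b + b', by rw [map_add, map_add, mul_add]; abel⟩
  | ι_mul x v hx =>
    obtain ⟨a, b, rfl⟩ := hx
    obtain ⟨w, c, rfl⟩ := exists_eq_add_smul_xi m hℓ v
    refine ⟨ι _ w * a + algebraMap F _ (c * quad F m (xi F ℓ)) * b,
      algebraMap F _ c * a - ι _ w * b, ?_⟩
    have h1 := ι_xi_mul m ℓ (ι (quadW F m ℓ) w)
    rw [involute_ι, map_neg, clifIncl_ι] at h1
    have h2 : ι (quad F m) (w : Fin 4 → F) * ι (quad F m) (xi F ℓ) =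
      - (ι (quad F m) (xi F ℓ) * ι (quad F m) (w : Fin 4 → F)) := by rw [h1, neg_mul, neg_neg]
    have h3 : ι (quad F m) (c • xi F ℓ) = algebraMap F _ c * ι (quad F m) (xi F ℓ) := by
      rw [map_smul, Algebra.smul_def]
    have h4 := Algebra.commutes c (ι (quad F m) (xi F ℓ))
    have h5 : ι (quad F m) (xi F ℓ) * ι (quad F m) (xi F ℓ) =
      algebraMap F _ (quad F m (xi F ℓ)) := ι_sq_scalar _ _
    rw [map_add (ι (quad F m)), h3, map_add, map_sub, map_mul, map_mul,
      AlgHom.commutes, map_mul (clifIncl F m ℓ) (algebraMap _ _ c),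
      map_mul (clifIncl F m ℓ) (ι _ w) b, AlgHom.commutes, clifIncl_ι,
      map_mul (algebraMap F (CliffordAlgebra (quad F m))), ← h5]
    generalize clifIncl F m ℓ a = A at *
    generalize clifIncl F m ℓ b = B at *
    generalize ι (quad F m) (w : Fin 4 → F) = w' at *
    generalize ι (quad F m) (xi F ℓ) = z at *
    generalize algebraMap F (CliffordAlgebra (quad F m)) c = c' at *
    calc _ = w' * A + (w' * z) * B + c' * z * A + c' * z * z * B := by noncomm_ring
      _ = w' * A - z * w' * B + z * c' * A + c' * z * z * B := by rw [h2, h4]; noncomm_ring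
      _ = _ := by noncomm_ring

/-- In x = a + ξb, evenness lets a be taken even and b odd. Since ξ anticommutes with odd elements
of A(W), commuting with ξ gives 2ℓb = 0, so b vanishes. -/
theorem exists_eq_clifIncl (hℓ : (ℓ : F) ≠ 0) {x : CliffordAlgebra (quad F m)} (hx : involute x = x)
    (hc : ι (quad F m) (xi F ℓ) * x = x * ι (quad F m) (xi F ℓ)) :
    ∃ a, involute a = a ∧ x = clifIncl F m ℓ a := by
  obtain ⟨a, b, rfl⟩ := exists_eq_clifIncl_add hℓ x
  set z := ι (quad F m) (xi F ℓ) with hz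
  have hzz : z * z = algebraMap F _ (ℓ : F) := by
    rw [hz, ι_sq_scalar]; exact congrArg _ phi_xi_xi
  have ha := ι_xi_mul m ℓ a
  have hb := ι_xi_mul m ℓ b
  rw [← hz] at ha hb
  have h1 := ι_xi_mul m ℓ (a + involute a)
  have h2 := ι_xi_mul m ℓ (b - involute b)
  rw [map_add involute, involute_involute, add_comm (involute a)] at h1
  rw [map_sub involute, involute_involute, ← neg_sub b, map_neg] at h2
  rw [map_add involute, map_mul, involute_clifIncl, involute_clifIncl, hz, involute_ι, ← hz] at hx
  -- Adding to x its own image under the involution replaces a and b by twice their even and odd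
  -- parts, without using uniqueness of the decomposition.
  have h3 : (2 : CliffordAlgebra (quad F m)) * (clifIncl F m ℓ a + z * clifIncl F m ℓ b) =
      clifIncl F m ℓ (a + involute a) + z * clifIncl F m ℓ (b - involute b) := by
    rw [two_mul]
    nth_rw 2 [← hx]
    rw [map_add, map_sub]
    noncomm_ring
  rw [← hz] at h1 h2
  set x := clifIncl F m ℓ a + z * clifIncl F m ℓ b
  have h4 : z * (2 * x) = 2 * x * z := by rw [mul_assoc, ← hc, two_mul, two_mul, mul_add]
  generalize b - involute b = b' at *
  rw [h3, mul_add, add_mul, h1, add_right_inj, mul_assoc, h2, neg_mul, mul_neg,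
    ← mul_assoc, h2, neg_mul, neg_mul, neg_neg, mul_assoc, hzz] at h4
  have h5 : clifIncl F m ℓ b' = 0 := by
    have h6 : (2 * (ℓ : F)) • clifIncl F m ℓ b' = 0 := by
      rw [two_mul, add_smul, Algebra.smul_def, Algebra.commutes]
      nth_rw 1 [h4]
      rw [neg_add_cancel]
    exact (smul_eq_zero.mp h6).resolve_left (mul_ne_zero two_ne_zero hℓ)
  rw [h5, mul_zero, add_zero] at h3
  refine ⟨(2 : F)⁻¹ • (a + involute a), ?_, ?_⟩
  · rw [map_smul, map_add, involute_involute, add_comm]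
  · rw [map_smul, ← h3, two_mul, ← two_smul F, smul_smul, inv_mul_cancel₀ two_ne_zero, one_smul]

/-- Fixing ξ means commuting with ξ, so γ and γ⁻¹ both come from A(W). Injectivity of the inclusion
shows that the preimages are inverse to each other and preserve W. -/
theorem exists_inclG_eq {γ : GV F m} (h : (tau γ).1 (xi F ℓ) = xi F ℓ) :
    ∃ ε : GW F m ℓ, inclG F m hℓ ε = γ := by
  have key : ∀ γ : GV F m, (tau γ).1 (xi F ℓ) = xi F ℓ →
      ∃ a, involute a = a ∧ (γ.1 : CliffordAlgebra (quad F m)) = clifIncl F m ℓ a := by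
    intro γ h
    refine exists_eq_clifIncl hℓ γ.2.1 ?_
    have h1 := ι_tau γ (xi F ℓ)
    rw [h] at h1
    conv_lhs => rw [h1]
    rw [mul_assoc, Units.inv_mul, mul_one]
  have h' : (tau γ⁻¹).1 (xi F ℓ) = xi F ℓ := by rw [map_inv, SOV_inv_apply_eq, h]
  obtain ⟨a, ha, h1⟩ := key γ h
  obtain ⟨b, hb, h2⟩ := key γ⁻¹ h'
  have h2' : ((γ.1⁻¹ : (CliffordAlgebra (quad F m))ˣ) : CliffordAlgebra (quad F m)) =
    clifIncl F m ℓ b := h2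
  have hab : a * b = 1 := clifIncl_injective hℓ (by
    rw [map_mul, ← h1, ← h2', Units.mul_inv, map_one])
  have hba : b * a = 1 := clifIncl_injective hℓ (by
    rw [map_mul, ← h1, ← h2', Units.inv_mul, map_one])
  obtain ⟨g, hg⟩ := exists_extends_of_apply_xi hℓ h
  obtain ⟨g', hg'⟩ := exists_extends_of_apply_xi hℓ h'
  refine ⟨evenCliffordGroup.mk' a b hab hba ha (fun w => mem_range_of_eq (v := g.1 w) ?_)
    (fun w => mem_range_of_eq (v := g'.1 w) ?_), Subtype.ext (Units.ext h1.symm)⟩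
  · apply clifIncl_injective hℓ
    rw [map_mul, map_mul, clifIncl_ι, clifIncl_ι, ← hg.2, ← h1, ← h2', ι_tau]
  · apply clifIncl_injective hℓ
    rw [map_mul, map_mul, clifIncl_ι, clifIncl_ι, ← hg'.2, ι_tau, ← h1, ← h2]
    rfl

end ComplementClifford
end QuadSpace

/-! ### Extension of scalars on W and its compatibility with V₀ -/

namespace QuadSpace
open CliffordAlgebra

section CastComplement
variable (F : Type*) [Field F] [CharZero F] {m ℓ : ℕ}

theorem castV_xi : castV F (xi ℚ ℓ) = xi F ℓ := by
  rw [xi, castV_vec4, xi]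
  simp

theorem clifCastW_ι (x : W ℚ m ℓ) :
    clifCastW F m ℓ (ι (quadW ℚ m ℓ) x) = ι (quadW F m ℓ) (castW F m ℓ x) :=
  CliffordAlgebra.lift_ι_apply (Q := quadW ℚ m ℓ)
    (((ι (quadW F m ℓ)).restrictScalars ℚ) ∘ₗ castW F m ℓ) _ x

theorem clifCastW_algebraMap (r : ℚ) :
    clifCastW F m ℓ (algebraMap ℚ _ r) = algebraMap F _ (r : F) := by
  rw [AlgHom.commutes, IsScalarTower.algebraMap_apply ℚ F (CliffordAlgebra (quadW F m ℓ))]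
  rfl

theorem clifIncl_clifCastW (x : CliffordAlgebra (quadW ℚ m ℓ)) :
    clifIncl F m ℓ (clifCastW F m ℓ x) = clifCastV F m (clifIncl ℚ m ℓ x) := by
  induction x using CliffordAlgebra.induction with
  | algebraMap r =>
    rw [clifCastW_algebraMap, AlgHom.commutes, AlgHom.commutes, clifCastV_algebraMap]
  | ι v => rw [clifCastW_ι, clifIncl_ι, clifIncl_ι, clifCastV_ι]; rfl
  | mul a b ha hb => simp only [map_mul, ha, hb]
  | add a b ha hb => simp only [map_add, ha, hb]

variable {F}

theorem inclG_injective (hℓ : (ℓ : F) ≠ 0) : Function.Injective (inclG F m hℓ) := fun _ _ h =>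
  Subtype.ext (Units.ext (clifIncl_injective hℓ (congrArg Units.val (congrArg Subtype.val h))))

/-- Extension of scalars in G⁺(V₀) keeps ξ fixed, so the extended element already comes from G⁺(W ⊗
F) by `exists_inclG_eq`. -/
theorem exists_castGW (hQ : (ℓ : ℚ) ≠ 0) (hℓ : (ℓ : F) ≠ 0) (γ : GW ℚ m ℓ) :
    ∃ ε : GW F m ℓ, ε.1 = unitCastW F γ ∧ inclG F m hℓ ε = castG F (inclG ℚ m hQ γ) := by
  have h : (tau (castG F (inclG ℚ m hQ γ))).1 (xi F ℓ) = xi F ℓ := by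
    rw [← castV_xi, isCastV_tau_castG, (extends_tau_inclG hQ γ).1]
  obtain ⟨ε, hε⟩ := exists_inclG_eq hℓ h
  refine ⟨ε, Units.ext (clifIncl_injective hℓ ?_), hε⟩
  have h1 := congrArg (fun g : GV F m => (g.1 : CliffordAlgebra (quad F m))) hε
  exact h1.trans (clifIncl_clifCastW F _).symm

theorem inclG_eq_castG_iff (hQ : (ℓ : ℚ) ≠ 0) (hℓ : (ℓ : F) ≠ 0) {γ : GW ℚ m ℓ} {ε : GW F m ℓ} :
    ε.1 = unitCastW F γ ↔ inclG F m hℓ ε = castG F (inclG ℚ m hQ γ) := by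
  obtain ⟨ε', h1, h2⟩ := exists_castGW (F := F) hQ hℓ γ
  rw [← h1, ← h2, (inclG_injective hℓ).eq_iff, Subtype.ext_iff]

theorem exists_isCastV (hm : Squarefree m) (h : SOV ℚ m) : ∃ g : SOV F m, IsCastV h g := by
  obtain ⟨α, rfl⟩ := tau_surjective hm h
  exact ⟨_, isCastV_tau_castG α⟩

theorem isCastW_iff (hℓ : (ℓ : F) ≠ 0) {h : SOW ℚ m ℓ} {g : SOV ℚ m} (H : Extends h g)
    {h' : SOW F m ℓ} {g' : SOV F m} (H' : Extends h' g') : IsCastW h h' ↔ IsCastV g g' := by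
  have hQ : (ℓ : ℚ) ≠ 0 := by exact_mod_cast (Nat.cast_ne_zero (R := F)).mp hℓ
  constructor
  · intro hc v
    obtain ⟨w, c, rfl⟩ := exists_eq_add_smul_xi m hQ v
    have h1 : castV F (c • xi ℚ ℓ) = (c : F) • xi F ℓ := by
      rw [map_smul, castV_xi]
      ext i
      simp [Rat.smul_def]
    rw [H.apply, map_add (castV F), map_add (castV F), h1]
    refine (H'.apply (castW F m ℓ w) (c : F)).trans ?_
    rw [hc]
    rfl
  · intro hc w
    refine Subtype.ext ?_
    rw [← H'.2]
    exact (hc w).trans (congrArg _ (H.2 w))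

theorem exists_isCastW (hm : Squarefree m) (hℓ : (ℓ : F) ≠ 0) (h : SOW ℚ m ℓ) :
    ∃ h' : SOW F m ℓ, IsCastW h h' := by
  have hQ : (ℓ : ℚ) ≠ 0 := by exact_mod_cast (Nat.cast_ne_zero (R := F)).mp hℓ
  obtain ⟨g, hg⟩ := exists_extends hQ h
  obtain ⟨g', hg'⟩ := exists_isCastV (F := F) hm g
  obtain ⟨h', hh⟩ := exists_extends_of_apply_xi hℓ (g := g') (by
    rw [← castV_xi, hg', hg.1])
  exact ⟨h', (isCastW_iff hℓ hg hh).mpr hg'⟩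

end CastComplement
end QuadSpace

/-! ### The order generated by a lattice and integrality of its scalars -/

namespace QuadSpace
open CliffordAlgebra

section LatticeOrder
variable {F : Type*} [Field F] [CharZero F] {m ℓ : ℕ} {O : Subring F}

theorem algebraMap_mem_latticeOrder {M : Type*} [AddCommGroup M] [Module F M]
    {Q : QuadraticForm F M} (L : AddSubgroup M) {c : F} (hc : c ∈ O) :
    algebraMap F _ c ∈ latticeOrder Q O L :=
  Subring.subset_closure (Or.inr ⟨c, hc, rfl⟩)

theorem ι_mem_latticeOrder {M : Type*} [AddCommGroup M] [Module F M]
    {Q : QuadraticForm F M} {L : AddSubgroup M} {v : M} (hv : v ∈ L) :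
    ι Q v ∈ latticeOrder Q O L :=
  Subring.subset_closure (Or.inl ⟨v, hv, rfl⟩)

theorem reverse_mem_latticeOrder {M : Type*} [AddCommGroup M] [Module F M]
    {Q : QuadraticForm F M} {L : AddSubgroup M} {x : CliffordAlgebra Q}
    (hx : x ∈ latticeOrder Q O L) : reverse x ∈ latticeOrder Q O L := by
  induction hx using Subring.closure_induction with
  | mem x hx =>
    rcases hx with ⟨v, hv, rfl⟩ | ⟨c, hc, rfl⟩
    · rw [reverse_ι]; exact ι_mem_latticeOrder hv
    · rw [reverse.commutes]; exact algebraMap_mem_latticeOrder L hc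
  | zero => rw [map_zero]; exact zero_mem _
  | one => rw [reverse.map_one]; exact one_mem _
  | add x y _ _ hx hy => rw [map_add]; exact add_mem hx hy
  | neg x _ hx => rw [map_neg]; exact neg_mem hx
  | mul x y _ _ hx hy => rw [reverse.map_mul]; exact mul_mem hy hx

theorem clifIncl_mem_latticeOrder {x : CliffordAlgebra (quadW F m ℓ)}
    (hx : x ∈ latticeOrder (quadW F m ℓ) O (latticeW m ℓ O)) :
    clifIncl F m ℓ x ∈ latticeOrder (quad F m) O (lattice O) := by
  induction hx using Subring.closure_induction with
  | mem x hx =>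
    rcases hx with ⟨v, hv, rfl⟩ | ⟨c, hc, rfl⟩
    · rw [clifIncl_ι]; exact ι_mem_latticeOrder hv
    · rw [AlgHom.commutes]; exact algebraMap_mem_latticeOrder _ hc
  | zero => rw [map_zero]; exact zero_mem _
  | one => rw [map_one]; exact one_mem _
  | add x y _ _ hx hy => rw [map_add]; exact add_mem hx hy
  | neg x _ hx => rw [map_neg]; exact neg_mem hx
  | mul x y _ _ hx hy => rw [map_mul]; exact mul_mem hx hy

variable (O) in
/-- The `O`-span of the ordered monomials in a list of vectors. -/
def monomialSpan {M : Type*} [AddCommGroup M] [Module F M] (Q : QuadraticForm F M) :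
    List M → AddSubgroup (CliffordAlgebra Q)
  | [] => O.toAddSubgroup.map (algebraMap F (CliffordAlgebra Q)).toAddMonoidHom
  | v :: l => monomialSpan Q l ⊔ (monomialSpan Q l).map (AddMonoidHom.mulLeft (ι Q v))

section MonomialSpan
variable {M : Type*} [AddCommGroup M] [Module F M] {Q : QuadraticForm F M}

theorem mem_monomialSpan_cons {v : M} {l : List M} {x : CliffordAlgebra Q} :
    x ∈ monomialSpan O Q (v :: l) ↔
      ∃ y ∈ monomialSpan O Q l, ∃ z ∈ monomialSpan O Q l, x = y + ι Q v * z := by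
  rw [monomialSpan, AddSubgroup.mem_sup]
  constructor
  · rintro ⟨y, hy, _, ⟨z, hz, rfl⟩, rfl⟩
    exact ⟨y, hy, z, hz, rfl⟩
  · rintro ⟨y, hy, z, hz, rfl⟩
    exact ⟨y, hy, _, ⟨z, hz, rfl⟩, rfl⟩

theorem algebraMap_mul_mem_monomialSpan {c : F} (hc : c ∈ O) (l : List M) :
    ∀ x ∈ monomialSpan O Q l, algebraMap F _ c * x ∈ monomialSpan O Q l := by
  induction l with
  | nil =>
    rintro _ ⟨r, hr, rfl⟩
    exact ⟨c * r, O.mul_mem hc hr, map_mul (algebraMap F _) _ _⟩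
  | cons v l ih =>
    intro x hx
    obtain ⟨y, hy, z, hz, rfl⟩ := mem_monomialSpan_cons.mp hx
    refine mem_monomialSpan_cons.mpr ⟨_, ih y hy, _, ih z hz, ?_⟩
    rw [mul_add, ← mul_assoc, Algebra.commutes c (ι Q v), mul_assoc]

theorem one_mem_monomialSpan (l : List M) : 1 ∈ monomialSpan O Q l := by
  induction l with
  | nil => exact ⟨1, O.one_mem, map_one (algebraMap F _)⟩
  | cons v l ih => exact mem_monomialSpan_cons.mpr ⟨1, ih, 0, zero_mem _, by simp⟩

/-- The relations v² = Q(v) and vu + uv = polar(v, u) reorder monomials with coefficients in O.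
Hence the finitely generated span of ordered monomials is stable under the generators of the order.
-/
theorem ι_mul_mem_monomialSpan (l : List M) (hQ : ∀ v ∈ l, Q v ∈ O)
    (hP : ∀ v ∈ l, ∀ w ∈ l, QuadraticMap.polar Q v w ∈ O) :
    ∀ v ∈ l, ∀ x ∈ monomialSpan O Q l, ι Q v * x ∈ monomialSpan O Q l := by
  induction l with
  | nil => simp
  | cons u l ih =>
    have ih' := ih (fun v hv => hQ v (by simp [hv])) (fun v hv w hw => hP v (by simp [hv]) w
      (by simp [hw]))
    intro v hv x hx
    obtain ⟨y, hy, z, hz, rfl⟩ := mem_monomialSpan_cons.mp hx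
    rw [List.mem_cons] at hv
    rcases hv with rfl | hv
    · refine mem_monomialSpan_cons.mpr
        ⟨_, algebraMap_mul_mem_monomialSpan (hQ v (by simp)) l z hz, y, hy, ?_⟩
      rw [mul_add, ← mul_assoc, ι_sq_scalar, add_comm]
    · refine mem_monomialSpan_cons.mpr ⟨_, add_mem (ih' v hv y hy)
        (algebraMap_mul_mem_monomialSpan (hP v (by simp [hv]) u (by simp)) l z hz),
        _, neg_mem (ih' v hv z hz), ?_⟩
      rw [← ι_mul_ι_add_swap v u]
      noncomm_ring

end MonomialSpan

/-- The standard basis of `F⁴`, as a list. -/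
def basisList (F : Type*) [Field F] : List (Fin 4 → F) :=
  [![1, 0, 0, 0], ![0, 1, 0, 0], ![0, 0, 1, 0], ![0, 0, 0, 1]]

theorem mul_mem_monomialSpan {x : CliffordAlgebra (quad F m)}
    (hx : x ∈ latticeOrder (quad F m) O (lattice O)) :
    ∀ y ∈ monomialSpan O (quad F m) (basisList F), x * y ∈ monomialSpan O (quad F m) (basisList F) := by
  have hL : ∀ v ∈ basisList F, v ∈ lattice O := by
    intro v hv
    simp only [basisList, List.mem_cons, List.not_mem_nil, or_false] at hv
    rcases hv with rfl | rfl | rfl | rfl <;> apply vec4_mem_lattice <;>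
      first | exact O.zero_mem | exact O.one_mem
  have hι := ι_mul_mem_monomialSpan (O := O) (Q := quad F m) (basisList F)
    (fun v hv => quad_mem (hL v hv)) (fun v hv w hw => polar_mem (hL v hv) (hL w hw))
  induction hx using Subring.closure_induction with
  | mem x hx =>
    rcases hx with ⟨v, hv, rfl⟩ | ⟨c, hc, rfl⟩
    · intro y hy
      have h : v = v 0 • ![1, 0, 0, 0] + v 1 • ![0, 1, 0, 0] + v 2 • ![0, 0, 1, 0] +
          v 3 • ![0, 0, 0, 1] := by apply vec4_ext <;> simp
      rw [h]
      simp only [map_add, map_smul, add_mul, smul_mul_assoc]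
      simp only [Algebra.smul_def]
      refine add_mem (add_mem (add_mem ?_ ?_) ?_) ?_ <;>
        exact algebraMap_mul_mem_monomialSpan (hv _) _ _ (hι _ (by
          simp only [basisList, List.mem_cons, true_or, or_true]) y hy)
    · exact algebraMap_mul_mem_monomialSpan hc _
  | zero => intro y _; rw [zero_mul]; exact zero_mem _
  | one => intro y hy; rwa [one_mul]
  | add x y _ _ hx hy => intro z hz; rw [add_mul]; exact add_mem (hx z hz) (hy z hz)
  | neg x _ hx => intro z hz; rw [neg_mul]; exact neg_mem (hx z hz)
  | mul x y _ _ hx hy => intro z hz; rw [mul_assoc]; exact hx _ (hy z hz)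

variable {p : Nat.Primes}

theorem exists_bound_monomialSpan {M : Type*} [AddCommGroup M] [Module ℚ_[p] M]
    {Q : QuadraticForm ℚ_[p] M} (l : List M) (f : CliffordAlgebra Q →ₗ[ℚ_[p]] ℚ_[p]) :
    ∃ C : ℝ, ∀ x ∈ monomialSpan (Zp p) Q l, ‖f x‖ ≤ C := by
  induction l generalizing f with
  | nil =>
    refine ⟨‖f 1‖, ?_⟩
    rintro _ ⟨r, hr, rfl⟩
    change ‖f (algebraMap _ _ r)‖ ≤ _
    rw [Algebra.algebraMap_eq_smul_one, map_smul, norm_smul]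
    exact mul_le_of_le_one_left (norm_nonneg _) (mem_Zp.mp hr)
  | cons v l ih =>
    obtain ⟨C, hC⟩ := ih f
    obtain ⟨D, hD⟩ := ih (f ∘ₗ LinearMap.mulLeft ℚ_[p] (ι Q v))
    refine ⟨C + D, fun x hx => ?_⟩
    obtain ⟨y, hy, z, hz, rfl⟩ := mem_monomialSpan_cons.mp hx
    rw [map_add]
    exact (norm_add_le _ _).trans (add_le_add (hC y hy) (hD z hz))

theorem mem_Zp_of_algebraMap_mem_latticeOrder {c : ℚ_[p]}
    (hc : algebraMap ℚ_[p] _ c ∈ latticeOrder (quad ℚ_[p] m) (Zp p) (lattice (Zp p))) :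
    c ∈ Zp p := by
  obtain ⟨f, hf⟩ := LinearMap.exists_leftInverse_of_injective
    (Algebra.linearMap ℚ_[p] (CliffordAlgebra (quad ℚ_[p] m)))
    (LinearMap.ker_eq_bot.mpr (algebraMap_inj _))
  obtain ⟨C, hC⟩ := exists_bound_monomialSpan (p := p) (Q := quad ℚ_[p] m) (basisList _) f
  rw [mem_Zp]
  by_contra! h
  -- The powers of c stay in the order, and applied to 1 they stay in the monomial span, on which f
  -- is bounded. This is impossible if |c| > 1.
  obtain ⟨n, hn⟩ := pow_unbounded_of_one_lt C h
  have h1 := hC _ (mul_mem_monomialSpan (pow_mem hc n) 1 (one_mem_monomialSpan _))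
  rw [mul_one, ← map_pow] at h1
  have h2 : f (algebraMap _ _ (c ^ n)) = c ^ n := LinearMap.congr_fun hf (c ^ n)
  rw [h2, norm_pow] at h1
  exact absurd h1 (not_le.mpr hn)

end LatticeOrder
end QuadSpace

/-! ### Integrality at almost all primes -/

namespace QuadSpace
open CliffordAlgebra Filter

section AlmostAll
variable {m ℓ : ℕ}

theorem eventually_mem_Zp (r : ℚ) :
    ∀ᶠ p : Nat.Primes in cofinite, (r : ℚ_[p]) ∈ Zp p := by
  have h : Set.Finite ((fun p : Nat.Primes => (p : ℕ)) ⁻¹' (r.den.primeFactors : Set ℕ)) :=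
    Set.Finite.preimage (fun a _ b _ h => Subtype.ext h) (Finset.finite_toSet _)
  refine Filter.eventually_cofinite.mpr (h.subset fun p hp => ?_)
  simp only [Set.mem_preimage, Finset.mem_coe, Nat.mem_primeFactors]
  refine ⟨p.2, ?_, r.den_nz⟩
  by_contra hd
  exact hp (mem_Zp.mpr (Padic.norm_rat_le_one hd))

theorem eventually_isUnitIn_Zp {r : ℚ} (hr : r ≠ 0) :
    ∀ᶠ p : Nat.Primes in cofinite, IsUnitIn (Zp p) (r : ℚ_[p]) := by
  filter_upwards [eventually_mem_Zp r, eventually_mem_Zp r⁻¹] with p h1 h2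
  exact ⟨Rat.cast_ne_zero.mpr hr, h1, by rwa [← Rat.cast_inv]⟩

theorem eventually_castV_mem (v : Fin 4 → ℚ) :
    ∀ᶠ p : Nat.Primes in cofinite, castV ℚ_[p] v ∈ lattice (Zp p) := by
  filter_upwards [eventually_mem_Zp (v 0), eventually_mem_Zp (v 1), eventually_mem_Zp (v 2),
    eventually_mem_Zp (v 3)] with p h0 h1 h2 h3
  intro i
  fin_cases i <;> assumption

theorem eventually_mem_stabilizer (h : SOV ℚ m) : ∀ᶠ p : Nat.Primes in cofinite,
    ∀ g : SOV ℚ_[p] m, IsCastV h g → g ∈ stabilizer (quad ℚ_[p] m) (lattice (Zp p)) := by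
  have key : ∀ h : SOV ℚ m, ∀ᶠ p : Nat.Primes in cofinite, ∀ g : SOV ℚ_[p] m, IsCastV h g →
      ∀ v ∈ lattice (Zp p), g.1 v ∈ lattice (Zp p) := by
    intro h
    filter_upwards [eventually_castV_mem (h.1 ![1, 0, 0, 0]),
      eventually_castV_mem (h.1 ![0, 1, 0, 0]), eventually_castV_mem (h.1 ![0, 0, 1, 0]),
      eventually_castV_mem (h.1 ![0, 0, 0, 1])] with p h0 h1 h2 h3 g hg v hv
    rw [castV_span _ v]
    simp only [map_add, map_smul, hg _]
    exact add_mem (add_mem (add_mem (smul_mem_lattice (hv 0) h0) (smul_mem_lattice (hv 1) h1))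
      (smul_mem_lattice (hv 2) h2)) (smul_mem_lattice (hv 3) h3)
  filter_upwards [key h, key h⁻¹] with p h1 h2 g hg
  exact mem_stabilizer_of (h1 g hg) (h2 g⁻¹ hg.inv)

theorem eventually_castG_mem_unitG (hm : Squarefree m) (α : GV ℚ m) :
    ∀ᶠ p : Nat.Primes in cofinite, castG ℚ_[p] α ∈ unitG (Zp p) m := by
  obtain ⟨c, hc, h⟩ := exists_hasNorm hm α
  filter_upwards [eventually_mem_stabilizer (tau α), eventually_isUnitIn_Zp hc] with p h1 h2
  exact mem_unitG_iff.mpr ⟨h1 _ (isCastV_tau_castG α), _, h2, hasNorm_castG h⟩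

/-- When 2ℓ is a unit the lattice splits as (O⁴ ∩ W) ⊕ Oξ, the coefficient of ξ being 2φ₀(v,
ξ)/(2ℓ). Hence the integral structure of the restricted product is compatible with L₀ at every prime
not dividing 2ℓ. -/
theorem Extends.mem_stabilizer {F : Type*} [Field F] [CharZero F] {O : Subring F}
    (hℓ : IsUnitIn O (2 * (ℓ : F))) {h : SOW F m ℓ} {g : SOV F m} (H : Extends h g)
    (hh : h ∈ QuadSpace.stabilizer (quadW F m ℓ) (latticeW m ℓ O)) :
    g ∈ QuadSpace.stabilizer (quad F m) (lattice O) := by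
  have hℓ' : (ℓ : F) ≠ 0 := right_ne_zero_of_mul hℓ.1
  have hxi : xi F ℓ ∈ lattice O :=
    vec4_mem_lattice O.one_mem O.zero_mem O.zero_mem (natCast_mem O ℓ)
  have key : ∀ (h : SOW F m ℓ) (g : SOV F m), Extends h g →
      h ∈ QuadSpace.stabilizer (quadW F m ℓ) (latticeW m ℓ O) →
      ∀ v ∈ lattice O, g.1 v ∈ lattice O := by
    intro h g H hh v hv
    obtain ⟨w, c, rfl⟩ := exists_eq_add_smul_xi m hℓ' v
    have hc : c ∈ O := by
      have h1 := div_mem_of_isUnitIn (polar_mem (m := m) hv hxi) hℓ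
      rw [polar_eq_two_phi, map_add, map_smul, LinearMap.add_apply, LinearMap.smul_apply, phi_coe_xi,
        phi_xi_xi, zero_add, smul_eq_mul, mul_left_comm, mul_div_cancel_right₀ _ hℓ.1] at h1
      exact h1
    have hw : w ∈ latticeW m ℓ O := by
      have := sub_mem hv (smul_mem_lattice hc hxi)
      rwa [add_sub_cancel_right] at this
    rw [H.apply]
    exact add_mem ((hh w).mpr hw) (smul_mem_lattice hc hxi)
  exact mem_stabilizer_of (key h g H hh) (key h⁻¹ g⁻¹ H.inv (inv_mem hh))

theorem Extends.mem_stabilizerW {F : Type*} [Field F] [CharZero F] {O : Subring F}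
    {h : SOW F m ℓ} {g : SOV F m} (H : Extends h g)
    (hg : g ∈ QuadSpace.stabilizer (quad F m) (lattice O)) :
    h ∈ QuadSpace.stabilizer (quadW F m ℓ) (latticeW m ℓ O) := by
  intro w
  change ((h.1 w : W F m ℓ) : Fin 4 → F) ∈ lattice O ↔ (w : Fin 4 → F) ∈ lattice O
  rw [← H.2, hg]

/-- The norms of an integral element and of its inverse are scalars in the order generated by the
lattice, hence in ℤ_p; being inverse to each other, they are units. -/
theorem inclG_mem_unitG (hm : Squarefree m) {p : Nat.Primes} (hℓ : (ℓ : ℚ_[p]) ≠ 0)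
    (h2 : IsUnitIn (Zp p) (2 * (ℓ : ℚ_[p]))) {ε : GW ℚ_[p] m ℓ} (hε : ε ∈ intGW m ℓ p) :
    inclG ℚ_[p] m hℓ ε ∈ unitG (Zp p) m := by
  have key : ∀ ε ∈ intGW m ℓ p, ∀ c, HasNorm (inclG ℚ_[p] m hℓ ε) c → c ∈ Zp p := by
    intro ε hε c hc
    refine mem_Zp_of_algebraMap_mem_latticeOrder (m := m) ?_
    rw [← hc]
    have h := clifIncl_mem_latticeOrder hε.1
    exact mul_mem h (reverse_mem_latticeOrder h)
  obtain ⟨c, hc, h⟩ := exists_hasNorm hm (inclG ℚ_[p] m hℓ ε)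
  refine mem_unitG_iff.mpr ⟨(extends_tau_inclG hℓ ε).mem_stabilizer h2 hε.2.2, c,
    ⟨hc, key ε hε c h, key ε⁻¹ (inv_mem hε) _ ?_⟩, h⟩
  rw [map_inv]
  exact h.inv hm

theorem eventually_isUnitIn_two_mul (hℓ : 0 < ℓ) :
    ∀ᶠ p : Nat.Primes in cofinite, IsUnitIn (Zp p) (2 * (ℓ : ℚ_[p])) := by
  have h : (2 * (ℓ : ℚ)) ≠ 0 := by positivity
  filter_upwards [eventually_isUnitIn_Zp h] with p hp
  simpa using hp

theorem eventually_inclG_mem_unitG (hm : Squarefree m) (hℓ : ∀ p : Nat.Primes, (ℓ : ℚ_[p]) ≠ 0)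
    (ε : GWA m ℓ) :
    ∀ᶠ p : Nat.Primes in cofinite, inclG ℚ_[p] m (hℓ p) (ε.2 p) ∈ unitG (Zp p) m := by
  have h0 : 0 < ℓ := Nat.pos_of_ne_zero fun h => hℓ ⟨2, Nat.prime_two⟩ (by rw [h, Nat.cast_zero])
  filter_upwards [eventually_isUnitIn_two_mul h0, ε.2.2] with p h1 h2
  exact inclG_mem_unitG hm (hℓ p) h1 h2

theorem eventually_mem_stabilizer_of_extends (hℓ : 0 < ℓ) (ε : HA m ℓ) :
    ∀ᶠ p : Nat.Primes in cofinite, ∀ g : SOV ℚ_[p] m, Extends (ε.2 p) g →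
      g ∈ stabilizer (quad ℚ_[p] m) (lattice (Zp p)) := by
  filter_upwards [eventually_isUnitIn_two_mul hℓ, ε.2.2] with p h1 h2 g hg
  exact hg.mem_stabilizer h1 h2

theorem eventually_clifCastW_mem (x : CliffordAlgebra (quadW ℚ m ℓ)) :
    ∀ᶠ p : Nat.Primes in cofinite, clifCastW ℚ_[p] m ℓ x ∈
      latticeOrder (quadW ℚ_[p] m ℓ) (Zp p) (latticeW m ℓ (Zp p)) := by
  induction x using CliffordAlgebra.induction with
  | algebraMap r =>
    filter_upwards [eventually_mem_Zp r] with p h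
    rw [clifCastW_algebraMap]
    exact algebraMap_mem_latticeOrder _ h
  | ι w =>
    filter_upwards [eventually_castV_mem (w : Fin 4 → ℚ)] with p h
    rw [clifCastW_ι]
    exact ι_mem_latticeOrder h
  | mul a b ha hb =>
    filter_upwards [ha, hb] with p h1 h2
    rw [map_mul]
    exact mul_mem h1 h2
  | add a b ha hb =>
    filter_upwards [ha, hb] with p h1 h2
    rw [map_add]
    exact add_mem h1 h2

/-- The point is membership in the restricted product: a rational element and its inverse involve
finitely many vectors and scalars, so only finitely many denominators. -/
theorem exists_mem_GWQ (hQ : (ℓ : ℚ) ≠ 0)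
    (hℓ : ∀ p : Nat.Primes, (ℓ : ℚ_[p]) ≠ 0) (γ : GW ℚ m ℓ) :
    ∃ a ∈ GWQ m ℓ, ∀ p : Nat.Primes,
      inclG ℚ_[p] m (hℓ p) (a.2 p) = castG ℚ_[p] (inclG ℚ m hQ γ) := by
  have hR : (ℓ : ℝ) ≠ 0 := by exact_mod_cast hQ
  obtain ⟨r, hr, -⟩ := exists_castGW (F := ℝ) hQ hR γ
  choose e he hi using fun p : Nat.Primes => exists_castGW (F := ℚ_[p]) hQ (hℓ p) γ
  refine ⟨(r, ⟨e, ?_⟩), ⟨γ, hr, he⟩, hi⟩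
  filter_upwards [eventually_clifCastW_mem (γ.1 : CliffordAlgebra (quadW ℚ m ℓ)),
    eventually_clifCastW_mem ((γ.1⁻¹ : (CliffordAlgebra (quadW ℚ m ℓ))ˣ) :
      CliffordAlgebra (quadW ℚ m ℓ)), eventually_mem_stabilizer (tau (inclG ℚ m hQ γ))]
    with p h1 h2 h3
  refine ⟨?_, ?_, ?_⟩
  · rw [he p]; exact h1
  · rw [he p]; exact h2
  · refine (extends_tau_inclG (hℓ p) (e p)).mem_stabilizerW (h3 _ ?_)
    rw [hi p]
    exact isCastV_tau_castG _

theorem exists_mem_HQ (hm : Squarefree m) (hℓ : 0 < ℓ) (h : SOW ℚ m ℓ) :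
    ∃ a ∈ HQ m ℓ, ∀ p : Nat.Primes, IsCastW h (a.2 p) := by
  have hQ : (ℓ : ℚ) ≠ 0 := by positivity
  have hp : ∀ p : Nat.Primes, (ℓ : ℚ_[p]) ≠ 0 := fun p => by exact_mod_cast hℓ.ne'
  obtain ⟨r, hr⟩ := exists_isCastW (F := ℝ) hm (by positivity) h
  choose e he using fun p : Nat.Primes => exists_isCastW (F := ℚ_[p]) hm (hp p) h
  obtain ⟨g, hg⟩ := exists_extends hQ h
  refine ⟨(r, ⟨e, ?_⟩), ⟨h, hr, he⟩, he⟩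
  filter_upwards [eventually_mem_stabilizer g] with p h1
  obtain ⟨g', hg'⟩ := exists_extends (hp p) (e p)
  exact hg'.mem_stabilizerW (h1 _ ((isCastW_iff (hp p) hg hg').mp (he p)))

end AlmostAll
end QuadSpace

/-! ### Maximality of the form and the vectors of L₀[ℓ, 2⁻¹ℤ] -/

namespace QuadSpace
open CliffordAlgebra

section IntegralVectors
variable {m ℓ : ℕ}

theorem intCast_dvd_of_dvd_sq {m : ℕ} (hm : Squarefree m) {k : ℤ} (h : (m : ℤ) ∣ k ^ 2) :
    (m : ℤ) ∣ k := by
  rw [Int.natCast_dvd] at h ⊢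
  rw [Int.natAbs_pow] at h
  exact (hm.dvd_pow_iff_dvd two_ne_zero).mp h

/-- The binary form attached to `m` is a maximal integral form. -/
theorem mem_ZZ_of_qS_mem (hm : Squarefree m) {x y : ℚ} (h1 : 2 * x + tS m * y ∈ ZZ)
    (h2 : tS m * x + 2 * nS m * y ∈ ZZ) (h : qS m x y ∈ ZZ) : x ∈ ZZ ∧ y ∈ ZZ := by
  have hm0 : (m : ℚ) ≠ 0 := by exact_mod_cast hm.ne_zero
  obtain ⟨j, hj⟩ := h1
  obtain ⟨k, hk⟩ := h2
  obtain ⟨q, hq⟩ := h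
  simp only [eq_intCast] at hj hk hq
  rw [qS] at hq
  by_cases h3 : m % 4 = 3
  · have ht : tS m = 1 := by simp [tS, h3]
    have hn : (m : ℚ) = 4 * nS m - 1 := by
      have : (m : ℤ) = 4 * nS m - 1 := by simp only [nS, h3, if_true]; omega
      exact_mod_cast this
    rw [ht] at hj hk hq
    push_cast at hj hk hq
    -- Completing the square gives m(4q − j²) = (my)² with my an integer. Square-freeness yields m ∣
    -- my, so y is an integer.
    have hK : (2 * k - j : ℚ) = m * y := by rw [hj, hk, hn]; ring
    have e1 : (m : ℤ) * (4 * q - j ^ 2) = (2 * k - j) ^ 2 := by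
      have : (m : ℚ) * (4 * q - j ^ 2) = (2 * k - j) ^ 2 := by rw [hK, hq, hj, hn]; ring
      exact_mod_cast this
    obtain ⟨r, hr⟩ := intCast_dvd_of_dvd_sq hm (Dvd.intro _ e1)
    have hy : y = r := by
      have : (m : ℚ) * y = m * r := by rw [← hK]; exact_mod_cast hr
      exact mul_left_cancel₀ hm0 this
    -- Since m is odd, 4q = j² + m r² forces j and r to have the same parity, and x = (j − r)/2.
    have hpar : Even (j - r) := by
      have e2 : 4 * q = j ^ 2 + m * r ^ 2 := by
        have : (4 * q : ℚ) = j ^ 2 + m * r ^ 2 := by rw [hq, hj, hn, ← hy]; ring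
        exact_mod_cast this
      have hmo : ¬ Even (m : ℤ) := by rw [Int.even_iff]; omega
      have : Even (j ^ 2 + m * r ^ 2) := ⟨2 * q, by rw [← e2]; ring⟩
      simp only [Int.even_add, Int.even_sub, Int.even_pow, Int.even_mul, hmo, false_or] at this ⊢
      simpa using this
    obtain ⟨s, hs⟩ := hpar
    refine ⟨⟨s, ?_⟩, ⟨r, hy.symm⟩⟩
    have : (j - r : ℚ) = s + s := by exact_mod_cast hs
    simp only [eq_intCast]
    rw [hj, ← hy] at this
    linarith
  · have ht : tS m = 0 := by simp [tS, h3]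
    have hn : nS m = m := by simp [nS, h3]
    rw [ht, hn] at hk hq
    rw [ht] at hj
    push_cast at hj hk hq
    have e1 : (m : ℤ) * (4 * q - j ^ 2) = k ^ 2 := by
      have : (m : ℚ) * (4 * q - j ^ 2) = k ^ 2 := by rw [hk, hq, hj]; ring
      exact_mod_cast this
    obtain ⟨r, hr⟩ := intCast_dvd_of_dvd_sq hm (Dvd.intro _ e1)
    have hy : 2 * y = r := by
      have : (m : ℚ) * (2 * y) = m * r := by
        have : (k : ℚ) = m * r := by exact_mod_cast hr
        rw [← this, hk]; ring
      exact mul_left_cancel₀ hm0 this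
    have e2 : 4 * q = j ^ 2 + m * r ^ 2 := by
      have : (4 * q : ℚ) = j ^ 2 + m * r ^ 2 := by rw [hq, hj, ← hy]; ring
      exact_mod_cast this
    have hm4 : m % 4 = 1 ∨ m % 4 = 2 := by
      have : m % 4 ≠ 0 := fun h0 => by
        have := hm 2 (Nat.dvd_of_mod_eq_zero h0)
        simp at this
      omega
    -- For m ≡ 1, 2 mod 4 the form j² + m r² vanishes modulo 4 only when j and r are even.
    have hpar : Even j ∧ Even r := by
      have hz : ((m : ZMod 4) = 1 ∨ (m : ZMod 4) = 2) := by
        rcases hm4 with h | h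
        · left; rw [← ZMod.natCast_mod, h]; rfl
        · right; rw [← ZMod.natCast_mod, h]; rfl
      have e3 : (j : ZMod 4) ^ 2 + m * (r : ZMod 4) ^ 2 = 0 := by
        have := congrArg (Int.cast : ℤ → ZMod 4) e2
        push_cast at this
        rw [← this, show (4 : ZMod 4) = 0 from rfl, zero_mul]
      have key : ∀ a b c : ZMod 4, (c = 1 ∨ c = 2) → a ^ 2 + c * b ^ 2 = 0 →
          2 * a = 0 ∧ 2 * b = 0 := by decide
      have hev : ∀ a : ℤ, 2 * (a : ZMod 4) = 0 → Even a := by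
        intro a ha
        have h4 : ((2 * a : ℤ) : ZMod 4) = 0 := by push_cast; exact ha
        rw [ZMod.intCast_zmod_eq_zero_iff_dvd] at h4
        rw [Int.even_iff]; omega
      exact ⟨hev j (key _ _ _ hz e3).1, hev r (key _ _ _ hz e3).2⟩
    obtain ⟨⟨a, ha⟩, ⟨b, hb⟩⟩ := hpar
    have ha' : (j : ℚ) = a + a := by exact_mod_cast ha
    have hb' : (r : ℚ) = b + b := by exact_mod_cast hb
    refine ⟨⟨a, ?_⟩, ⟨b, ?_⟩⟩ <;> simp only [eq_intCast] <;> linarith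

theorem basis_mem_lattice {F : Type*} [Field F] [CharZero F] {O : Subring F} (i : Fin 4) :
    (Pi.single i 1 : Fin 4 → F) ∈ lattice O := by
  intro k
  rw [Pi.single_apply]
  split_ifs
  exacts [O.one_mem, O.zero_mem]

theorem mem_X_iff {v : Fin 4 → ℚ} : v ∈ X m ℓ ↔ quad ℚ m v = ℓ ∧
    (lattice ZZ).map (phi ℚ m v).toAddMonoidHom = AddSubgroup.zmultiples (2⁻¹ : ℚ) := Iff.rfl

/-- The condition on φ₀(v, L₀) puts v in the dual of L₀ for 2φ₀, and φ₀[v] = ℓ is an integer;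
maximality of the binary form then puts v in L₀. -/
theorem mem_lattice_of_mem_X (hm : Squarefree m) {v : Fin 4 → ℚ} (hv : v ∈ X m ℓ) :
    v ∈ lattice ZZ := by
  have h1 : ∀ y ∈ lattice ZZ, QuadraticMap.polar (quad ℚ m) v y ∈ ZZ := by
    intro y hy
    have h2 : phi ℚ m v y ∈ AddSubgroup.zmultiples (2⁻¹ : ℚ) := hv.2 ▸ ⟨y, hy, rfl⟩
    obtain ⟨n, hn⟩ := h2
    refine ⟨n, ?_⟩
    change n • (2⁻¹ : ℚ) = phi ℚ m v y at hn
    rw [polar_eq_two_phi, ← hn, zsmul_eq_mul, mul_left_comm, mul_inv_cancel₀ two_ne_zero, mul_one]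
    rfl
  have hb : ∀ i : Fin 4, _ := fun i => h1 _ (basis_mem_lattice i)
  have hq := hv.1
  change quad ℚ m v = ℓ at hq
  obtain ⟨a, b, c, d, rfl⟩ := exists_eq_vec4 v
  have h0 := hb 0
  have h3 := hb 3
  have h1 := ZZ.neg_mem (hb 1)
  have h2 := ZZ.neg_mem (hb 2)
  simp only [polar_eq, bS] at h0 h1 h2 h3
  simp at h0 h1 h2 h3
  have hq' : qS m b c ∈ ZZ := by
    have : qS m b c = a * d - ℓ := by rw [← hq, quad_eq]; simp
    rw [this]
    exact ZZ.sub_mem (ZZ.mul_mem h3 h0) (natCast_mem ZZ ℓ)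
  have h4 : 2 * b + tS m * c ∈ ZZ := by
    obtain ⟨n, hn⟩ := h1
    exact ⟨n, by simp only [eq_intCast]; rw [hn]; ring⟩
  have h5 : tS m * b + 2 * nS m * c ∈ ZZ := by
    obtain ⟨n, hn⟩ := h2
    exact ⟨n, by simp only [eq_intCast]; rw [hn]; ring⟩
  obtain ⟨hb, hc⟩ := mem_ZZ_of_qS_mem hm h4 h5 hq'
  exact vec4_mem_lattice h3 hb hc h0

theorem exists_polar_eq_one_of_mem_X {v : Fin 4 → ℚ} (hv : v ∈ X m ℓ) :
    ∃ y ∈ lattice ZZ, QuadraticMap.polar (quad ℚ m) v y = 1 := by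
  have h : (2⁻¹ : ℚ) ∈ (lattice ZZ).map (phi ℚ m v).toAddMonoidHom :=
    hv.2 ▸ AddSubgroup.mem_zmultiples _
  obtain ⟨y, hy, h⟩ := h
  refine ⟨y, hy, ?_⟩
  rw [polar_eq_two_phi]
  change phi ℚ m v y = 2⁻¹ at h
  rw [h, mul_inv_cancel₀ two_ne_zero]

theorem polar_castV {F : Type*} [Field F] [CharZero F] (v w : Fin 4 → ℚ) :
    QuadraticMap.polar (quad F m) (castV F v) (castV F w) =
      (QuadraticMap.polar (quad ℚ m) v w : ℚ) := by
  rw [polar_eq_two_phi, polar_eq_two_phi, phi_castV]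
  push_cast
  rfl

theorem quad_castV {F : Type*} [Field F] [CharZero F] (v : Fin 4 → ℚ) :
    quad F m (castV F v) = (quad ℚ m v : ℚ) := phi_castV F m v v

theorem polar_castV_left {F : Type*} [Field F] [CharZero F] {v : Fin 4 → ℚ} {n : Fin 4 → ℤ}
    (hn : ∀ i, QuadraticMap.polar (quad ℚ m) v (Pi.single i 1) = n i) (y : Fin 4 → F) :
    QuadraticMap.polar (quad F m) (castV F v) y = ∑ i, y i * (n i : F) := by
  have hs : ∀ i : Fin 4, (Pi.single i 1 : Fin 4 → F) = castV F (Pi.single i 1) := by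
    intro i
    ext j
    simp only [castV, Pi.single_apply, LinearMap.coe_mk, AddHom.coe_mk]
    split_ifs <;> simp
  have hy : y = ∑ i, y i • (Pi.single i 1 : Fin 4 → F) := pi_eq_sum_univ' y
  conv_lhs => rw [hy]
  rw [← QuadraticMap.polarBilin_apply_apply, map_sum]
  refine Finset.sum_congr rfl fun i _ => ?_
  rw [map_smul, smul_eq_mul, QuadraticMap.polarBilin_apply_apply, hs, polar_castV, hn,
    Rat.cast_intCast]

theorem exists_not_dvd_of_sum_eq_one {p : Nat.Primes} {n : Fin 4 → ℤ} {y : Fin 4 → ℚ_[p]}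
    (hy : y ∈ lattice (Zp p)) (h : ∑ i, y i * (n i : ℚ_[p]) = 1) :
    ∃ i, ¬ ((p : ℕ) : ℤ) ∣ n i := by
  by_contra! hd
  choose k hk using hd
  have h1 : ∑ i, y i * (k i : ℚ_[p]) ∈ Zp p :=
    (Zp p).sum_mem fun i _ => (Zp p).mul_mem (hy i) (intCast_mem _ _)
  have h2 : ((p : ℕ) : ℚ_[p]) * ∑ i, y i * (k i : ℚ_[p]) = 1 := by
    rw [← h, Finset.mul_sum]
    refine Finset.sum_congr rfl fun i _ => ?_
    rw [hk]
    push_cast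
    ring
  have h3 := congrArg norm h2
  rw [norm_mul, norm_one] at h3
  have h4 : ‖((p : ℕ) : ℚ_[p])‖ < 1 := Padic.norm_p_lt_one
  exact absurd h3 (mul_lt_one_of_nonneg_of_lt_one_left (norm_nonneg _) h4 (mem_Zp.mp h1)).ne

theorem exists_sum_mul_eq_one {n : Fin 4 → ℤ}
    (h : ∀ p : Nat.Primes, ∃ i, ¬ ((p : ℕ) : ℤ) ∣ n i) : ∃ c : Fin 4 → ℤ, ∑ i, c i * n i = 1 := by
  refine Ideal.mem_span_range_iff_exists_fun.mp ?_
  suffices hspan : Ideal.span (Set.range n) = ⊤ from hspan ▸ Submodule.mem_top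
  by_contra hne
  obtain ⟨d, hd⟩ := (IsPrincipalIdealRing.principal (Ideal.span (Set.range n))).principal
  have hd1 : d.natAbs ≠ 1 := fun h => hne (by
    rw [hd]
    exact Ideal.span_singleton_eq_top.mpr (Int.isUnit_iff_natAbs_eq.mpr h))
  obtain ⟨p, hp, hpd⟩ := Nat.exists_prime_and_dvd hd1
  obtain ⟨i, hi⟩ := h ⟨p, hp⟩
  have h4 : n i ∈ Ideal.span (Set.range n) := Ideal.subset_span ⟨i, rfl⟩
  rw [hd] at h4
  exact hi ((Int.natCast_dvd.mpr hpd).trans (Ideal.mem_span_singleton.mp h4))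

/-- At each p the vector is the image of ξ, which pairs to 1 with f, under a lattice-preserving
isometry. So no prime divides all pairings with the basis vectors, and Bézout gives an integral
vector pairing to 1 with v. -/
theorem mem_X_of_local {v : Fin 4 → ℚ} (hq : quad ℚ m v = ℓ)
    (H : ∀ p : Nat.Primes, ∃ c ∈ stabilizer (quad ℚ_[p] m) (lattice (Zp p)),
      castV ℚ_[p] v = c.1 (xi ℚ_[p] ℓ)) : v ∈ X m ℓ := by
  have hv : v ∈ lattice ZZ := by
    refine mem_lattice_ZZ_iff.mpr fun p => ?_
    obtain ⟨c, hc, h⟩ := H p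
    rw [h, hc]
    exact vec4_mem_lattice (Zp p).one_mem (Zp p).zero_mem (Zp p).zero_mem (natCast_mem _ ℓ)
  refine mem_X_iff.mpr ⟨hq, le_antisymm ?_ ?_⟩
  · rintro _ ⟨y, hy, rfl⟩
    obtain ⟨n, hn⟩ := polar_mem (m := m) hv hy
    refine ⟨n, ?_⟩
    rw [polar_eq_two_phi] at hn
    simp only [eq_intCast] at hn
    change n • (2⁻¹ : ℚ) = phi ℚ m v y
    rw [zsmul_eq_mul, hn]
    ring
  · choose n hn using fun i : Fin 4 => polar_mem (m := m) hv (basis_mem_lattice (O := ZZ) i)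
    have hn' : ∀ i, QuadraticMap.polar (quad ℚ m) v (Pi.single i 1) = n i := fun i => (hn i).symm
    obtain ⟨c, hc⟩ := exists_sum_mul_eq_one (n := n) fun p => by
      obtain ⟨c, hc, h⟩ := H p
      refine exists_not_dvd_of_sum_eq_one (y := c.1 ![0, 0, 0, 1]) ((hc _).mpr
        (vec4_mem_lattice (Zp p).zero_mem (Zp p).zero_mem (Zp p).zero_mem (Zp p).one_mem)) ?_
      rw [← polar_castV_left hn', h, polar_tau, polar_eq]
      simp [xi, bS]
    rw [AddSubgroup.zmultiples_le]
    refine ⟨fun i => (c i : ℚ), fun i => ⟨c i, rfl⟩, ?_⟩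
    have h2 := polar_castV_left hn' fun i => (c i : ℚ)
    rw [show castV ℚ v = v from funext fun i => Rat.cast_id _, polar_eq_two_phi] at h2
    have h3 : ∑ i, (c i : ℚ) * n i = 1 := by exact_mod_cast congrArg (Int.cast : ℤ → ℚ) hc
    rw [h3] at h2
    exact eq_inv_of_mul_eq_one_right h2

end IntegralVectors
end QuadSpace

/-! ### Adelic double cosets and orbits of integral vectors -/

namespace QuadSpace
open CliffordAlgebra Filter

section AdelicOrbits
variable {m ℓ : ℕ}

theorem memMulJ_iff (hp : ∀ p : Nat.Primes, (ℓ : ℚ_[p]) ≠ 0) {α : GV ℚ m} {ε : GWA m ℓ} :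
    MemMulJ α ε ↔ ∀ p : Nat.Primes,
      (castG ℚ_[p] α)⁻¹ * inclG ℚ_[p] m (hp p) (ε.2 p) ∈ unitG (Zp p) m := by
  refine forall_congr' fun p => ?_
  rw [← coe_inclG (hp p), ← coe_castG]
  constructor
  · rintro ⟨j, hj, h⟩
    have h' : inclG ℚ_[p] m (hp p) (ε.2 p) = castG ℚ_[p] α * j := Subtype.ext h
    rwa [h', inv_mul_cancel_left]
  · exact fun h => ⟨_, h, congrArg Subtype.val (mul_inv_cancel_left (castG ℚ_[p] α)
      (inclG ℚ_[p] m (hp p) (ε.2 p))).symm⟩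

theorem exists_memMulJ (hm : Squarefree m) (hp : ∀ p : Nat.Primes, (ℓ : ℚ_[p]) ≠ 0)
    (ε : GWA m ℓ) : ∃ α : GV ℚ m, MemMulJ α ε := by
  have h := Filter.eventually_cofinite.mp (eventually_inclG_mem_unitG hm hp ε)
  obtain ⟨α, hα⟩ := exists_rational_approx hm h.toFinset
    (fun p => inclG ℚ_[p] m (hp p) (ε.2 p)) (fun p hS => by
      simpa using hS)
  exact ⟨α, (memMulJ_iff hp).mpr hα⟩

/-- Class number one was obtained for G⁺(V₀). The components at the finitely many bad primes are
lifted through τ; elsewhere the component lies in C_p and the lift 1 suffices. -/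
theorem exists_memMulC (hm : Squarefree m) (hℓ : 0 < ℓ) (ε : HA m ℓ) :
    ∃ α : SOV ℚ m, MemMulC α ε := by
  have hp : ∀ p : Nat.Primes, (ℓ : ℚ_[p]) ≠ 0 := fun p => by exact_mod_cast hℓ.ne'
  choose g hg using fun p : Nat.Primes => exists_extends (hp p) (ε.2 p)
  have h := Filter.eventually_cofinite.mp (eventually_mem_stabilizer_of_extends hℓ ε)
  have hγ : ∀ p : Nat.Primes, ∃ γ : GV ℚ_[p] m, (p ∉ h.toFinset → γ ∈ unitG (Zp p) m) ∧
      (tau γ)⁻¹ * g p ∈ stabilizer (quad ℚ_[p] m) (lattice (Zp p)) := by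
    intro p
    by_cases hS : p ∈ h.toFinset
    · obtain ⟨γ, hγ⟩ := tau_surjective hm (g p)
      exact ⟨γ, fun h => absurd hS h, by rw [hγ, inv_mul_cancel]; exact one_mem _⟩
    · refine ⟨1, fun _ => one_mem _, ?_⟩
      rw [map_one, inv_one, one_mul]
      simp only [Set.Finite.mem_toFinset, Set.mem_ofPred_eq, not_not] at hS
      exact hS _ (hg p)
  choose γ hγ1 hγ2 using hγ
  obtain ⟨α, hα⟩ := exists_rational_approx hm h.toFinset γ hγ1
  refine ⟨tau α, fun p => ⟨(tau (castG ℚ_[p] α))⁻¹ * g p, ?_, tau (castG ℚ_[p] α),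
    isCastV_tau_castG α, by rw [mul_inv_cancel_left]; exact hg p⟩⟩
  have h1 := mul_mem (mem_unitG_iff.mp (hα p)).1 (hγ2 p)
  rw [map_mul, map_inv] at h1
  simpa [mul_assoc] using h1

theorem MemMulJ.memMulC (hℓ : 0 < ℓ) {α : GV ℚ m} {ε : GWA m ℓ} (h : MemMulJ α ε) :
    MemMulC (tau α) (tauA m ℓ ε) := by
  have hp : ∀ p : Nat.Primes, (ℓ : ℚ_[p]) ≠ 0 := fun p => by exact_mod_cast hℓ.ne'
  intro p
  refine ⟨_, (mem_unitG_iff.mp ((memMulJ_iff hp).mp h p)).1, _, isCastV_tau_castG α, ?_⟩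
  rw [← map_mul, mul_inv_cancel_left]
  exact extends_tau_inclG (hp p) (ε.2 p)

theorem quad_xi {F : Type*} [Field F] [CharZero F] : quad F m (xi F ℓ) = ℓ := phi_xi_xi

theorem MemMulC.mem_X {α : SOV ℚ m} {ε : HA m ℓ} (h : MemMulC α ε) :
    α⁻¹.1 (xi ℚ ℓ) ∈ X m ℓ := by
  refine mem_X_of_local ((α⁻¹.2.1 _).trans quad_xi) fun p => ?_
  obtain ⟨c, hc, a, ha, he⟩ := h p
  refine ⟨c, hc, ?_⟩
  rw [← ha.inv, castV_xi, SOV_inv_apply_eq]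
  exact he.1.symm

theorem MemMulJ.mem_X (hℓ : 0 < ℓ) {α : GV ℚ m} {ε : GWA m ℓ} (h : MemMulJ α ε) :
    (tau α)⁻¹.1 (xi ℚ ℓ) ∈ X m ℓ := (h.memMulC hℓ).mem_X

theorem orbHat_eq_iff {v w : X m ℓ} :
    orbHat v = orbHat w ↔ ∃ γ ∈ GamHat m, γ.1.1 w.1 = v.1 := by
  rw [orbHat, orbHat, Quotient.eq'', MulAction.orbitRel_apply]
  constructor
  · rintro ⟨γ, h⟩
    exact ⟨γ.1, γ.2, congrArg Subtype.val h⟩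
  · rintro ⟨γ, hγ, h⟩
    exact ⟨⟨γ, hγ⟩, Subtype.ext h⟩

theorem orb_eq_iff {v w : X m ℓ} : orb v = orb w ↔ ∃ γ ∈ Gam m, γ.1 w.1 = v.1 := by
  rw [orb, orb, Quotient.eq'', MulAction.orbitRel_apply]
  constructor
  · rintro ⟨γ, h⟩
    exact ⟨γ.1, γ.2, congrArg Subtype.val h⟩
  · rintro ⟨γ, hγ, h⟩
    exact ⟨⟨γ, hγ⟩, Subtype.ext h⟩

theorem orbHat_eq_of_memMulJ (hm : Squarefree m) (hℓ : 0 < ℓ) {α α' : GV ℚ m} {ε a b : GWA m ℓ}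
    (ha : a ∈ GWQ m ℓ) (hb : b ∈ GWJ m ℓ) (h : MemMulJ α ε) (h' : MemMulJ α' (a * ε * b)) :
    orbHat ⟨_, h.mem_X hℓ⟩ = orbHat ⟨_, h'.mem_X hℓ⟩ := by
  have hp : ∀ p : Nat.Primes, (ℓ : ℚ_[p]) ≠ 0 := fun p => by exact_mod_cast hℓ.ne'
  have hQ : (ℓ : ℚ) ≠ 0 := by exact_mod_cast hℓ.ne'
  obtain ⟨γ, -, hγ⟩ := ha
  -- At every p this rational element is a product of elements of J_p and their inverses. As γ fixes
  -- ξ, τ(β) takes τ(α)⁻¹ξ to τ(α')⁻¹ξ.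
  set β := α'⁻¹ * inclG ℚ m hQ γ * α with hβ
  have hβJ : ∀ p : Nat.Primes, castG ℚ_[p] β ∈ unitG (Zp p) m := by
    intro p
    have h1 := (memMulJ_iff hp).mp h p
    have h2 := (memMulJ_iff hp).mp h' p
    have h3 := (mem_levelG_iff (hp p)).mp (hb p)
    have h4 := (inclG_eq_castG_iff hQ (hp p)).mp (hγ p)
    have h5 : (a * ε * b).2 p = a.2 p * ε.2 p * b.2 p := rfl
    have h6 := mul_mem (mul_mem h2 (inv_mem h3)) (inv_mem h1)
    rw [h5, map_mul, map_mul, h4] at h6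
    rw [hβ, map_mul, map_mul, map_inv]
    convert h6 using 1
    group
  have hG : tau β ∈ Gam m := mem_Gam_of_local fun p =>
    ⟨_, (mem_unitG_iff.mp (hβJ p)).1, isCastV_tau_castG β⟩
  have hGH : (⟨tau β, hG⟩ : Gam m) ∈ GamHat m := mem_GamHat_of_local hm fun p =>
    ⟨_, tau_mem_discKernel_of_mem_unitG hm (hβJ p), isCastV_tau_castG β⟩
  symm
  refine orbHat_eq_iff.mpr ⟨_, hGH, ?_⟩
  change (tau β).1 ((tau α)⁻¹.1 (xi ℚ ℓ)) = (tau α')⁻¹.1 (xi ℚ ℓ)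
  rw [hβ, map_mul, map_mul, SOV_mul_apply, SOV_apply_inv_apply, SOV_mul_apply,
    (extends_tau_inclG hQ γ).1, map_inv]

theorem inv_mul_mem_levelG {F : Type*} [Field F] [CharZero F] {O : Subring F} (hℓ : (ℓ : F) ≠ 0)
    {α α' β : GV F m} {a e e' : GW F m ℓ} (ha : inclG F m hℓ a = α' * β * α⁻¹)
    (hβ : β ∈ unitG O m) (h : α⁻¹ * inclG F m hℓ e ∈ unitG O m)
    (h' : α'⁻¹ * inclG F m hℓ e' ∈ unitG O m) : (a * e)⁻¹ * e' ∈ levelG m ℓ O := by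
  have h1 : inclG F m hℓ ((a * e)⁻¹ * e') =
      (α⁻¹ * inclG F m hℓ e)⁻¹ * β⁻¹ * (α'⁻¹ * inclG F m hℓ e') := by
    rw [map_mul, map_inv, map_mul, ha]
    group
  rw [mem_levelG_iff hℓ, h1]
  exact mul_mem (mul_mem (inv_mem h) (inv_mem hβ)) h'

theorem exists_mul_of_orbHat_eq (hm : Squarefree m) (hℓ : 0 < ℓ) {α α' : GV ℚ m} {ε ε' : GWA m ℓ}
    (h : MemMulJ α ε) (h' : MemMulJ α' ε')
    (ho : orbHat ⟨_, h.mem_X hℓ⟩ = orbHat ⟨_, h'.mem_X hℓ⟩) :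
    ∃ a ∈ GWQ m ℓ, ∃ b ∈ GWJ m ℓ, ε' = a * ε * b := by
  have hp : ∀ p : Nat.Primes, (ℓ : ℚ_[p]) ≠ 0 := fun p => by exact_mod_cast hℓ.ne'
  have hQ : (ℓ : ℚ) ≠ 0 := by exact_mod_cast hℓ.ne'
  obtain ⟨γ, hγ, hv⟩ := orbHat_eq_iff.mp ho.symm
  obtain ⟨β, hβ, hβJ⟩ := exists_lift_of_mem_GamHat hm hγ
  have hv' : (tau β).1 ((tau α)⁻¹.1 (xi ℚ ℓ)) = (tau α')⁻¹.1 (xi ℚ ℓ) := hβ ▸ hv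
  -- The choice of β makes α'βα⁻¹ fix ξ, so it is a rational element of G⁺(W). It carries ε to ε' up
  -- to the level group.
  obtain ⟨γ₀, hγ₀⟩ := exists_inclG_eq hQ (γ := α' * β * α⁻¹) (by
    rw [map_mul, map_mul, SOV_mul_apply, SOV_mul_apply, map_inv, hv', SOV_apply_inv_apply])
  obtain ⟨a, ha, hap⟩ := exists_mem_GWQ hQ hp γ₀
  refine ⟨a, ha, (a * ε)⁻¹ * ε', fun p => ?_, (mul_inv_cancel_left (a * ε) ε').symm⟩
  exact inv_mul_mem_levelG (hp p) (by rw [hap, hγ₀, map_mul, map_mul, map_inv]) (hβJ p)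
    ((memMulJ_iff hp).mp h p) ((memMulJ_iff hp).mp h' p)

/-- Over ℚ some α moves v to ξ, and at each p some j in J_p does the same. Then αj⁻¹ fixes ξ, hence
lies in G⁺(W ⊗ ℚ_p), and serves as the p-component of ε. -/
theorem exists_memMulJ_of_mem_X (hm : Squarefree m) (hℓ : 0 < ℓ) {v : Fin 4 → ℚ}
    (hv : v ∈ X m ℓ) : ∃ (ε : GWA m ℓ) (α : GV ℚ m), MemMulJ α ε ∧ (tau α)⁻¹.1 (xi ℚ ℓ) = v := by
  have hp : ∀ p : Nat.Primes, (ℓ : ℚ_[p]) ≠ 0 := fun p => by exact_mod_cast hℓ.ne'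
  have hq : quad ℚ m v = ℓ := hv.1
  have hL := mem_lattice_of_mem_X hm hv
  obtain ⟨w, hw, hvw⟩ := exists_polar_eq_one_of_mem_X hv
  obtain ⟨α, -, hα⟩ := exists_elemGroup_of_primitive (O := (⊤ : Subring ℚ)) isLocalIn_top
    (fun _ => Subring.mem_top _) (fun _ => Subring.mem_top _) hvw
  rw [hq] at hα
  have hj : ∀ p : Nat.Primes, ∃ j ∈ unitG (Zp p) m,
      (tau j).1 (castV ℚ_[p] v) = xi ℚ_[p] ℓ := by
    intro p
    obtain ⟨j, hj, h⟩ := exists_elemGroup_of_primitive (m := m) (isLocalIn_Zp (p := p))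
      (mem_lattice_ZZ_iff.mp hL p) (mem_lattice_ZZ_iff.mp hw p)
      (by rw [polar_castV, hvw, Rat.cast_one])
    refine ⟨j, elemGroup_le_unitG hj, ?_⟩
    rw [h, quad_castV, hq, Rat.cast_natCast]
    rfl
  -- The component is taken to be 1 wherever α is already in J_p, that is, at almost all primes;
  -- this puts the family in the restricted product.
  have he : ∀ p : Nat.Primes, ∃ e : GW ℚ_[p] m ℓ,
      (castG ℚ_[p] α ∈ unitG (Zp p) m → e = 1) ∧
      (castG ℚ_[p] α)⁻¹ * inclG ℚ_[p] m (hp p) e ∈ unitG (Zp p) m := by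
    intro p
    by_cases hα' : castG ℚ_[p] α ∈ unitG (Zp p) m
    · exact ⟨1, fun _ => rfl, by rw [map_one, mul_one]; exact inv_mem hα'⟩
    · obtain ⟨j, hj, hjv⟩ := hj p
      obtain ⟨e, he⟩ := exists_inclG_eq (hp p) (γ := castG ℚ_[p] α * j⁻¹) (by
        rw [map_mul, SOV_mul_apply, map_inv, (SOV_inv_apply_eq m).mpr hjv.symm, isCastV_tau_castG, hα]
        exact castV_xi ℚ_[p])
      exact ⟨e, fun h => absurd h hα', by rw [he, inv_mul_cancel_left]; exact inv_mem hj⟩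
  choose e he1 he2 using he
  refine ⟨(1, ⟨e, ?_⟩), α, (memMulJ_iff hp).mpr he2, (SOV_inv_apply_eq m).mpr hα.symm⟩
  filter_upwards [eventually_castG_mem_unitG hm α] with p h
  rw [he1 p h]
  exact one_mem _

theorem orb_eq_of_memMulC (hℓ : 0 < ℓ) {α α' : SOV ℚ m} {ε a b : HA m ℓ}
    (ha : a ∈ HQ m ℓ) (hb : b ∈ HC m ℓ) (h : MemMulC α ε) (h' : MemMulC α' (a * ε * b)) :
    orb ⟨_, h.mem_X⟩ = orb ⟨_, h'.mem_X⟩ := by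
  have hp : ∀ p : Nat.Primes, (ℓ : ℚ_[p]) ≠ 0 := fun p => by exact_mod_cast hℓ.ne'
  have hQ : (ℓ : ℚ) ≠ 0 := by exact_mod_cast hℓ.ne'
  obtain ⟨γ, -, hγ⟩ := ha
  obtain ⟨g, hg⟩ := exists_extends hQ γ
  symm
  refine orb_eq_iff.mpr ⟨α'⁻¹ * g * α, mem_Gam_of_local fun p => ?_, ?_⟩
  · obtain ⟨c, hc, A, hA, hE⟩ := h p
    obtain ⟨c', hc', A', hA', hE'⟩ := h' p
    obtain ⟨d, hd, hE₁⟩ := hb p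
    obtain ⟨G, hG⟩ := exists_extends (hp p) (a.2 p)
    have h1 := ((hG.mul hE).mul hE₁).unique (hp p) hE'
    refine ⟨A'⁻¹ * G * A, ?_, (hA'.inv.mul ((isCastW_iff (hp p) hg hG).mp (hγ p))).mul hA⟩
    have h2 : A'⁻¹ * G * A = c' * d⁻¹ * c⁻¹ := by
      rw [eq_mul_inv_iff_mul_eq, eq_mul_inv_iff_mul_eq, mul_assoc, mul_assoc, mul_assoc,
        inv_mul_eq_iff_eq_mul, ← h1]
      simp only [mul_assoc]
    rw [h2]
    exact mul_mem (mul_mem hc' (inv_mem hd)) (inv_mem hc)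
  · change (α'⁻¹ * g * α).1 (α⁻¹.1 (xi ℚ ℓ)) = α'⁻¹.1 (xi ℚ ℓ)
    rw [SOV_mul_apply, SOV_apply_inv_apply, SOV_mul_apply, hg.1]

theorem IsCastV.mem_stabilizer {γ : SOV ℚ m} (hγ : γ ∈ Gam m) {p : Nat.Primes} {g : SOV ℚ_[p] m}
    (hg : IsCastV γ g) : g ∈ QuadSpace.stabilizer (quad ℚ_[p] m) (lattice (Zp p)) := by
  have key : ∀ (γ : SOV ℚ m) (g : SOV ℚ_[p] m), γ ∈ Gam m → IsCastV γ g →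
      ∀ v ∈ lattice (Zp p), g.1 v ∈ lattice (Zp p) := by
    intro γ g hγ hg v hv
    have h1 : ∀ x ∈ lattice ZZ, castV ℚ_[p] (γ.1 x) ∈ lattice (Zp p) := fun x hx =>
      mem_lattice_ZZ_iff.mp ((hγ x).mpr hx) p
    have h0 := ZZ.zero_mem
    have h2 := ZZ.one_mem
    rw [castV_span _ v]
    simp only [map_add, map_smul, hg _]
    exact add_mem (add_mem (add_mem
      (smul_mem_lattice (hv 0) (h1 _ (vec4_mem_lattice h2 h0 h0 h0)))
      (smul_mem_lattice (hv 1) (h1 _ (vec4_mem_lattice h0 h2 h0 h0))))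
      (smul_mem_lattice (hv 2) (h1 _ (vec4_mem_lattice h0 h0 h2 h0))))
      (smul_mem_lattice (hv 3) (h1 _ (vec4_mem_lattice h0 h0 h0 h2)))
  exact mem_stabilizer_of (key γ g hγ hg) (key γ⁻¹ g⁻¹ (inv_mem hγ) hg.inv)

/-- Here α'γα⁻¹ with γ in Γ(L₀) fixes ξ and gives the rational factor directly. No lift to the
Clifford group is involved, which is why Γ(L₀) replaces Γ̂(L₀). -/
theorem exists_mul_of_orb_eq (hm : Squarefree m) (hℓ : 0 < ℓ) {α α' : SOV ℚ m} {ε ε' : HA m ℓ}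
    (h : MemMulC α ε) (h' : MemMulC α' ε') (ho : orb ⟨_, h.mem_X⟩ = orb ⟨_, h'.mem_X⟩) :
    ∃ a ∈ HQ m ℓ, ∃ b ∈ HC m ℓ, ε' = a * ε * b := by
  have hp : ∀ p : Nat.Primes, (ℓ : ℚ_[p]) ≠ 0 := fun p => by exact_mod_cast hℓ.ne'
  have hQ : (ℓ : ℚ) ≠ 0 := by exact_mod_cast hℓ.ne'
  obtain ⟨γ, hγ, hv⟩ := orb_eq_iff.mp ho.symm
  change γ.1 (α⁻¹.1 (xi ℚ ℓ)) = α'⁻¹.1 (xi ℚ ℓ) at hv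
  obtain ⟨γ₀, hγ₀⟩ := exists_extends_of_apply_xi hQ (g := α' * γ * α⁻¹) (by
    rw [SOV_mul_apply, SOV_mul_apply, hv, SOV_apply_inv_apply])
  obtain ⟨a, ha, hap⟩ := exists_mem_HQ hm hℓ γ₀
  refine ⟨a, ha, (a * ε)⁻¹ * ε', fun p => ?_, (mul_inv_cancel_left (a * ε) ε').symm⟩
  obtain ⟨c, hc, A, hA, hE⟩ := h p
  obtain ⟨c', hc', A', hA', hE'⟩ := h' p
  obtain ⟨g, hg⟩ := exists_extends (hp p) (a.2 p)
  obtain ⟨G, hG⟩ := exists_isCastV (F := ℚ_[p]) hm γ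
  have h1 : g = A' * G * A⁻¹ :=
    ((isCastW_iff (hp p) hγ₀ hg).mp (hap p)).unique ((hA'.mul hG).mul hA.inv)
  refine ⟨_, ?_, (hg.mul hE).inv.mul hE'⟩
  have h2 : (g * (A * c))⁻¹ * (A' * c') = c⁻¹ * G⁻¹ * c' := by
    rw [h1]
    group
  rw [h2]
  exact mul_mem (mul_mem (inv_mem hc) (inv_mem (hG.mem_stabilizer hγ))) hc'

end AdelicOrbits
end QuadSpace
-- Construction of κ and λ
theorem mainTheorem9 (m ℓ : ℕ) (hm : Squarefree m) (hℓ : 0 < ℓ) :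
    (∀ ε : GWA m ℓ, ∃ α : GV ℚ m, MemMulJ α ε) ∧
    (∀ ε' : HA m ℓ, ∃ α' : SOV ℚ m, MemMulC α' ε') ∧
    ∃ (kappa : ClassesG m ℓ → OrbitsHat m ℓ) (lam : ClassesH m ℓ → Orbits m ℓ),
      (∀ (ε : GWA m ℓ) (α : GV ℚ m), MemMulJ α ε →
        ∃ h : (tau α)⁻¹.1 (xi ℚ ℓ) ∈ X m ℓ,
          kappa (DoubleCoset.mk (GWQ m ℓ) (GWJ m ℓ) ε) = orbHat ⟨_, h⟩) ∧
      (∀ (ε' : HA m ℓ) (α' : SOV ℚ m), MemMulC α' ε' →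
        ∃ h : (α')⁻¹.1 (xi ℚ ℓ) ∈ X m ℓ,
          lam (DoubleCoset.mk (HQ m ℓ) (HC m ℓ) ε') = orb ⟨_, h⟩) ∧
      Function.Bijective kappa ∧ Function.Bijective lam ∧
      ∀ x : ClassesG m ℓ, lam (tauClasses m ℓ x) = iota m ℓ (kappa x) := by
  have hp : ∀ p : Nat.Primes, (ℓ : ℚ_[p]) ≠ 0 := fun p => by exact_mod_cast hℓ.ne'
  have hJ : ∀ ε : GWA m ℓ, ∃ α : GV ℚ m, MemMulJ α ε := exists_memMulJ hm hp
  have hC : ∀ ε : HA m ℓ, ∃ α : SOV ℚ m, MemMulC α ε := exists_memMulC hm hℓ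
  -- Read from left to right this is independence of all choices; from right to left it is
  -- injectivity of κ.
  have hkap : ∀ (ε ε' : GWA m ℓ) (α α' : GV ℚ m) (h : MemMulJ α ε) (h' : MemMulJ α' ε'),
      DoubleCoset.mk (GWQ m ℓ) (GWJ m ℓ) ε = DoubleCoset.mk (GWQ m ℓ) (GWJ m ℓ) ε' ↔
        orbHat ⟨_, h.mem_X hℓ⟩ = orbHat ⟨_, h'.mem_X hℓ⟩ := by
    intro ε ε' α α' h h'
    rw [DoubleCoset.eq]
    constructor
    · rintro ⟨a, ha, b, hb, rfl⟩
      exact orbHat_eq_of_memMulJ hm hℓ ha hb h h'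
    · exact exists_mul_of_orbHat_eq hm hℓ h h'
  have hlam : ∀ (ε ε' : HA m ℓ) (α α' : SOV ℚ m) (h : MemMulC α ε) (h' : MemMulC α' ε'),
      DoubleCoset.mk (HQ m ℓ) (HC m ℓ) ε = DoubleCoset.mk (HQ m ℓ) (HC m ℓ) ε' ↔
        orb ⟨_, h.mem_X⟩ = orb ⟨_, h'.mem_X⟩ := by
    intro ε ε' α α' h h'
    rw [DoubleCoset.eq]
    constructor
    · rintro ⟨a, ha, b, hb, rfl⟩
      exact orb_eq_of_memMulC hℓ ha hb h h'
    · exact exists_mul_of_orb_eq hm hℓ h h'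
  -- The value is computed from a chosen representative and a chosen α; `hkappa` shows that any
  -- other choice gives the same orbit.
  let kappa : ClassesG m ℓ → OrbitsHat m ℓ := fun x =>
    orbHat ⟨_, (hJ x.out).choose_spec.mem_X hℓ⟩
  let lam : ClassesH m ℓ → Orbits m ℓ := fun x => orb ⟨_, (hC x.out).choose_spec.mem_X⟩
  have hkappa : ∀ (ε : GWA m ℓ) (α : GV ℚ m) (h : MemMulJ α ε),
      kappa (DoubleCoset.mk (GWQ m ℓ) (GWJ m ℓ) ε) = orbHat ⟨_, h.mem_X hℓ⟩ := fun ε α h =>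
    (hkap _ _ _ _ (hJ _).choose_spec h).mp (DoubleCoset.out_eq' _ _ _)
  have hlambda : ∀ (ε : HA m ℓ) (α : SOV ℚ m) (h : MemMulC α ε),
      lam (DoubleCoset.mk (HQ m ℓ) (HC m ℓ) ε) = orb ⟨_, h.mem_X⟩ := fun ε α h =>
    (hlam _ _ _ _ (hC _).choose_spec h).mp (DoubleCoset.out_eq' _ _ _)
  have hcomm : ∀ x : ClassesG m ℓ, lam (tauClasses m ℓ x) = iota m ℓ (kappa x) := by
    intro x
    induction x using Quotient.inductionOn' with
    | h ε =>
      obtain ⟨α, h⟩ := hJ ε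
      exact (hlambda _ _ (h.memMulC hℓ)).trans (congrArg (iota m ℓ) (hkappa ε α h).symm)
  have hsurj : Function.Surjective kappa := by
    intro o
    induction o using Quotient.inductionOn' with
    | h v =>
      obtain ⟨ε, α, h, hv⟩ := exists_memMulJ_of_mem_X hm hℓ v.2
      exact ⟨_, (hkappa ε α h).trans (congrArg orbHat (Subtype.ext hv))⟩
  refine ⟨hJ, hC, kappa, lam, fun ε α h => ⟨h.mem_X hℓ, hkappa ε α h⟩,
    fun ε α h => ⟨h.mem_X, hlambda ε α h⟩, ⟨?_, hsurj⟩, ⟨?_, ?_⟩, hcomm⟩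
  · intro x y
    induction x using Quotient.inductionOn' with
    | h ε =>
      induction y using Quotient.inductionOn' with
      | h ε' =>
        intro hxy
        obtain ⟨α, h⟩ := hJ ε
        obtain ⟨α', h'⟩ := hJ ε'
        exact (hkap ε ε' α α' h h').mpr ((hkappa ε α h).symm.trans (hxy.trans (hkappa ε' α' h')))
  · intro x y
    induction x using Quotient.inductionOn' with
    | h ε =>
      induction y using Quotient.inductionOn' with
      | h ε' =>
        intro hxy
        obtain ⟨α, h⟩ := hC ε
        obtain ⟨α', h'⟩ := hC ε'
        exact (hlam ε ε' α α' h h').mpr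
          ((hlambda ε α h).symm.trans (hxy.trans (hlambda ε' α' h')))
  · intro o
    induction o using Quotient.inductionOn' with
    | h v =>
      -- Since κ and ι are onto, λ∘τ = ι∘κ makes λ onto.
      obtain ⟨x, hx⟩ := hsurj (orbHat v)
      exact ⟨tauClasses m ℓ x, (hcomm x).trans (congrArg (iota m ℓ) hx)⟩
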